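/- Let $(\Lambda V,\partial)$ be a simply connected minimal Sullivan algebra over $\mathbb{Q}$: $V=\bigoplus_{i\ge 2}V^i$ is a graded rational vector space, $\Lambda V$ is the free commutative graded algebra on $V$, $\partial$ is a derivation of degree $+1$ with $\partial^2=0$ satisfying the Sullivan nilpotence condition, and $\partial V\subseteq \Lambda^{\ge 2}V$. Suppose that it is elliptic, i.e. $\dim H^*(\Lambda V)<\infty$ and $\dim V<\infty$, and let $n=\max\{i : H^i(\Lambda V)\neq 0\}$ be its formal dimension. For $i\ge 2$ put $$L^i=H^i\big(\Lambda(V^{\le i-2}),\partial\big),$$ where $\Lambda(V^{\le i-2})\subseteq\Lambda V$ is the ($\partial$-stable) subalgebra generated by $V^{\le i-2}$. Then every $L^i$ is finite dimensional and only finitely many of them are nonzero, so that $$\rho_{\Lambda V}=1+(\dim L^4+\dim L^6+\cdots)-(\dim L^5+\dim L^7+\cdots)$$ is a well-defined integer, and $$0\le \rho_{\Lambda V}-\sum_{i=4}^{n+1}(-1)^i\dim L^i\le 2$$ (the sum being empty if $n+1<4$). -/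

import Mathlib

open scoped DirectSum

universe u

/-- The relations `x ⊗ y = (-1)^{ij} y ⊗ x` for `x ∈ V^i`, `y ∈ V^j`, in the tensor algebra
of the total space of a graded rational vector space `V`. -/
inductive FreeCGA.Rel (V : ℕ → Type u) [∀ i, AddCommGroup (V i)] [∀ i, Module ℚ (V i)] :
    TensorAlgebra ℚ (⨁ i, V i) → TensorAlgebra ℚ (⨁ i, V i) → Prop
  | comm (i j : ℕ) (x : V i) (y : V j) :
      FreeCGA.Rel V
        (TensorAlgebra.ι ℚ (DirectSum.lof ℚ ℕ V i x) * TensorAlgebra.ι ℚ (DirectSum.lof ℚ ℕ V j y))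
        ((-1 : ℚ) ^ (i * j) •
          (TensorAlgebra.ι ℚ (DirectSum.lof ℚ ℕ V j y) *
            TensorAlgebra.ι ℚ (DirectSum.lof ℚ ℕ V i x)))

/-- The free commutative graded algebra `ΛV` on the graded rational vector space `V`. -/
def FreeCGA (V : ℕ → Type u) [∀ i, AddCommGroup (V i)] [∀ i, Module ℚ (V i)] : Type u :=
  RingQuot (FreeCGA.Rel V)

namespace FreeCGA

variable (V : ℕ → Type u) [∀ i, AddCommGroup (V i)] [∀ i, Module ℚ (V i)]

noncomputable instance instSemiring : Semiring (FreeCGA V) :=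
  inferInstanceAs (Semiring (RingQuot (Rel V)))

noncomputable instance instAlgebra : Algebra ℚ (FreeCGA V) :=
  inferInstanceAs (Algebra ℚ (RingQuot (Rel V)))

noncomputable instance instRing : Ring (FreeCGA V) :=
  Algebra.semiringToRing ℚ

/-- The quotient map from the tensor algebra to `ΛV`. -/
noncomputable def mk : TensorAlgebra ℚ (⨁ i, V i) →ₐ[ℚ] FreeCGA V :=
  RingQuot.mkAlgHom ℚ (Rel V)

/-- The inclusion `V^i → ΛV`. -/
noncomputable def gen (i : ℕ) : V i →ₗ[ℚ] FreeCGA V :=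
  (mk V).toLinearMap ∘ₗ TensorAlgebra.ι ℚ ∘ₗ DirectSum.lof ℚ ℕ V i

/-- `IsMonomial V n m`: the element `m` of `ΛV` is a product `v₁ ⋯ v_r` (`r ≥ 0`) with
`v_s ∈ V^{i_s}` and `i_1 + ⋯ + i_r = n`. -/
inductive IsMonomial : ℕ → FreeCGA V → Prop
  | one : IsMonomial 0 1
  | mul (i j : ℕ) (x : V i) (m : FreeCGA V) :
      IsMonomial j m → IsMonomial (i + j) (gen V i x * m)

/-- The subspace `(ΛV)^n` of elements of degree `n`. -/
noncomputable def degreePart (n : ℕ) : Submodule ℚ (FreeCGA V) :=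
  Submodule.span ℚ {m | IsMonomial V n m}

/-- The image of `V` in `ΛV`. -/
noncomputable def generators : Submodule ℚ (FreeCGA V) :=
  ⨆ i, LinearMap.range (gen V i)

/-- `Λ^{≥ 2}V`, spanned by the products of at least two elements of `V`. -/
noncomputable def decomposables : Submodule ℚ (FreeCGA V) :=
  generators V * generators V * ⊤

/-- The subalgebra `ΛW` of `ΛV` generated by a graded subspace `W` of `V`. -/
noncomputable def sub (W : ∀ i, Submodule ℚ (V i)) : Subalgebra ℚ (FreeCGA V) :=
  Algebra.adjoin ℚ {a | ∃ (i : ℕ) (x : V i), x ∈ W i ∧ gen V i x = a}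

/-- The subalgebra `Λ(V^{≤ k})` of `ΛV`. -/
noncomputable def subLE (k : ℕ) : Subalgebra ℚ (FreeCGA V) :=
  sub V fun i => if i ≤ k then ⊤ else ⊥

end FreeCGA

/-- A Sullivan algebra `(ΛV, ∂)` over `ℚ`: a differential of degree `+1` on `ΛV` that is a graded
derivation, where `V` is concentrated in positive degrees and is the union of an increasing
sequence of graded subspaces `F 0 ⊆ F 1 ⊆ ⋯` with `∂ = 0` on `F 0` and
`∂ (F (k + 1)) ⊆ Λ(F k)`. -/
structure SullivanAlgebra (V : ℕ → Type u) [∀ i, AddCommGroup (V i)] [∀ i, Module ℚ (V i)] where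
  d : FreeCGA V →ₗ[ℚ] FreeCGA V
  d_mem : ∀ (i : ℕ) (a : FreeCGA V), a ∈ FreeCGA.degreePart V i →
    d a ∈ FreeCGA.degreePart V (i + 1)
  leibniz : ∀ (i : ℕ) (a b : FreeCGA V), a ∈ FreeCGA.degreePart V i →
    d (a * b) = d a * b + (-1 : ℚ) ^ i • (a * d b)
  d_d : ∀ a : FreeCGA V, d (d a) = 0
  positive : Subsingleton (V 0)
  nilpotent : ∃ F : ℕ → ∀ i, Submodule ℚ (V i),
    Monotone F ∧ (∀ (i : ℕ) (x : V i), ∃ k, x ∈ F k i) ∧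
    (∀ (i : ℕ) (x : V i), x ∈ F 0 i → d (FreeCGA.gen V i x) = 0) ∧
    ∀ (k i : ℕ) (x : V i), x ∈ F (k + 1) i → d (FreeCGA.gen V i x) ∈ FreeCGA.sub V (F k)

namespace SullivanAlgebra

variable {V : ℕ → Type u} [∀ i, AddCommGroup (V i)] [∀ i, Module ℚ (V i)]

/-- The cocycles of degree `i` in a subalgebra `S` of `ΛV`. -/
noncomputable def cocycles (A : SullivanAlgebra V) (S : Subalgebra ℚ (FreeCGA V)) (i : ℕ) :
    Submodule ℚ (FreeCGA V) :=
  Subalgebra.toSubmodule S ⊓ FreeCGA.degreePart V i ⊓ LinearMap.ker A.d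

/-- The coboundaries of degree `i` in a `∂`-stable subalgebra `S` of `ΛV`. -/
noncomputable def coboundaries (A : SullivanAlgebra V) (S : Subalgebra ℚ (FreeCGA V)) :
    ℕ → Submodule ℚ (FreeCGA V)
  | 0 => ⊥
  | i + 1 => (Subalgebra.toSubmodule S ⊓ FreeCGA.degreePart V i).map A.d

/-- The cohomology `H^i(S, ∂)` of a `∂`-stable subalgebra `S` of `ΛV`. -/
abbrev cohomologyOf (A : SullivanAlgebra V) (S : Subalgebra ℚ (FreeCGA V)) (i : ℕ) : Type u :=
  A.cocycles S i ⧸ (A.coboundaries S i).submoduleOf (A.cocycles S i)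

/-- The cohomology `H^i(ΛV, ∂)`. -/
abbrev H (A : SullivanAlgebra V) (i : ℕ) : Type u :=
  A.cohomologyOf ⊤ i

/-- `L^i = H^i(Λ(V^{≤ i-2}), ∂)`, for `i ≥ 2`. -/
abbrev L (A : SullivanAlgebra V) (i : ℕ) : Type u :=
  A.cohomologyOf (FreeCGA.subLE V (i - 2)) i

/-- `V^1 = 0` (and `V^0 = 0` holds for every Sullivan algebra). -/
def IsSimplyConnected (_A : SullivanAlgebra V) : Prop :=
  Subsingleton (V 1)

/-- Minimality: `∂V ⊆ Λ^{≥ 2}V`. -/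
def IsMinimal (A : SullivanAlgebra V) : Prop :=
  ∀ (i : ℕ) (x : V i), A.d (FreeCGA.gen V i x) ∈ FreeCGA.decomposables V

/-- Ellipticity: `dim H^*(ΛV) < ∞` and `dim V < ∞`. -/
def IsElliptic (A : SullivanAlgebra V) : Prop :=
  Module.Finite ℚ (⨁ i, A.H i) ∧ Module.Finite ℚ (⨁ i, V i)

/-- `n = max {i | H^i(ΛV) ≠ 0}`. -/
def IsFormalDimension (A : SullivanAlgebra V) (n : ℕ) : Prop :=
  IsGreatest {i | Nontrivial (A.H i)} n

/-- `ρ = 1 + (dim L^4 + dim L^6 + ⋯) - (dim L^5 + dim L^7 + ⋯)`. -/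
noncomputable def rho (A : SullivanAlgebra V) : ℤ :=
  1 + ((∑ᶠ j : ℕ, Module.finrank ℚ (A.L (2 * j + 4)) : ℕ) : ℤ) -
    ((∑ᶠ j : ℕ, Module.finrank ℚ (A.L (2 * j + 5)) : ℕ) : ℤ)

end SullivanAlgebra

/-! For `m ≥ n` the assignment `v ↦ [∂v]` is an isomorphism `V^{m+1} ≅ L^{m+2}`: it is injective
because `H^{m+1}(ΛV) = 0` and surjective because `H^{m+2}(ΛV) = 0` (`nonempty_equiv_L`). So `ρ`
minus the truncated sum equals `1 + ∑ (-1)^i dim V^{i-1}` over `i ≥ max(4, n+2)`, and only the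
generators of degree above `n` matter. None of them is even and at most one is odd
(`generators_of_large_degree`), so the difference is in fact 1 or 2.

The statement about generators comes from the degree inequalities of Friedlander and Halperin. Let
`x_i` be the even and `y_j` the odd generators, and let `f_j` be the part of `∂y_j` that is a
polynomial in the `x_i`.

(a) Every `x_i` is nilpotent modulo the `f_j` (`X_mem_radical_pureIdeal`). Adjoin to `ΛV` new
generators `ū` that kill the generators of degree below `|x|`. There `x` can be corrected to a
cocycle `z`, each term of which has a letter from `V`. The power `z^{n+1}` then has `V`-degree above
`n` and is a boundary (`exists_primitive`). Evaluation modulo the `f_j` and the lower even variables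
kills boundaries and sends `z` to `x`, so `x^{n+1} = 0` there (`pow_eq_zero_of_hom`). Induction on
the degree finishes.

(b) By Krull's height theorem and Hall's marriage theorem, the even generators are matched
injectively to odd ones with `2|x_i| ≤ |y_{m(i)}| + 1` (`exists_matching`).

(c) `∑|y_j| - ∑(|x_i| - 1) ≤ n` (`sum_odd_deg_le`). By (a) some powers `x_i^N` lift to central
cocycles `z_i`, which form a regular sequence. Dividing by `z_i` raises the bound on cohomological
degrees by `N|x_i| - 1`, whereas the top class `∏ x_i^{N-1} ∏ y_j` survives in the quotient by all
`z_i`.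

Now take away from each `|y_j|` the number `|x_i| - 1` of its partner, if there is one. By (c) the
remainders `u_j` have sum at most `n`; by (b), `u_{m(i)} ≥ |x_i|` and `2u_j ≥ |y_j| + 1`. Hence
`|x_i| ≤ n`, and two odd generators of degree above `n` would make the sum exceed `n`.

All this takes place in `SuperPoly`, the free algebra on a homogeneous basis of `V`; degree
conditions are expressed as membership in `wspan deg P`, a span of words whose exponent vectors
satisfy `P`. -/

/-- The sign relations `b c = (-1)^{|b||c|} c b` between generators `b`, `c`. -/
inductive SuperPoly.Rel {γ : Type*} (deg : γ → ℕ) : FreeAlgebra ℚ γ → FreeAlgebra ℚ γ → Prop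
  | comm (b c : γ) : SuperPoly.Rel deg (FreeAlgebra.ι ℚ b * FreeAlgebra.ι ℚ c)
      ((-1 : ℚ) ^ (deg b * deg c) • (FreeAlgebra.ι ℚ c * FreeAlgebra.ι ℚ b))

/-- The free graded commutative algebra on a set `γ` of generators of given degrees. -/
def SuperPoly {γ : Type*} (deg : γ → ℕ) : Type _ := RingQuot (SuperPoly.Rel deg)

namespace SuperPoly

/-! ### Free graded commutative algebras on a set of generators: signs and derivations. -/

section Basic

variable {γ : Type*} {deg : γ → ℕ}

noncomputable instance : Ring (SuperPoly deg) := inferInstanceAs (Ring (RingQuot (Rel deg)))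

noncomputable instance : Algebra ℚ (SuperPoly deg) :=
  inferInstanceAs (Algebra ℚ (RingQuot (Rel deg)))

variable (deg) in
/-- The generator of `SuperPoly deg` with index `b`. -/
noncomputable def X (b : γ) : SuperPoly deg :=
  RingQuot.mkAlgHom ℚ (Rel deg) (FreeAlgebra.ι ℚ b)

theorem X_mul_X (b c : γ) :
    X deg b * X deg c = (-1 : ℚ) ^ (deg b * deg c) • (X deg c * X deg b) := by
  have h := RingQuot.mkAlgHom_rel ℚ (Rel.comm (deg := deg) b c)
  rw [map_smul, map_mul, map_mul] at h
  exact h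

/-- The universal property of `SuperPoly deg`. -/
noncomputable def lift {C : Type*} [Ring C] [Algebra ℚ C] (f : γ → C)
    (hf : ∀ b c, f b * f c = (-1 : ℚ) ^ (deg b * deg c) • (f c * f b)) : SuperPoly deg →ₐ[ℚ] C :=
  RingQuot.liftAlgHom ℚ ⟨FreeAlgebra.lift ℚ f, by
    rintro _ _ ⟨b, c⟩
    simp [hf b c]⟩

@[simp]
theorem lift_X {C : Type*} [Ring C] [Algebra ℚ C] (f : γ → C)
    (hf : ∀ b c, f b * f c = (-1 : ℚ) ^ (deg b * deg c) • (f c * f b)) (b : γ) :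
    lift f hf (X deg b) = f b := by
  unfold lift X
  erw [RingQuot.liftAlgHom_mkAlgHom_apply]
  simp

/-- The product of a list of generators. -/
noncomputable def word (deg : γ → ℕ) (l : List γ) : SuperPoly deg := (l.map (X deg)).prod

@[simp] theorem word_nil : word deg [] = 1 := rfl

@[simp] theorem word_cons (b : γ) (l : List γ) : word deg (b :: l) = X deg b * word deg l := by
  simp [word]

theorem word_append (l l' : List γ) : word deg (l ++ l') = word deg l * word deg l' := by
  simp [word]

theorem span_word : Submodule.span ℚ (Set.range (word deg)) = ⊤ := by
  rw [eq_top_iff]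
  rintro x -
  obtain ⟨y, rfl⟩ := RingQuot.mkAlgHom_surjective ℚ (Rel deg) x
  induction y using FreeAlgebra.induction with
  | grade0 r =>
    rw [AlgHom.commutes, Algebra.algebraMap_eq_smul_one]
    exact Submodule.smul_mem _ _ (Submodule.subset_span ⟨[], rfl⟩)
  | grade1 b => exact Submodule.subset_span ⟨[b], by simp; rfl⟩
  | add a b ha hb => rw [map_add]; exact Submodule.add_mem _ ha hb
  | mul a b ha hb =>
    rw [map_mul]
    have := Submodule.mul_mem_mul ha hb
    rw [Submodule.span_mul_span] at this
    refine Submodule.span_mono ?_ this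
    rintro _ ⟨_, ⟨l, rfl⟩, _, ⟨l', rfl⟩, rfl⟩
    exact ⟨l ++ l', word_append l l'⟩

/-- Induction over words. -/
theorem word_induction {p : SuperPoly deg → Prop} (hw : ∀ l, p (word deg l))
    (hadd : ∀ x y, p x → p y → p (x + y)) (hsmul : ∀ (r : ℚ) x, p x → p (r • x))
    (x : SuperPoly deg) : p x := by
  have hx : x ∈ Submodule.span ℚ (Set.range (word deg)) := by rw [span_word]; trivial
  induction hx using Submodule.span_induction with
  | mem x h => obtain ⟨l, rfl⟩ := h; exact hw l
  | zero => simpa using hsmul 0 _ (hw [])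
  | add x y _ _ hx hy => exact hadd x y hx hy
  | smul r x _ hx => exact hsmul r x hx

theorem linearMap_ext {M : Type*} [AddCommGroup M] [Module ℚ M] {f g : SuperPoly deg →ₗ[ℚ] M}
    (h : ∀ l, f (word deg l) = g (word deg l)) : f = g := by
  ext x
  induction x using word_induction with
  | hw l => exact h l
  | hadd x y hx hy => simp [hx, hy]
  | hsmul r x hx => simp [hx]

theorem algHom_ext {C : Type*} [Ring C] [Algebra ℚ C] {f g : SuperPoly deg →ₐ[ℚ] C}
    (h : ∀ b, f (X deg b) = g (X deg b)) : f = g := by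
  have : f.toLinearMap = g.toLinearMap := linearMap_ext fun l => by
    induction l with
    | nil => simp
    | cons b l ih => simpa [h] using congrArg (g (X deg b) * ·) ih
  ext x
  exact LinearMap.congr_fun this x

/-! ### The parity automorphism -/

/-- The parity automorphism, multiplication by `(-1)^n` in degree `n`. -/
noncomputable def sgn : SuperPoly deg →ₐ[ℚ] SuperPoly deg :=
  lift (fun b => (-1 : ℚ) ^ deg b • X deg b) fun b c => by
    rw [smul_mul_smul_comm, smul_mul_smul_comm, X_mul_X b c, smul_smul, smul_smul]
    congr 1; ring

@[simp] theorem sgn_X (b : γ) : sgn (X deg b) = (-1 : ℚ) ^ deg b • X deg b := lift_X _ _ b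

/-- `HasParity i a` says that `a` is a sum of terms whose degree has the parity of `i`. -/
def HasParity (i : ℕ) (a : SuperPoly deg) : Prop := sgn a = (-1 : ℚ) ^ i • a

theorem hasParity_X (b : γ) : HasParity (deg b) (X deg b) := sgn_X b

theorem neg_one_pow_smul_self_smul {M : Type*} [AddCommGroup M] [Module ℚ M] (i : ℕ) (x : M) :
    (-1 : ℚ) ^ i • (-1 : ℚ) ^ i • x = x := by
  rw [smul_smul, ← pow_add, Even.neg_one_pow ⟨i, rfl⟩, one_smul]

theorem sgn_sgn (a : SuperPoly deg) : sgn (sgn a) = a := by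
  have : (sgn.comp sgn : SuperPoly deg →ₐ[ℚ] SuperPoly deg) = AlgHom.id ℚ _ :=
    algHom_ext fun b => by
      simp [neg_one_pow_smul_self_smul]
  exact DFunLike.congr_fun this a

theorem HasParity.add {i : ℕ} {a b : SuperPoly deg} (ha : HasParity i a) (hb : HasParity i b) :
    HasParity i (a + b) := by
  unfold HasParity at *; rw [map_add, ha, hb, smul_add]

theorem HasParity.neg {i : ℕ} {a : SuperPoly deg} (ha : HasParity i a) : HasParity i (-a) := by
  unfold HasParity at *; rw [map_neg, ha, smul_neg]

theorem HasParity.zero {i : ℕ} : HasParity i (0 : SuperPoly deg) := by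
  simp [HasParity]

theorem HasParity.mul {i j : ℕ} {a b : SuperPoly deg} (ha : HasParity i a) (hb : HasParity j b) :
    HasParity (i + j) (a * b) := by
  unfold HasParity at *; rw [map_mul, ha, hb, smul_mul_smul_comm, pow_add]

theorem HasParity.congr {i j : ℕ} {a : SuperPoly deg} (ha : HasParity i a)
    (h : (-1 : ℚ) ^ i = (-1 : ℚ) ^ j) : HasParity j a := by
  unfold HasParity at *; rw [ha, h]

theorem hasParity_one : HasParity 0 (1 : SuperPoly deg) := by simp [HasParity]

theorem hasParity_word (l : List γ) : HasParity (l.map deg).sum (word deg l) := by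
  induction l with
  | nil => simpa using hasParity_one
  | cons b l ih => simpa using (hasParity_X b).mul ih

/-- The iterates of the parity automorphism. -/
noncomputable def sgnPow (i : ℕ) : SuperPoly deg →ₐ[ℚ] SuperPoly deg :=
  lift (fun b => (-1 : ℚ) ^ (i * deg b) • X deg b) fun b c => by
    rw [smul_mul_smul_comm, smul_mul_smul_comm, X_mul_X b c, smul_smul, smul_smul]
    congr 1; ring

@[simp] theorem sgnPow_X (i : ℕ) (b : γ) :
    sgnPow i (X deg b) = (-1 : ℚ) ^ (i * deg b) • X deg b := lift_X _ _ b

theorem sgnPow_of_parity {i j : ℕ} (h : (-1 : ℚ) ^ i = (-1 : ℚ) ^ j) :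
    (sgnPow i : SuperPoly deg →ₐ[ℚ] SuperPoly deg) = sgnPow j :=
  algHom_ext fun b => by simp [pow_mul, h]

theorem sgnPow_zero (a : SuperPoly deg) : sgnPow 0 a = a := by
  have : (sgnPow 0 : SuperPoly deg →ₐ[ℚ] SuperPoly deg) = AlgHom.id ℚ _ :=
    algHom_ext fun b => by simp
  exact DFunLike.congr_fun this a

theorem sgnPow_one : (sgnPow 1 : SuperPoly deg →ₐ[ℚ] SuperPoly deg) = sgn :=
  algHom_ext fun b => by simp

theorem sgnPow_add (i j : ℕ) (a : SuperPoly deg) : sgnPow (i + j) a = sgnPow i (sgnPow j a) := by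
  have : (sgnPow (i + j) : SuperPoly deg →ₐ[ℚ] SuperPoly deg) = (sgnPow i).comp (sgnPow j) :=
    algHom_ext fun b => by simp [smul_smul, ← pow_add]; ring_nf
  exact DFunLike.congr_fun this a

theorem HasParity.sgnPow {i j : ℕ} {a : SuperPoly deg} (ha : HasParity j a) :
    sgnPow i a = (-1 : ℚ) ^ (i * j) • a := by
  induction i with
  | zero => simp [sgnPow_zero]
  | succ i ih =>
    rw [add_comm i 1, sgnPow_add, ih, map_smul, sgnPow_one, ha, smul_smul]
    congr 1; ring

theorem X_mul (b : γ) (x : SuperPoly deg) : X deg b * x = sgnPow (deg b) x * X deg b := by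
  induction x using word_induction with
  | hw l =>
    induction l with
    | nil => simp
    | cons c l ih =>
      rw [word_cons, ← mul_assoc, X_mul_X, smul_mul_assoc, mul_assoc, ih, map_mul, sgnPow_X,
        smul_mul_assoc, smul_mul_assoc, mul_assoc]
  | hadd x y hx hy => simp [mul_add, add_mul, hx, hy]
  | hsmul r x hx => simp [hx]

theorem word_mul (l : List γ) (x : SuperPoly deg) :
    word deg l * x = sgnPow (l.map deg).sum x * word deg l := by
  induction l generalizing x with
  | nil => simp [sgnPow_zero]
  | cons b l ih =>
    rw [word_cons, mul_assoc, ih, ← mul_assoc, X_mul, List.map_cons, List.sum_cons, sgnPow_add,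
      mul_assoc]

/-- Graded commutativity. -/
theorem HasParity.mul_comm' {i : ℕ} {a : SuperPoly deg} (ha : HasParity i a) (x : SuperPoly deg) :
    a * x = SuperPoly.sgnPow i x * a := by
  -- `a + (-1)^i • sgn a` is twice the component of parity `i`: it vanishes on words of the other
  -- parity, and words of the right parity are covered by `word_mul`.
  have key : ∀ a : SuperPoly deg, (a + (-1 : ℚ) ^ i • sgn a) * x =
      SuperPoly.sgnPow i x * (a + (-1 : ℚ) ^ i • sgn a) := by
    intro a
    induction a using word_induction with
    | hw l =>
      rw [hasParity_word l, smul_smul, ← pow_add]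
      rcases Nat.even_or_odd (i + (l.map deg).sum) with h | h
      · have h' : (-1 : ℚ) ^ (l.map deg).sum = (-1 : ℚ) ^ i := by
          rcases Nat.even_or_odd i with hi | hi
          · rw [hi.neg_one_pow, ((Nat.even_add.1 h).1 hi).neg_one_pow]
          · rw [hi.neg_one_pow, Odd.neg_one_pow]
            by_contra hc
            exact (Nat.not_even_iff_odd.2 hi) ((Nat.even_add.1 h).2 (Nat.not_odd_iff_even.1 hc))
        rw [h.neg_one_pow, one_smul, add_mul, mul_add, word_mul, sgnPow_of_parity h']
      · rw [h.neg_one_pow]; simp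
    | hadd a b ha hb =>
      have : ∀ a b : SuperPoly deg, (a + b) + (-1 : ℚ) ^ i • sgn (a + b) =
        (a + (-1 : ℚ) ^ i • sgn a) + (b + (-1 : ℚ) ^ i • sgn b) := by
        intro a b; rw [map_add, smul_add]; abel
      rw [this, add_mul, mul_add, ha, hb]
    | hsmul r a ha =>
      have : r • a + (-1 : ℚ) ^ i • sgn (r • a) = r • (a + (-1 : ℚ) ^ i • sgn a) := by
        rw [map_smul, smul_add, smul_comm]
      rw [this, smul_mul_assoc, mul_smul_comm, ha]
  have h2 := key a
  rw [ha, neg_one_pow_smul_self_smul, ← two_smul ℚ a, smul_mul_assoc, mul_smul_comm] at h2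
  exact smul_right_injective _ (two_ne_zero (α := ℚ)) h2

theorem HasParity.mul_comm {i j : ℕ} {a b : SuperPoly deg} (ha : HasParity i a)
    (hb : HasParity j b) : a * b = (-1 : ℚ) ^ (i * j) • (b * a) := by
  rw [ha.mul_comm', hb.sgnPow, smul_mul_assoc]

theorem HasParity.commute {a : SuperPoly deg} (ha : HasParity 0 a) (x : SuperPoly deg) :
    a * x = x * a := by
  rw [ha.mul_comm', sgnPow_zero]

/-- Algebra maps between free graded commutative algebras from values of the right parity. -/
noncomputable def hom {δ : Type*} {deg' : δ → ℕ} (f : γ → SuperPoly deg')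
    (hf : ∀ b, HasParity (deg b) (f b)) : SuperPoly deg →ₐ[ℚ] SuperPoly deg' :=
  lift f fun b c => (hf b).mul_comm (hf c)

@[simp] theorem hom_X {δ : Type*} {deg' : δ → ℕ} (f : γ → SuperPoly deg')
    (hf : ∀ b, HasParity (deg b) (f b)) (b : γ) : hom f hf (X deg b) = f b := lift_X _ _ b

theorem hom_sgn {δ : Type*} {deg' : δ → ℕ} (f : SuperPoly deg →ₐ[ℚ] SuperPoly deg')
    (hf : ∀ b, HasParity (deg b) (f (X deg b))) (x : SuperPoly deg) : f (sgn x) = sgn (f x) := by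
  have : f.comp sgn = sgn.comp f := algHom_ext fun b => by
    simp only [AlgHom.comp_apply, sgn_X, map_smul]; exact (hf b).symm
  exact DFunLike.congr_fun this x

theorem HasParity.map {δ : Type*} {deg' : δ → ℕ} {f : SuperPoly deg →ₐ[ℚ] SuperPoly deg'}
    (hf : ∀ x, f (sgn x) = sgn (f x)) {i : ℕ} {a : SuperPoly deg} (ha : HasParity i a) :
    HasParity i (f a) := by
  unfold HasParity at *; rw [← hf, ha, map_smul]

/-! ### Superderivations -/

/-- A linear map `D` with `D (a b) = D a · b + (-1)^{ε |a|} a · D b` that changes the parity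
by `ε`. -/
structure IsDer (ε : ℕ) (D : SuperPoly deg →ₗ[ℚ] SuperPoly deg) : Prop where
  leibniz : ∀ a b, D (a * b) = D a * b + sgnPow ε a * D b
  parity : ∀ a i, HasParity i a → HasParity (i + ε) (D a)

theorem IsDer.map_one {ε : ℕ} {D : SuperPoly deg →ₗ[ℚ] SuperPoly deg} (hD : IsDer ε D) :
    D 1 = 0 := by
  have := hD.leibniz 1 1
  simpa using this

/-- A superderivation is the off-diagonal entry of an algebra map to upper triangular matrices with
diagonal `sgnPow ε a`, `a`: matrix multiplication is the Leibniz rule. The universal property thus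
produces derivations, and the parity of `g b` is exactly what the sign relations require. -/
theorem exists_matrix_hom (ε : ℕ) (g : γ → SuperPoly deg)
    (hg : ∀ b, HasParity (deg b + ε) (g b)) :
    ∃ F : SuperPoly deg →ₐ[ℚ] Matrix (Fin 2) (Fin 2) (SuperPoly deg),
      ∀ b, F (X deg b) = !![sgnPow ε (X deg b), g b; 0, X deg b] := by
  refine ⟨lift (fun b => !![sgnPow ε (X deg b), g b; 0, X deg b]) fun b c => ?_,
    fun b => lift_X _ _ b⟩
  have h1 : sgnPow ε (X deg b) * g c = (-1 : ℚ) ^ (deg b * deg c) • (g c * X deg b) := by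
    rw [sgnPow_X, smul_mul_assoc, (hasParity_X b).mul_comm (hg c), smul_smul]
    congr 1
    rw [mul_add, pow_add, mul_comm, mul_assoc, ← pow_add, mul_comm ε,
      Even.neg_one_pow ⟨_, rfl⟩, mul_one]
  have h2 : g b * X deg c = (-1 : ℚ) ^ (deg b * deg c) • (sgnPow ε (X deg c) * g b) := by
    rw [sgnPow_X, smul_mul_assoc, (hg b).mul_comm (hasParity_X c), smul_smul]
    congr 1
    rw [add_mul, pow_add]
  ext i j
  fin_cases i <;> fin_cases j
  · simp only [Matrix.smul_apply, Matrix.mul_apply, Fin.sum_univ_two]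
    simp
    rw [X_mul_X, smul_comm, smul_comm ((-1 : ℚ) ^ (deg b * deg c))]
    congr 1
    rw [smul_comm]
  · simp [Matrix.mul_apply, Fin.sum_univ_two, -sgnPow_X]
    rw [h1, h2, add_comm]
  · simp [Matrix.mul_apply, Fin.sum_univ_two]
  · simpa [Matrix.mul_apply, Fin.sum_univ_two] using X_mul_X b c

theorem exists_isDer (ε : ℕ) (g : γ → SuperPoly deg) (hg : ∀ b, HasParity (deg b + ε) (g b)) :
    ∃ D : SuperPoly deg →ₗ[ℚ] SuperPoly deg, IsDer ε D ∧ ∀ b, D (X deg b) = g b := by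
  obtain ⟨F, hFX⟩ := exists_matrix_hom ε g hg
  have hF : ∀ x, F x 0 0 = sgnPow ε x ∧ F x 1 0 = 0 ∧ F x 1 1 = x := by
    intro x
    induction x using word_induction with
    | hw l =>
      induction l with
      | nil => simp
      | cons b l ih =>
        obtain ⟨i1, i2, i3⟩ := ih
        rw [word_cons, map_mul, hFX]
        simp [Matrix.mul_apply, Fin.sum_univ_two, i1, i2, i3]
    | hadd x y hx hy => simp [hx, hy]
    | hsmul r x hx => simp [hx]
  obtain ⟨D, hD⟩ : ∃ D : SuperPoly deg →ₗ[ℚ] SuperPoly deg, ∀ x, D x = F x 0 1 :=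
    ⟨{ toFun := fun x => F x 0 1
       map_add' := fun x y => by simp
       map_smul' := fun r x => by simp }, fun _ => rfl⟩
  have hDX : ∀ b, D (X deg b) = g b := fun b => by simp [hD, hFX]
  have hL : ∀ a b, D (a * b) = D a * b + sgnPow ε a * D b := fun a b => by
    rw [hD, map_mul, Matrix.mul_apply, Fin.sum_univ_two, (hF a).1, (hF b).2.2, hD, hD, add_comm]
  have h1 : D 1 = 0 := by simp [hD]
  refine ⟨D, ⟨hL, ?_⟩, hDX⟩
  have hs : ∀ a, sgn (D a) = (-1 : ℚ) ^ ε • D (sgn a) := by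
    intro a
    induction a using word_induction with
    | hw l =>
      induction l with
      | nil => simp [h1]
      | cons b l ih =>
        rw [word_cons, hL, map_add, map_mul, map_mul, hDX, hg b, ih, map_mul, hL, sgn_X, map_smul,
          hDX, smul_add, sgnPow_X, map_smul, map_smul, sgnPow_X, sgn_X]
        simp only [smul_mul_assoc, mul_smul_comm, smul_smul, pow_add]
        congr 2 <;> ring
    | hadd x y hx hy => rw [map_add, map_add, map_add, map_add, hx, hy, smul_add]
    | hsmul r x hx => rw [map_smul, map_smul, map_smul, map_smul, hx, smul_comm]
  intro a i ha
  unfold HasParity at *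
  rw [hs, ha, map_smul, smul_smul, ← pow_add, add_comm]

end Basic

end SuperPoly

namespace SuperPoly

/-! ### Words, exponent vectors and the monomial basis. -/

section Words

variable {γ : Type*} {deg : γ → ℕ}

/-- The number of occurrences of each generator in a list. -/
noncomputable def cnt (l : List γ) : γ →₀ ℕ := (l.map fun b => Finsupp.single b 1).sum

@[simp] theorem cnt_nil : cnt ([] : List γ) = 0 := rfl

@[simp] theorem cnt_cons (b : γ) (l : List γ) : cnt (b :: l) = Finsupp.single b 1 + cnt l := by
  simp [cnt]

@[simp] theorem cnt_append (l l' : List γ) : cnt (l ++ l') = cnt l + cnt l' := by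
  simp [cnt]

theorem cnt_replicate (b : γ) (k : ℕ) : cnt (List.replicate k b) = Finsupp.single b k := by
  induction k with
  | zero => simp
  | succ k ih => rw [List.replicate_succ, cnt_cons, ih, ← Finsupp.single_add, add_comm]

theorem toMultiset_cnt (l : List γ) : Finsupp.toMultiset (cnt l) = (l : Multiset γ) := by
  induction l with
  | nil => simp
  | cons b l ih =>
    rw [cnt_cons, map_add, ih, Finsupp.toMultiset_single, one_smul, Multiset.singleton_add,
      Multiset.cons_coe]

theorem perm_of_cnt {l l' : List γ} (h : cnt l = cnt l') : l.Perm l' := by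
  rw [← Multiset.coe_eq_coe, ← toMultiset_cnt, ← toMultiset_cnt, h]

/-- A list with prescribed numbers of occurrences. -/
noncomputable def listOf (e : γ →₀ ℕ) : List γ := (Finsupp.toMultiset e).toList

@[simp] theorem cnt_listOf (e : γ →₀ ℕ) : cnt (listOf e) = e := by
  classical
  have h : Finsupp.toMultiset (cnt (listOf e)) = Finsupp.toMultiset e := by
    rw [toMultiset_cnt, listOf, Multiset.coe_toList]
  rw [← Finsupp.toMultiset_toFinsupp (cnt (listOf e)), h, Finsupp.toMultiset_toFinsupp]

theorem mem_iff_cnt {b : γ} {l : List γ} : b ∈ l ↔ cnt l b ≠ 0 := by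
  classical
  rw [← Multiset.mem_coe, ← toMultiset_cnt, Finsupp.mem_toMultiset, Finsupp.mem_support_iff]

theorem weight_cnt (w : γ → ℕ) (l : List γ) : Finsupp.weight w (cnt l) = (l.map w).sum := by
  induction l with
  | nil => simp
  | cons b l ih => simp [ih, Finsupp.weight_single]

theorem weight_single_one (w : γ → ℕ) (b : γ) : Finsupp.weight w (Finsupp.single b 1) = w b := by
  simp [Finsupp.weight_single]

theorem exists_word_perm {l l' : List γ} (h : l.Perm l') :
    ∃ s : ℚ, s ≠ 0 ∧ word deg l = s • word deg l' := by
  induction h with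
  | nil => exact ⟨1, one_ne_zero, by simp⟩
  | cons b _ ih =>
    obtain ⟨s, hs, h⟩ := ih
    exact ⟨s, hs, by rw [word_cons, word_cons, h, mul_smul_comm]⟩
  | swap b c l =>
    refine ⟨(-1) ^ (deg c * deg b), pow_ne_zero _ (neg_ne_zero.2 one_ne_zero), ?_⟩
    rw [word_cons, word_cons, word_cons, word_cons, ← mul_assoc, X_mul_X, smul_mul_assoc,
      mul_assoc]
  | trans _ _ ih ih' =>
    obtain ⟨s, hs, h⟩ := ih
    obtain ⟨t, ht, h'⟩ := ih'
    exact ⟨s * t, mul_ne_zero hs ht, by rw [h, h', smul_smul]⟩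

theorem exists_word_of_cnt {l l' : List γ} (h : cnt l = cnt l') :
    ∃ s : ℚ, s ≠ 0 ∧ word deg l = s • word deg l' :=
  exists_word_perm (perm_of_cnt h)

theorem X_mul_self {b : γ} (hb : Odd (deg b)) : X deg b * X deg b = 0 := by
  have h := X_mul_X (deg := deg) b b
  rw [(hb.mul hb).neg_one_pow, neg_one_smul, eq_neg_iff_add_eq_zero, ← two_smul ℚ] at h
  exact (smul_eq_zero.1 h).resolve_left two_ne_zero

theorem word_replicate (b : γ) (k : ℕ) : word deg (List.replicate k b) = X deg b ^ k := by
  simp [word]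

/-- The span of the words whose numbers of occurrences satisfy `P`. -/
noncomputable def wspan (deg : γ → ℕ) (P : (γ →₀ ℕ) → Prop) : Submodule ℚ (SuperPoly deg) :=
  Submodule.span ℚ {x | ∃ l, P (cnt l) ∧ word deg l = x}

theorem word_mem {P : (γ →₀ ℕ) → Prop} {l : List γ} (h : P (cnt l)) : word deg l ∈ wspan deg P :=
  Submodule.subset_span ⟨l, h, rfl⟩

theorem X_mem {P : (γ →₀ ℕ) → Prop} {b : γ} (h : P (Finsupp.single b 1)) :
    X deg b ∈ wspan deg P := by
  have := word_mem (deg := deg) (P := P) (l := [b]) (by simpa using h)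
  simpa using this

theorem one_mem_wspan {P : (γ →₀ ℕ) → Prop} (h : P 0) : 1 ∈ wspan deg P :=
  word_mem (l := []) h

theorem wspan_le {P : (γ →₀ ℕ) → Prop} {N : Submodule ℚ (SuperPoly deg)}
    (h : ∀ l, P (cnt l) → word deg l ∈ N) : wspan deg P ≤ N := by
  refine Submodule.span_le.2 ?_
  rintro _ ⟨l, hl, rfl⟩
  exact h l hl

theorem map_mem_of_mem_wspan {P : (γ →₀ ℕ) → Prop} {M : Type*} [AddCommGroup M] [Module ℚ M]
    {N : Submodule ℚ M} (f : SuperPoly deg →ₗ[ℚ] M) (h : ∀ l, P (cnt l) → f (word deg l) ∈ N)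
    {x : SuperPoly deg} (hx : x ∈ wspan deg P) : f x ∈ N :=
  (wspan_le (N := N.comap f) h) hx

theorem eq_of_mem_wspan {P : (γ →₀ ℕ) → Prop} {M : Type*} [AddCommGroup M] [Module ℚ M]
    (f g : SuperPoly deg →ₗ[ℚ] M) (h : ∀ l, P (cnt l) → f (word deg l) = g (word deg l))
    {x : SuperPoly deg} (hx : x ∈ wspan deg P) : f x = g x := by
  have := map_mem_of_mem_wspan (N := ⊥) (f - g) (fun l hl => by simp [h l hl]) hx
  simpa [sub_eq_zero] using this

theorem wspan_mono {P Q : (γ →₀ ℕ) → Prop} (h : ∀ e, P e → Q e) : wspan deg P ≤ wspan deg Q :=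
  wspan_le fun _ hl => word_mem (h _ hl)

theorem wspan_true : wspan deg (fun _ => True) = ⊤ := by
  rw [eq_top_iff, ← span_word]
  refine Submodule.span_le.2 ?_
  rintro _ ⟨l, rfl⟩
  exact word_mem trivial

theorem wspan_false : wspan deg (fun _ => False) = ⊥ :=
  eq_bot_iff.2 (wspan_le fun _ h => h.elim)

theorem mul_mem_wspan {P Q R : (γ →₀ ℕ) → Prop} (h : ∀ e f, P e → Q f → R (e + f))
    {x y : SuperPoly deg} (hx : x ∈ wspan deg P) (hy : y ∈ wspan deg Q) :
    x * y ∈ wspan deg R := by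
  have := Submodule.mul_mem_mul hx hy
  rw [wspan, wspan, Submodule.span_mul_span] at this
  refine Submodule.span_le.2 ?_ this
  rintro _ ⟨_, ⟨l, hl, rfl⟩, _, ⟨l', hl', rfl⟩, rfl⟩
  rw [SetLike.mem_coe]
  beta_reduce
  rw [← word_append]
  exact word_mem (by rw [cnt_append]; exact h _ _ hl hl')

theorem sgnPow_word (i : ℕ) (l : List γ) :
    sgnPow i (word deg l) = (-1 : ℚ) ^ (i * (l.map deg).sum) • word deg l :=
  (hasParity_word l).sgnPow

theorem sgnPow_mem {P : (γ →₀ ℕ) → Prop} (i : ℕ) {x : SuperPoly deg} (hx : x ∈ wspan deg P) :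
    sgnPow i x ∈ wspan deg P :=
  map_mem_of_mem_wspan (sgnPow i).toLinearMap (fun l hl => by
    simp only [AlgHom.toLinearMap_apply, sgnPow_word]
    exact Submodule.smul_mem _ _ (word_mem hl)) hx

theorem hasParity_of_mem {P : (γ →₀ ℕ) → Prop} {i : ℕ}
    (h : ∀ e, P e → (-1 : ℚ) ^ Finsupp.weight deg e = (-1 : ℚ) ^ i) {x : SuperPoly deg}
    (hx : x ∈ wspan deg P) : HasParity i x := by
  have := eq_of_mem_wspan sgn.toLinearMap ((-1 : ℚ) ^ i • LinearMap.id) (fun l hl => by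
    have := hasParity_word (deg := deg) l
    rw [← weight_cnt] at this
    exact this.congr (h _ hl)) hx
  exact this

/-- By the Leibniz rule, each term of the derivative replaces one letter `b` by a term of `D (X deg
b)`. All bookkeeping of degrees for derivations goes through this. -/
theorem IsDer.word_mem {ε : ℕ} {D : SuperPoly deg →ₗ[ℚ] SuperPoly deg} (hD : IsDer ε D)
    {R : γ → (γ →₀ ℕ) → Prop} (hR : ∀ b, D (X deg b) ∈ wspan deg (R b)) (l : List γ) :
    D (word deg l) ∈ wspan deg fun g =>
      ∃ b e f, cnt l = Finsupp.single b 1 + e ∧ R b f ∧ g = e + f := by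
  induction l with
  | nil => simp [hD.map_one]
  | cons c l ih =>
    rw [word_cons, hD.leibniz]
    refine Submodule.add_mem _ ?_ ?_
    · exact mul_mem_wspan (fun e f he hf => ⟨c, cnt l, e, cnt_cons c l, he, by
        rw [hf, add_comm]⟩) (hR c) (SuperPoly.word_mem (P := fun e => e = cnt l) rfl)
    · refine mul_mem_wspan ?_ (sgnPow_mem ε (X_mem (P := fun e => e = Finsupp.single c 1) rfl)) ih
      rintro _ _ rfl ⟨b, e, f, h1, h2, rfl⟩
      exact ⟨b, Finsupp.single c 1 + e, f, by rw [cnt_cons, h1]; abel, h2, by abel⟩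

theorem IsDer.mem_wspan {ε : ℕ} {D : SuperPoly deg →ₗ[ℚ] SuperPoly deg} (hD : IsDer ε D)
    {R : γ → (γ →₀ ℕ) → Prop} (hR : ∀ b, D (X deg b) ∈ wspan deg (R b))
    {P Q : (γ →₀ ℕ) → Prop}
    (h : ∀ b e f, P (Finsupp.single b 1 + e) → R b f → Q (e + f)) {x : SuperPoly deg}
    (hx : x ∈ wspan deg P) : D x ∈ wspan deg Q :=
  map_mem_of_mem_wspan D (fun l hl => wspan_mono (by
    rintro _ ⟨b, e, f, h1, h2, rfl⟩
    exact h b e f (h1 ▸ hl) h2) (hD.word_mem hR l)) hx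

/-- `T e f` bounds which exponent vectors `f` can occur in the image of a word with exponent vector
`e`; it is propagated one letter at a time. -/
theorem algHom_mem_wspan {δ : Type*} {deg' : δ → ℕ} (F : SuperPoly deg →ₐ[ℚ] SuperPoly deg')
    {R : γ → (δ →₀ ℕ) → Prop} (hR : ∀ b, F (X deg b) ∈ wspan deg' (R b))
    (T : (γ →₀ ℕ) → (δ →₀ ℕ) → Prop) (h0 : T 0 0)
    (hT : ∀ b e f g, T e f → R b g → T (Finsupp.single b 1 + e) (g + f))
    {P : (γ →₀ ℕ) → Prop} {Q : (δ →₀ ℕ) → Prop} (hPQ : ∀ e f, P e → T e f → Q f)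
    {x : SuperPoly deg} (hx : x ∈ wspan deg P) : F x ∈ wspan deg' Q := by
  refine map_mem_of_mem_wspan F.toLinearMap (fun l hl => ?_) hx
  have : F (word deg l) ∈ wspan deg' (T (cnt l)) := by
    clear hl
    induction l with
    | nil => simpa using one_mem_wspan h0
    | cons b l ih =>
      rw [word_cons, map_mul, cnt_cons]
      exact mul_mem_wspan (fun g f hg hf => hT b _ f g hf hg) (hR b) ih
  exact wspan_mono (fun f hf => hPQ _ f hl hf) this

theorem IsDer.eq_of_X {ε : ℕ} {D D' : SuperPoly deg →ₗ[ℚ] SuperPoly deg} (hD : IsDer ε D)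
    (hD' : IsDer ε D') (h : ∀ b, D (X deg b) = D' (X deg b)) : D = D' :=
  linearMap_ext fun l => by
    induction l with
    | nil => rw [word_nil, hD.map_one, hD'.map_one]
    | cons b l ih => rw [word_cons, hD.leibniz, hD'.leibniz, h, ih]

theorem IsDer.sgn_comm {D : SuperPoly deg →ₗ[ℚ] SuperPoly deg} {ε : ℕ} (hD : IsDer ε D)
    (a : SuperPoly deg) : D (sgn a) = (-1 : ℚ) ^ ε • sgn (D a) := by
  induction a using word_induction with
  | hw l =>
    have h := hD.parity _ _ (hasParity_word l)
    unfold HasParity at h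
    rw [hasParity_word l, map_smul, h, smul_smul]
    congr 1
    rw [pow_add, mul_comm, mul_assoc, ← pow_add, Even.neg_one_pow ⟨ε, rfl⟩, mul_one]
  | hadd x y hx hy => rw [map_add, map_add, map_add, map_add, hx, hy, smul_add]
  | hsmul r x hx => rw [map_smul, map_smul, map_smul, map_smul, hx, smul_comm]

/-- The anticommutator of two odd derivations is a derivation. -/
theorem IsDer.anticommutator {D D' : SuperPoly deg →ₗ[ℚ] SuperPoly deg} (hD : IsDer 1 D)
    (hD' : IsDer 1 D') : IsDer 0 (D ∘ₗ D' + D' ∘ₗ D) where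
  leibniz a b := by
    have h1 := hD.sgn_comm a
    have h2 := hD'.sgn_comm a
    simp only [LinearMap.add_apply, LinearMap.comp_apply, hD.leibniz, hD'.leibniz, map_add,
      sgnPow_one, sgn_sgn, sgnPow_zero, h1, h2, pow_one, neg_smul, one_smul, add_mul, mul_add]
    simp only [neg_mul]
    abel
  parity a i ha := by
    simp only [LinearMap.add_apply, LinearMap.comp_apply]
    refine (HasParity.add (hD.parity _ _ (hD'.parity _ _ ha))
      (hD'.parity _ _ (hD.parity _ _ ha))).congr ?_
    rw [add_assoc, pow_add]; norm_num

/-- The square of an odd derivation vanishes if it vanishes on generators. -/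
theorem IsDer.sq_eq_zero {D : SuperPoly deg →ₗ[ℚ] SuperPoly deg} (hD : IsDer 1 D)
    (h : ∀ b, D (D (X deg b)) = 0) (x : SuperPoly deg) : D (D x) = 0 := by
  have h0 : IsDer 0 (0 : SuperPoly deg →ₗ[ℚ] SuperPoly deg) :=
    ⟨fun a b => by simp, fun a i _ => by simpa using HasParity.zero⟩
  have := (hD.anticommutator hD).eq_of_X h0 fun b => by simp [h b]
  have hx := LinearMap.congr_fun this x
  rw [LinearMap.add_apply, LinearMap.comp_apply, LinearMap.zero_apply, ← two_smul ℚ] at hx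
  exact (smul_eq_zero.1 hx).resolve_left two_ne_zero

/-- The augmentation. -/
noncomputable def aug : SuperPoly deg →ₐ[ℚ] ℚ := lift (fun _ => 0) (by simp)

@[simp] theorem aug_X (b : γ) : aug (X deg b) = 0 := lift_X _ _ b

/-! ### Partial derivatives and the monomial basis -/

theorem exists_partial (u : γ) : ∃ D : SuperPoly deg →ₗ[ℚ] SuperPoly deg, IsDer (deg u) D ∧
    D (X deg u) = 1 ∧ ∀ b, b ≠ u → D (X deg b) = 0 := by
  classical
  obtain ⟨D, hD, h⟩ := exists_isDer (deg := deg) (deg u) (fun b => if b = u then 1 else 0)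
    fun b => by
      split_ifs with hb
      · subst hb
        exact hasParity_one.congr (by rw [Even.neg_one_pow ⟨_, rfl⟩]; simp)
      · exact HasParity.zero
  exact ⟨D, hD, by rw [h, if_pos rfl], fun b hb => by rw [h, if_neg hb]⟩

/-- The partial derivative with respect to a generator. -/
noncomputable def pd (deg : γ → ℕ) (u : γ) : SuperPoly deg →ₗ[ℚ] SuperPoly deg :=
  (exists_partial u).choose

theorem pd_isDer (u : γ) : IsDer (deg u) (pd deg u) := (exists_partial u).choose_spec.1

@[simp] theorem pd_self (u : γ) : pd deg u (X deg u) = 1 := (exists_partial u).choose_spec.2.1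

theorem pd_of_ne {u b : γ} (h : b ≠ u) : pd deg u (X deg b) = 0 :=
  (exists_partial u).choose_spec.2.2 b h

theorem pd_eq_zero {u : γ} {x : SuperPoly deg} (hx : x ∈ wspan deg fun e => e u = 0) :
    pd deg u x = 0 := by
  have := (pd_isDer (deg := deg) u).mem_wspan (R := fun b f => b = u) (Q := fun _ => False)
    (fun b => by
      by_cases hb : b = u
      · rw [show (fun _ : γ →₀ ℕ => b = u) = fun _ => True by simp [hb], wspan_true]; trivial
      · rw [pd_of_ne hb]; exact zero_mem _)
    (fun b e f he hb => by subst hb; simp at he) hx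
  rw [wspan_false] at this
  simpa using this

theorem pd_pow (u : γ) (k : ℕ) (hk : Odd (deg u) → k ≤ 1) :
    pd deg u (X deg u ^ k) = (k : ℚ) • X deg u ^ (k - 1) := by
  rcases Nat.even_or_odd (deg u) with h | h
  · have hs : sgnPow (deg u) (X deg u) = X deg u := by
      rw [sgnPow_X, (h.mul_left _).neg_one_pow, one_smul]
    clear hk
    induction k with
    | zero => simp [(pd_isDer u).map_one]
    | succ k ih =>
      rw [pow_succ', (pd_isDer u).leibniz, ih, pd_self, one_mul, hs, mul_smul_comm,
        Nat.add_sub_cancel]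
      rcases k with _ | k
      · simp
      · rw [Nat.add_sub_cancel, ← pow_succ', Nat.cast_succ (k + 1), add_smul, one_smul, add_comm]
  · have := hk h
    interval_cases k
    · simp [(pd_isDer u).map_one]
    · simp

theorem pd_mul_pow {u : γ} {a : SuperPoly deg} (ha : a ∈ wspan deg fun e => e u = 0) (k : ℕ)
    (hk : Odd (deg u) → k ≤ 1) :
    pd deg u (a * X deg u ^ k) = ((k : ℚ) • sgnPow (deg u) a) * X deg u ^ (k - 1) := by
  rw [(pd_isDer u).leibniz, pd_eq_zero ha, zero_mul, zero_add, pd_pow u k hk, mul_smul_comm,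
    smul_mul_assoc]

theorem sgnPow_injective (i : ℕ) : Function.Injective (sgnPow i : SuperPoly deg → SuperPoly deg) := by
  intro a b h
  have h2 : ∀ a : SuperPoly deg, sgnPow i (sgnPow i a) = a := fun a => by
    rw [← sgnPow_add, sgnPow_of_parity (j := 0) (by rw [Even.neg_one_pow ⟨i, rfl⟩, pow_zero]),
      sgnPow_zero]
  rw [← h2 a, h, h2]

/-- Expansions in powers of a generator are unique. -/
theorem eq_zero_of_sum_mul_pow (u : γ) (K : ℕ) (hK : Odd (deg u) → K ≤ 1)
    (a : ℕ → SuperPoly deg) (ha : ∀ k, a k ∈ wspan deg fun e => e u = 0)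
    (h : ∑ k ∈ Finset.range (K + 1), a k * X deg u ^ k = 0) : ∀ k ≤ K, a k = 0 := by
  induction K generalizing a with
  | zero =>
    intro k hk
    obtain rfl : k = 0 := by omega
    simpa using h
  | succ K ih =>
    -- Differentiation lowers every power of `u` by one and multiplies the coefficients by nonzero
    -- integers, up to sign, so the induction hypothesis applies to the coefficients of positive
    -- index.
    have h' := congrArg (pd deg u) h
    rw [map_sum, map_zero, Finset.sum_range_succ'] at h'
    have h0 : pd deg u (a 0 * X deg u ^ 0) = 0 := by rw [pow_zero, mul_one, pd_eq_zero (ha 0)]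
    rw [h0, add_zero] at h'
    have key := ih (fun hu => (Nat.le_succ K).trans (hK hu))
      (fun k => ((k + 1 : ℕ) : ℚ) • sgnPow (deg u) (a (k + 1)))
      (fun k => Submodule.smul_mem _ _ (sgnPow_mem _ (ha _))) (by
        rw [← h']
        refine Finset.sum_congr rfl fun k hk => ?_
        rw [pd_mul_pow (ha _) _ fun hu => by
          have := hK hu; have := Finset.mem_range.1 hk; omega]
        rw [Nat.add_sub_cancel])
    have hpos : ∀ k ≤ K, a (k + 1) = 0 := fun k hk => by
      have h1 := (smul_eq_zero.1 (key k hk)).resolve_left (Nat.cast_ne_zero.2 (Nat.succ_ne_zero k))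
      exact sgnPow_injective (deg u) (h1.trans (map_zero _).symm)
    intro k hk
    rcases k with _ | k
    · rw [Finset.sum_range_succ', Finset.sum_eq_zero (fun k hk => by
        rw [hpos k (by have := Finset.mem_range.1 hk; omega), zero_mul])] at h
      simpa using h
    · exact hpos k (by omega)

/-- Admissible exponents: odd generators occur at most once. -/
def Adm (deg : γ → ℕ) (e : γ →₀ ℕ) : Prop := ∀ b, Odd (deg b) → e b ≤ 1

theorem exists_list_split (u : γ) (l : List γ) :
    ∃ l₀, cnt l = Finsupp.single u (cnt l u) + cnt l₀ ∧ cnt l₀ u = 0 := by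
  classical
  refine ⟨listOf ((cnt l).erase u), ?_, by simp⟩
  rw [cnt_listOf, Finsupp.single_add_erase]

theorem word_eq_zero_of_not_adm {l : List γ} (h : ¬ Adm deg (cnt l)) : word deg l = 0 := by
  unfold Adm at h
  push Not at h
  obtain ⟨b, hb, h⟩ := h
  obtain ⟨l₀, hl, -⟩ := exists_list_split b l
  obtain ⟨s, -, hs⟩ := exists_word_of_cnt (deg := deg) (l := l)
    (l' := List.replicate (cnt l b) b ++ l₀) (by rw [cnt_append, cnt_replicate]; exact hl)
  obtain ⟨k, hk⟩ := Nat.exists_eq_add_of_lt h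
  rw [hs, word_append, word_replicate, hk, show 1 + k + 1 = 2 + k by omega, pow_add, pow_two,
    X_mul_self hb]
  simp

/-- Move all copies of `b` to the right. The derivative of `b ^ (k + 1)` contributes the factor `k +
1`, nonzero in characteristic zero; an inadmissible word is itself zero. -/
theorem pd_word {b : γ} {l l' : List γ} (h : cnt l = Finsupp.single b 1 + cnt l') :
    ∃ r : ℚ, pd deg b (word deg l) = r • word deg l' ∧ (Adm deg (cnt l) → r ≠ 0) := by
  by_cases hadm : Adm deg (cnt l)
  · obtain ⟨l₀, hl, h0⟩ := exists_list_split b l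
    obtain ⟨k, hk⟩ : ∃ k, cnt l b = k + 1 := ⟨cnt l' b, by rw [h]; simp [add_comm]⟩
    rw [hk] at hl
    obtain ⟨s, hs, e1⟩ := exists_word_of_cnt (deg := deg) (l := l)
      (l' := l₀ ++ List.replicate (k + 1) b) (by
        rw [cnt_append, cnt_replicate, add_comm]; exact hl)
    obtain ⟨t, ht, e2⟩ := exists_word_of_cnt (deg := deg) (l' := l')
      (l := l₀ ++ List.replicate k b) (by
        rw [cnt_append, cnt_replicate]
        have : Finsupp.single b 1 + cnt l' = Finsupp.single b 1 + (cnt l₀ + Finsupp.single b k) := by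
          rw [← h, hl, Finsupp.single_add]; abel
        exact (add_left_cancel this).symm)
    refine ⟨s * ((k + 1 : ℕ) : ℚ) * (-1) ^ (deg b * (l₀.map deg).sum) * t, ?_, fun _ => ?_⟩
    · rw [e1, word_append, word_replicate, map_smul, pd_mul_pow (word_mem h0) (k + 1) fun hb => by
        have := hadm b hb; omega]
      rw [Nat.add_sub_cancel, sgnPow_word, ← smul_smul _ t, ← e2, word_append, word_replicate]
      simp only [smul_mul_assoc, smul_smul]
      congr 1
      ring
    · exact mul_ne_zero (mul_ne_zero (mul_ne_zero hs (Nat.cast_ne_zero.2 (Nat.succ_ne_zero k)))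
        (pow_ne_zero _ (neg_ne_zero.2 one_ne_zero))) ht
  · exact ⟨0, by rw [word_eq_zero_of_not_adm hadm]; simp, fun h => absurd h hadm⟩

/-- Differentiating along all the letters of `d` and then augmenting detects the exponent vector of
`d`. These functionals separate the admissible monomials, whence their linear independence. -/
theorem exists_dual (d : List γ) : ∃ Λ : SuperPoly deg →ₗ[ℚ] ℚ, ∀ l,
    (cnt l ≠ cnt d → Λ (word deg l) = 0) ∧
    (cnt l = cnt d → Adm deg (cnt l) → Λ (word deg l) ≠ 0) := by
  induction d with
  | nil =>
    refine ⟨aug.toLinearMap, fun l => ?_⟩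
    rcases l with _ | ⟨b, l⟩
    · simp
    · have : aug (word deg (b :: l)) = 0 := by simp
      refine ⟨fun _ => this, fun h => absurd (DFunLike.congr_fun h b) (by simp)⟩
  | cons b d ih =>
    obtain ⟨Λ, hΛ⟩ := ih
    refine ⟨Λ ∘ₗ pd deg b, fun l => ?_⟩
    by_cases hb : cnt l b = 0
    · have : pd deg b (word deg l) = 0 := pd_eq_zero (word_mem hb)
      refine ⟨fun _ => by simp [this], fun h => absurd (DFunLike.congr_fun h b) (by rw [hb]; simp; omega)⟩
    · obtain ⟨l', hl'⟩ : ∃ l', cnt l = Finsupp.single b 1 + cnt l' := by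
        refine ⟨listOf (cnt l - Finsupp.single b 1), ?_⟩
        rw [cnt_listOf, add_tsub_cancel_of_le]
        rw [Finsupp.single_le_iff]; omega
      obtain ⟨r, hr, hr'⟩ := pd_word (deg := deg) hl'
      have hiff : cnt l = cnt (b :: d) ↔ cnt l' = cnt d := by
        rw [hl', cnt_cons]; exact add_right_inj _
      have hadm : Adm deg (cnt l) → Adm deg (cnt l') := fun h c hc =>
        le_trans (by rw [hl']; simp) (h c hc)
      rw [LinearMap.comp_apply, hr, map_smul, Ne, hiff]
      refine ⟨fun h => by rw [(hΛ l').1 h, smul_zero], fun h ha => ?_⟩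
      exact smul_ne_zero (hr' ha) ((hΛ l').2 h (hadm ha))

variable (deg) in
/-- The monomial with given exponents. -/
noncomputable def mono (e : γ →₀ ℕ) : SuperPoly deg := word deg (listOf e)

theorem exists_word_eq_mono (l : List γ) : ∃ s : ℚ, s ≠ 0 ∧ word deg l = s • mono deg (cnt l) :=
  exists_word_of_cnt (by simp)

variable (deg) in
/-- The monomial basis. -/
noncomputable def monoBasis : Module.Basis {e : γ →₀ ℕ // Adm deg e} ℚ (SuperPoly deg) :=
  Module.Basis.mk (v := fun e : {e : γ →₀ ℕ // Adm deg e} => mono deg e.1)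
    (by
      rw [linearIndependent_iff']
      intro s g hg i hi
      obtain ⟨Λ, hΛ⟩ := exists_dual (deg := deg) (listOf i.1)
      have := congrArg Λ hg
      rw [map_sum, map_zero, Finset.sum_eq_single i] at this
      · rw [map_smul, smul_eq_zero] at this
        exact this.resolve_right ((hΛ _).2 rfl (by simpa using i.2))
      · intro j _ hj
        rw [map_smul, mono, (hΛ _).1 (by simpa [Subtype.ext_iff] using hj), smul_zero]
      · intro h; exact absurd hi h)
    (by
      rw [← span_word]
      refine Submodule.span_le.2 ?_
      rintro _ ⟨l, rfl⟩
      by_cases h : Adm deg (cnt l)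
      · obtain ⟨s, -, hs⟩ := exists_word_eq_mono (deg := deg) l
        rw [hs]
        exact Submodule.smul_mem _ _ (Submodule.subset_span ⟨⟨_, h⟩, rfl⟩)
      · rw [word_eq_zero_of_not_adm h]; exact zero_mem _)

@[simp] theorem monoBasis_apply (e : {e : γ →₀ ℕ // Adm deg e}) :
    monoBasis deg e = mono deg e.1 := by
  simp [monoBasis]

theorem wspan_eq_span_image (P : (γ →₀ ℕ) → Prop) :
    wspan deg P = Submodule.span ℚ (monoBasis deg '' {e | P e.1}) := by
  apply le_antisymm
  · refine wspan_le fun l hl => ?_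
    by_cases h : Adm deg (cnt l)
    · obtain ⟨s, -, hs⟩ := exists_word_eq_mono (deg := deg) l
      rw [hs]
      exact Submodule.smul_mem _ _ (Submodule.subset_span ⟨⟨_, h⟩, hl, by simp⟩)
    · rw [word_eq_zero_of_not_adm h]; exact zero_mem _
  · refine Submodule.span_le.2 ?_
    rintro _ ⟨e, he, rfl⟩
    rw [monoBasis_apply]
    exact word_mem (by simpa using he)

/-- `wspan` is spanned by a subset of the monomial basis, so membership is a condition on the
support. This is what permits intersecting two such conditions. -/
theorem mem_wspan_iff {P : (γ →₀ ℕ) → Prop} {x : SuperPoly deg} :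
    x ∈ wspan deg P ↔ ∀ e, (monoBasis deg).repr x e ≠ 0 → P e.1 := by
  rw [wspan_eq_span_image, Module.Basis.mem_span_image]
  simp [Set.subset_def]

theorem mem_wspan_and {P Q : (γ →₀ ℕ) → Prop} {x : SuperPoly deg} (hP : x ∈ wspan deg P)
    (hQ : x ∈ wspan deg Q) : x ∈ wspan deg fun e => P e ∧ Q e :=
  mem_wspan_iff.2 fun e he => ⟨mem_wspan_iff.1 hP e he, mem_wspan_iff.1 hQ e he⟩

variable (deg) in
/-- The diagonal linear map that scales the monomial with exponents `e` by `c e`. -/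
noncomputable def diag (c : (γ →₀ ℕ) → ℚ) : SuperPoly deg →ₗ[ℚ] SuperPoly deg :=
  (monoBasis deg).constr ℚ fun e => c e.1 • mono deg e.1

theorem diag_word (c : (γ →₀ ℕ) → ℚ) (l : List γ) :
    diag deg c (word deg l) = c (cnt l) • word deg l := by
  by_cases h : Adm deg (cnt l)
  · obtain ⟨s, -, hs⟩ := exists_word_eq_mono (deg := deg) l
    have := (monoBasis deg).constr_basis ℚ (fun e => c e.1 • mono deg e.1) ⟨_, h⟩
    rw [monoBasis_apply] at this
    rw [hs, map_smul, diag, this, smul_comm]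
  · rw [word_eq_zero_of_not_adm h]; simp

theorem diag_mem {P : (γ →₀ ℕ) → Prop} (c : (γ →₀ ℕ) → ℚ) {x : SuperPoly deg}
    (hx : x ∈ wspan deg P) : diag deg c x ∈ wspan deg P :=
  map_mem_of_mem_wspan _ (fun l hl => by
    rw [diag_word]; exact Submodule.smul_mem _ _ (word_mem hl)) hx

end Words

end SuperPoly

namespace SuperPoly

/-! ### Comparing maps on generators, recursion on rank, expansion in one generator. -/

section Tools

variable {γ : Type*} {deg : γ → ℕ} {δ : Type*} {deg' : δ → ℕ}

theorem algHom_eq_of_mem {C : Type*} [Ring C] [Algebra ℚ C] {f g : SuperPoly deg →ₐ[ℚ] C}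
    {p : γ → Prop} (h : ∀ b, p b → f (X deg b) = g (X deg b)) {x : SuperPoly deg}
    (hx : x ∈ wspan deg fun e => ∀ b, e b ≠ 0 → p b) : f x = g x :=
  eq_of_mem_wspan f.toLinearMap g.toLinearMap (fun l hl => by
    have hl' : ∀ b ∈ l, p b := fun b hb => hl b (mem_iff_cnt.1 hb)
    clear hl
    simp only [AlgHom.toLinearMap_apply]
    induction l with
    | nil => simp
    | cons b l ih =>
      rw [word_cons, map_mul, map_mul, h b (hl' b (by simp)),
        ih fun c hc => hl' c (List.mem_cons_of_mem _ hc)]) hx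

/-- Both sides obey the same Leibniz rule, so generators suffice. The restriction `p` is there
because some of the maps below are chain maps only on generators of low degree. -/
theorem intertwine {F : SuperPoly deg →ₐ[ℚ] SuperPoly deg'} (hF : ∀ x, F (sgn x) = sgn (F x))
    {D : SuperPoly deg →ₗ[ℚ] SuperPoly deg} {D' : SuperPoly deg' →ₗ[ℚ] SuperPoly deg'}
    (hD : IsDer 1 D) (hD' : IsDer 1 D') {p : γ → Prop}
    (h : ∀ b, p b → D' (F (X deg b)) = F (D (X deg b))) {x : SuperPoly deg}
    (hx : x ∈ wspan deg fun e => ∀ b, e b ≠ 0 → p b) : D' (F x) = F (D x) :=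
  eq_of_mem_wspan (D' ∘ₗ F.toLinearMap) (F.toLinearMap ∘ₗ D) (fun l hl => by
    have hl' : ∀ b ∈ l, p b := fun b hb => hl b (mem_iff_cnt.1 hb)
    clear hl
    simp only [LinearMap.comp_apply, AlgHom.toLinearMap_apply]
    induction l with
    | nil => simp [hD.map_one, hD'.map_one]
    | cons b l ih =>
      rw [word_cons, map_mul, hD.leibniz, hD'.leibniz, map_add, map_mul, map_mul,
        h b (hl' b (by simp)), ih fun c hc => hl' c (List.mem_cons_of_mem _ hc), sgnPow_one,
        sgnPow_one, hF]) hx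

/-- Algebra maps defined by recursion on the rank of generators. -/
theorem exists_rec_hom (ρ : γ → ℕ) (N : ℕ) (hN : ∀ c, ρ c < N) (t : γ → SuperPoly deg')
    (r : γ → SuperPoly deg) (ℓ : γ → SuperPoly deg' →ₗ[ℚ] SuperPoly deg')
    (hr : ∀ c, r c ∈ wspan deg fun e => ∀ b, e b ≠ 0 → ρ b < ρ c)
    (hpar : ∀ f : SuperPoly deg →ₐ[ℚ] SuperPoly deg', (∀ x, f (sgn x) = sgn (f x)) →
      ∀ c, HasParity (deg c) (t c + ℓ c (f (r c)))) :
    ∃ f : SuperPoly deg →ₐ[ℚ] SuperPoly deg', (∀ x, f (sgn x) = sgn (f x)) ∧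
      ∀ c, f (X deg c) = t c + ℓ c (f (r c)) := by
  -- The desired map is a fixed point of `T`. Compatibility with `sgn` is carried along because
  -- `hpar` needs it at every stage.
  let T : {f : SuperPoly deg →ₐ[ℚ] SuperPoly deg' // ∀ x, f (sgn x) = sgn (f x)} →
      {f : SuperPoly deg →ₐ[ℚ] SuperPoly deg' // ∀ x, f (sgn x) = sgn (f x)} := fun f =>
    ⟨hom (fun c => t c + ℓ c (f.1 (r c))) (hpar f.1 f.2), hom_sgn _ fun b => by
      rw [hom_X]; exact hpar f.1 f.2 b⟩
  have hT : ∀ f c, (T f).1 (X deg c) = t c + ℓ c (f.1 (r c)) :=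
    fun f c => hom_X _ (hpar f.1 f.2) c
  let f₀ : {f : SuperPoly deg →ₐ[ℚ] SuperPoly deg' // ∀ x, f (sgn x) = sgn (f x)} :=
    ⟨hom (fun _ => 0) fun _ => HasParity.zero, hom_sgn _ fun b => by
      rw [hom_X]; exact HasParity.zero⟩
  -- The iterates become stationary: `r c` involves only generators of smaller rank, whose values
  -- have been settled one step earlier.
  have stab : ∀ k c, ρ c < k → (T^[k + 1] f₀).1 (X deg c) = (T^[k] f₀).1 (X deg c) := by
    intro k
    induction k with
    | zero => intro c hc; omega
    | succ k ih =>
      intro c hc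
      rw [Function.iterate_succ_apply' T (k + 1), hT, Function.iterate_succ_apply' T k, hT,
        ← Function.iterate_succ_apply' T k]
      congr 2
      exact algHom_eq_of_mem (p := fun b => ρ b < k) ih
        (wspan_mono (fun e he b hb => by have := he b hb; omega) (hr c))
  refine ⟨(T^[N] f₀).1, (T^[N] f₀).2, fun c => ?_⟩
  rw [← stab N c (hN c), Function.iterate_succ_apply', hT]

/-- Each monomial can be rewritten with its letters `u` at the right end; for odd `u` the square is
zero, which bounds the exponent by one. -/
theorem exists_expansion (u : γ) {P : (γ →₀ ℕ) → Prop} {x : SuperPoly deg}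
    (hx : x ∈ wspan deg P) : ∃ (K : ℕ) (c : ℕ → SuperPoly deg), (Odd (deg u) → K ≤ 1) ∧
      (∀ k, c k ∈ wspan deg fun e => e u = 0 ∧ P (e + Finsupp.single u k)) ∧
      x = ∑ k ∈ Finset.range (K + 1), c k * X deg u ^ k := by
  have key : ∃ c : ℕ →₀ SuperPoly deg, (∀ k, Odd (deg u) → c k ≠ 0 → k ≤ 1) ∧
      (∀ k, c k ∈ wspan deg fun e => e u = 0 ∧ P (e + Finsupp.single u k)) ∧
      x = c.sum fun k a => a * X deg u ^ k := by
    induction hx using Submodule.span_induction with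
    | mem x h =>
      obtain ⟨l, hl, rfl⟩ := h
      by_cases hadm : Adm deg (cnt l)
      · obtain ⟨l₀, h1, h2⟩ := exists_list_split u l
        obtain ⟨s, -, hs⟩ := exists_word_of_cnt (deg := deg) (l := l)
          (l' := l₀ ++ List.replicate (cnt l u) u) (by
            rw [cnt_append, cnt_replicate, add_comm]; exact h1)
        refine ⟨Finsupp.single (cnt l u) (s • word deg l₀), fun k ho hk => ?_, fun k => ?_, ?_⟩
        · obtain rfl : cnt l u = k := by
            by_contra hne
            exact hk (Finsupp.single_eq_of_ne' hne)
          exact hadm u ho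
        · rw [Finsupp.single_apply]
          split_ifs with hk
          · refine Submodule.smul_mem _ _ (word_mem ⟨h2, ?_⟩)
            rw [← hk, add_comm, ← h1]
            exact hl
          · exact zero_mem _
        · rw [Finsupp.sum_single_index (by simp), hs, word_append, word_replicate, smul_mul_assoc]
      · exact ⟨0, by simp, fun k => by simp, by simp [word_eq_zero_of_not_adm hadm]⟩
    | zero => exact ⟨0, by simp, fun k => by simp, by simp⟩
    | add x y _ _ hx hy =>
      obtain ⟨c, h1, h2, rfl⟩ := hx
      obtain ⟨c', h1', h2', rfl⟩ := hy
      refine ⟨c + c', fun k ho hk => ?_, fun k => Submodule.add_mem _ (h2 k) (h2' k), ?_⟩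
      · by_cases h : c k = 0
        · exact h1' k ho fun h' => hk (by simp [h, h'])
        · exact h1 k ho h
      · rw [Finsupp.sum_add_index' (by simp) (by simp [add_mul])]
    | smul r x _ hx =>
      obtain ⟨c, h1, h2, rfl⟩ := hx
      refine ⟨r • c, fun k ho hk => h1 k ho fun h' => hk (by simp [h']),
        fun k => Submodule.smul_mem _ _ (h2 k), ?_⟩
      rw [Finsupp.sum_smul_index' (by simp), Finsupp.smul_sum]
      simp
  obtain ⟨c, h1, h2, h3⟩ := key
  refine ⟨c.support.sup id, c, fun ho => Finset.sup_le fun k hk =>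
    h1 k ho (Finsupp.mem_support_iff.1 hk), h2, ?_⟩
  rw [h3]
  refine Finsupp.sum_of_support_subset _ (fun k hk => ?_) _ (by simp)
  exact Finset.mem_range.2 (Nat.lt_succ_of_le (Finset.le_sup (f := id) hk))

theorem exists_single_add {e : γ →₀ ℕ} {c : γ} (h : e c ≠ 0) :
    ∃ e', e = Finsupp.single c 1 + e' := by
  refine ⟨e - Finsupp.single c 1, ?_⟩
  rw [add_tsub_cancel_of_le]
  rw [Finsupp.single_le_iff]; omega

variable (γ) in
/-- The number of letters. -/
noncomputable abbrev len : (γ →₀ ℕ) →+ ℕ := Finsupp.weight fun _ : γ => (1 : ℕ)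

theorem two_mul_len_le (h2 : ∀ b, 2 ≤ deg b) (e : γ →₀ ℕ) :
    2 * len γ e ≤ Finsupp.weight deg e := by
  rw [Finsupp.weight_apply, Finsupp.weight_apply, Finsupp.sum, Finsupp.sum, Finset.mul_sum]
  exact Finset.sum_le_sum fun b _ => by
    simp only [smul_eq_mul, mul_one]; rw [mul_comm]; exact Nat.mul_le_mul_left _ (h2 b)

/-- Besides `c` there is another letter, of degree at least two. Consequently a decomposable
differential involves only generators of strictly smaller degree, which makes recursions on the
degree possible. -/
theorem deg_add_two_le (h2 : ∀ b, 2 ≤ deg b) {e : γ →₀ ℕ} (he : 2 ≤ len γ e) {c : γ}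
    (hc : e c ≠ 0) : deg c + 2 ≤ Finsupp.weight deg e := by
  obtain ⟨e', rfl⟩ := exists_single_add hc
  have := two_mul_len_le h2 e'
  rw [map_add, weight_single_one] at he ⊢
  omega

end Tools

/-! ### The contractible algebra on generators `û` and `ū` -/

section Koszul

variable {U : Type*} (g : U → ℕ)

/-- Degrees of the generators `û = inl u` of degree `|u|` and `ū = inr u` of degree `|u| - 1`. -/
def kdeg : U ⊕ U → ℕ := Sum.elim g fun u => g u - 1

/-- With `d ū = û` and `s û = ū`, the derivation `ds + sd` fixes every generator and so multiplies a
word by its length. Hence `h`, which is `s` after division by the length, contracts the algebra onto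
the constants. The last clause says that `h` merely turns one `û` into `ū`. -/
theorem exists_contraction (hg : ∀ u, 1 ≤ g u) :
    ∃ d h : SuperPoly (kdeg g) →ₗ[ℚ] SuperPoly (kdeg g), IsDer 1 d ∧
      (∀ u, d (X _ (Sum.inr u)) = X _ (Sum.inl u)) ∧ (∀ u, d (X _ (Sum.inl u)) = 0) ∧
      (∀ x, d (h x) + h (d x) = x - algebraMap ℚ _ (aug x)) ∧
      (∀ a i, HasParity i a → HasParity (i + 1) (h a)) ∧ (∀ x, aug (h x) = 0) ∧
      ∀ P Q : (U ⊕ U →₀ ℕ) → Prop, (∀ u e, P (Finsupp.single (Sum.inl u) 1 + e) →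
        Q (Finsupp.single (Sum.inr u) 1 + e)) → ∀ x ∈ wspan (kdeg g) P, h x ∈ wspan (kdeg g) Q := by
  obtain ⟨d, hd, hdX⟩ := exists_isDer (deg := kdeg g) 1
    (Sum.elim (fun _ => 0) fun u => X _ (Sum.inl u)) (by
      rintro (u | u)
      · exact HasParity.zero
      · refine (hasParity_X (deg := kdeg g) (Sum.inl u)).congr ?_
        simp [kdeg, Nat.sub_add_cancel (hg u)])
  obtain ⟨s, hs, hsX⟩ := exists_isDer (deg := kdeg g) 1
    (Sum.elim (fun u => X _ (Sum.inr u)) fun _ => 0) (by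
      rintro (u | u)
      · refine (hasParity_X (deg := kdeg g) (Sum.inr u)).congr ?_
        have := hg u
        simp only [kdeg, Sum.elim_inl, Sum.elim_inr]
        rw [show g u + 1 = g u - 1 + 2 by omega, pow_add]; norm_num
      · exact HasParity.zero)
  have hθ := hd.anticommutator hs
  have hθw : ∀ l, (d ∘ₗ s + s ∘ₗ d) (word (kdeg g) l) = (l.length : ℚ) • word (kdeg g) l := by
    intro l
    induction l with
    | nil => simp [hd.map_one, hs.map_one]
    | cons b l ih =>
      have hb : (d ∘ₗ s + s ∘ₗ d) (X (kdeg g) b) = X (kdeg g) b := by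
        rcases b with u | u <;> simp [hdX, hsX]
      rw [word_cons, hθ.leibniz, ih, hb, sgnPow_zero, mul_smul_comm, List.length_cons,
        Nat.cast_succ, add_smul, one_smul, add_comm]
  -- On constants the length is `0` and its inverse is `0` by convention, so `q` kills them; this
  -- accounts for the augmentation in the homotopy formula.
  let q := diag (kdeg g) fun e => ((len _ e : ℕ) : ℚ)⁻¹
  have hlen : ∀ l : List (U ⊕ U), len _ (cnt l) = l.length := fun l => by
    rw [weight_cnt]; simp
  have hq : ∀ l, q (word (kdeg g) l) = (l.length : ℚ)⁻¹ • word (kdeg g) l := fun l => by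
    rw [diag_word, hlen]
  have hdlen : ∀ l, d (word (kdeg g) l) ∈ wspan (kdeg g) fun e => len _ e = l.length := by
    intro l
    refine hd.mem_wspan (R := fun _ f => len _ f = 1) (P := fun e => len _ e = l.length) ?_ ?_
      (word_mem (hlen l))
    · rintro (u | u)
      · simp [hdX]
      · simp only [hdX, Sum.elim_inr]; exact X_mem (weight_single_one _ _)
    · intro b e f he hf
      rw [map_add, weight_single_one] at he
      rw [map_add, hf, ← he, add_comm]
  have hqd : ∀ l, q (d (word (kdeg g) l)) = (l.length : ℚ)⁻¹ • d (word (kdeg g) l) := fun l =>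
    eq_of_mem_wspan q ((l.length : ℚ)⁻¹ • LinearMap.id) (fun l' hl' => by
      rw [hq]; rw [hlen] at hl'; simp [hl']) (hdlen l)
  have hqpar : ∀ a i, HasParity i a → HasParity i (q a) := by
    have hc : ∀ a, sgn (q a) = q (sgn a) := fun a => by
      induction a using word_induction with
      | hw l => rw [hq, map_smul, hasParity_word l, map_smul, hq, smul_comm]
      | hadd x y hx hy => rw [map_add, map_add, map_add, map_add, hx, hy]
      | hsmul r x hx => rw [map_smul, map_smul, map_smul, map_smul, hx]
    intro a i ha
    unfold HasParity at *
    rw [hc, ha, map_smul]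
  have hsmem : ∀ P Q : (U ⊕ U →₀ ℕ) → Prop, (∀ u e, P (Finsupp.single (Sum.inl u) 1 + e) →
      Q (Finsupp.single (Sum.inr u) 1 + e)) → ∀ x ∈ wspan (kdeg g) P,
      s x ∈ wspan (kdeg g) Q := by
    intro P Q h x hx
    refine hs.mem_wspan (R := fun b f => ∃ u, b = Sum.inl u ∧ f = Finsupp.single (Sum.inr u) 1)
      ?_ ?_ hx
    · rintro (u | u)
      · simp only [hsX, Sum.elim_inl]; exact X_mem ⟨u, rfl, rfl⟩
      · simp [hsX]
    · rintro _ e _ he ⟨u, rfl, rfl⟩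
      rw [add_comm]; exact h u e he
  refine ⟨d, s ∘ₗ q, hd, fun u => by simp [hdX], fun u => by simp [hdX], fun x => ?_,
    fun a i ha => hs.parity _ _ (hqpar _ _ ha), fun x => ?_,
    fun P Q h x hx => hsmem P Q h _ (diag_mem _ hx)⟩
  · induction x using word_induction with
    | hw l =>
      have h1 : d (s (q (word (kdeg g) l))) + s (q (d (word (kdeg g) l))) =
          ((l.length : ℚ)⁻¹ * l.length) • word (kdeg g) l := by
        rw [hq, hqd, map_smul, map_smul, map_smul, ← smul_add, mul_smul, ← hθw]; rfl
      rw [LinearMap.comp_apply, LinearMap.comp_apply, h1]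
      rcases l with _ | ⟨b, l⟩
      · simp
      · rw [inv_mul_cancel₀ (Nat.cast_ne_zero.2 (by simp))]; simp
    | hadd x y hx hy =>
      rw [map_add, map_add, map_add, map_add, add_add_add_comm, hx, hy, map_add, map_add]; abel
    | hsmul r x hx =>
      rw [map_smul, map_smul, map_smul, map_smul, ← smul_add, hx, map_smul, smul_sub]
      simp [Algebra.smul_def]
  · have hx : x ∈ wspan (kdeg g) fun _ => True := by rw [wspan_true]; trivial
    have := hsmem (fun _ => True) (fun e => ∃ b, e b ≠ 0)
      (fun u e _ => ⟨Sum.inr u, by simp⟩) (q x) (diag_mem _ hx)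
    have h2 := eq_of_mem_wspan aug.toLinearMap (0 : SuperPoly (kdeg g) →ₗ[ℚ] ℚ) (fun l hl => by
      rcases l with _ | ⟨b, l⟩
      · simp at hl
      · simp) this
    simpa using h2

end Koszul

end SuperPoly

/-! ### Minimal differentials and extensions `ΛV ⊗ ΛŪ`. -/

namespace SuperPoly

/-- A minimal differential on a free graded commutative algebra with generators of degree at
least two. -/
structure IsMinimalDifferential {β : Type*} {deg : β → ℕ}
    (d : SuperPoly deg →ₗ[ℚ] SuperPoly deg) : Prop where
  isDer : IsDer 1 d
  sq_zero : ∀ x, d (d x) = 0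
  two_le : ∀ b, 2 ≤ deg b
  map_X : ∀ b, d (X deg b) ∈ wspan deg fun e => 2 ≤ len β e ∧ Finsupp.weight deg e = deg b + 1

section Extension

variable {β : Type*} {deg : β → ℕ} {d : SuperPoly deg →ₗ[ℚ] SuperPoly deg}

theorem IsMinimalDifferential.map_X_lt (hd : IsMinimalDifferential d) (b : β) :
    d (X deg b) ∈ wspan deg fun e => 2 ≤ len β e ∧ ∀ c, e c ≠ 0 → deg c < deg b :=
  wspan_mono (fun e he => ⟨he.1, fun c hc => by
    have := deg_add_two_le hd.two_le he.1 hc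
    omega⟩) (hd.map_X b)

variable {U : Type*} (g : U → ℕ)

variable (deg) in
/-- Degrees of the generators of `ΛV ⊗ ΛŪ`. -/
def edeg : β ⊕ U → ℕ := Sum.elim deg fun u => g u - 1

variable (deg) (U) in
/-- The degree of the part of a word in the generators of `ΛV`. -/
noncomputable def vdeg : (β ⊕ U →₀ ℕ) →+ ℕ := Finsupp.weight (Sum.elim deg fun _ => 0)

variable (β) (U) in
/-- The number of letters of a word that are generators of `ΛV`. -/
noncomputable def vlen : (β ⊕ U →₀ ℕ) →+ ℕ :=
  Finsupp.weight (Sum.elim (fun _ => (1 : ℕ)) fun _ => 0)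

theorem two_mul_vlen_le (h2 : ∀ b, 2 ≤ deg b) (f : β ⊕ U →₀ ℕ) :
    2 * vlen β U f ≤ vdeg deg U f := by
  rw [vlen, vdeg, Finsupp.weight_apply, Finsupp.weight_apply, Finsupp.sum, Finsupp.sum,
    Finset.mul_sum]
  refine Finset.sum_le_sum fun b _ => ?_
  rcases b with b | u
  · simp only [smul_eq_mul, Sum.elim_inl, mul_one]
    rw [mul_comm]; exact Nat.mul_le_mul_left _ (h2 b)
  · simp

/-- The inclusion `ΛV → ΛV ⊗ ΛŪ`. -/
noncomputable def incl : SuperPoly deg →ₐ[ℚ] SuperPoly (edeg deg g) :=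
  hom (fun b => X _ (Sum.inl b)) fun b => hasParity_X (deg := edeg deg g) (Sum.inl b)

@[simp] theorem incl_X (b : β) : incl g (X deg b) = X (edeg deg g) (Sum.inl b) := hom_X _ _ b

theorem incl_sgn (x : SuperPoly deg) : incl g (sgn x) = sgn (incl g x) :=
  hom_sgn _ (fun b => by rw [incl_X]; exact hasParity_X (deg := edeg deg g) (Sum.inl b)) x

/-- The projection `ΛV ⊗ ΛŪ → ΛV`. -/
noncomputable def retr : SuperPoly (edeg deg g) →ₐ[ℚ] SuperPoly deg :=
  hom (Sum.elim (fun b => X deg b) fun _ => 0) (by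
    rintro (b | u)
    · exact hasParity_X b
    · exact HasParity.zero)

theorem retr_incl (x : SuperPoly deg) : retr g (incl g x) = x := by
  have : (retr g).comp (incl g) = AlgHom.id ℚ (SuperPoly deg) := algHom_ext fun b => by
    simp [retr]
  exact DFunLike.congr_fun this x

theorem incl_retr {x : SuperPoly (edeg deg g)}
    (hx : x ∈ wspan (edeg deg g) fun f => ∀ u, f (Sum.inr u) = 0) : incl g (retr g x) = x := by
  refine algHom_eq_of_mem (f := (incl g).comp (retr g)) (g := AlgHom.id ℚ _)
    (p := fun b => ∃ v, b = Sum.inl v) ?_ (wspan_mono (fun f hf b hb => ?_) hx)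
  · rintro _ ⟨v, rfl⟩
    simp [retr]
  · rcases b with v | u
    · exact ⟨v, rfl⟩
    · exact absurd (hf u) hb

theorem retr_mem {t : ℕ} {x : SuperPoly (edeg deg g)}
    (hx : x ∈ wspan (edeg deg g) fun f => t ≤ vdeg deg U f) :
    retr g x ∈ wspan deg fun e => t ≤ Finsupp.weight deg e := by
  refine algHom_mem_wspan (retr g) (R := fun b e => ∃ v, b = Sum.inl v ∧ e = Finsupp.single v 1)
    ?_ (fun f e => Finsupp.weight deg e = vdeg deg U f) (by simp) ?_
    (fun f e hf he => by rw [he]; exact hf) hx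
  · rintro (v | u)
    · simp only [retr, hom_X, Sum.elim_inl]; exact X_mem ⟨v, rfl, rfl⟩
    · simp [retr]
  · rintro _ f e _ he ⟨v, rfl, rfl⟩
    rw [map_add, map_add, he, weight_single_one, vdeg, weight_single_one]
    rfl

theorem incl_mem {t : ℕ} {x : SuperPoly deg} (hx : x ∈ wspan deg fun e => t ≤ Finsupp.weight deg e) :
    incl g x ∈ wspan (edeg deg g) fun f => t ≤ vdeg deg U f ∧ ∀ u, f (Sum.inr u) = 0 := by
  refine algHom_mem_wspan (incl g) (R := fun v f => f = Finsupp.single (Sum.inl v) 1)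
    ?_ (fun e f => vdeg deg U f = Finsupp.weight deg e ∧ ∀ u, f (Sum.inr u) = 0) (by simp) ?_
    (fun f e hf he => ⟨by rw [he.1]; exact hf, he.2⟩) hx
  · intro v
    rw [incl_X]; exact X_mem rfl
  · rintro v e f _ ⟨he, h0⟩ rfl
    rw [map_add, map_add, he, weight_single_one, vdeg, weight_single_one]
    exact ⟨rfl, fun u => by simp [h0 u]⟩

/-- The derivative of a power of a generator `ū`. -/
theorem IsDer.map_pow {γ : Type*} {deg : γ → ℕ} {D : SuperPoly deg →ₗ[ℚ] SuperPoly deg}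
    (hD : IsDer 1 D) (u : γ) {P : (γ →₀ ℕ) → Prop} (hu : D (X deg u) ∈ wspan deg P) (k : ℕ) :
    ∃ m ∈ wspan deg P, D (X deg u ^ k) = m * X deg u ^ (k - 1) := by
  induction k with
  | zero => exact ⟨0, zero_mem _, by simp [hD.map_one]⟩
  | succ k ih =>
    rcases k with _ | k
    · exact ⟨D (X deg u), hu, by simp⟩
    · obtain ⟨m, hm, h⟩ := ih
      refine ⟨D (X deg u) + (-1 : ℚ) ^ deg u • sgnPow (deg u) m,
        Submodule.add_mem _ hu (Submodule.smul_mem _ _ (sgnPow_mem _ hm)), ?_⟩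
      rw [_root_.pow_succ', hD.leibniz, h, sgnPow_one, sgn_X, Nat.add_sub_cancel, smul_mul_assoc,
        ← mul_assoc, X_mul, Nat.add_sub_cancel, mul_assoc, ← _root_.pow_succ', ← smul_mul_assoc,
        add_mul]

variable {g}

/-- The vanishing of cohomology, filtered by `V`-degree, passes from `ΛV` to the extension. The
generators `ū` are added in order of increasing `g`, so that `D` preserves each stage, and for one
`ū` the induction is on the power of `ū`. The leading coefficient is a cocycle `D w`; subtracting `D
(w ū^(K+1))` leaves a remainder of lower power in `ū`. Its `V`-degree is still at least `t + 1`,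
although that of `w` may be only `t`, because `D ū` contains a letter from `V`. -/
theorem exists_primitive (hd : IsMinimalDifferential d) {n : ℕ}
    (hH : ∀ t, n ≤ t → ∀ a ∈ wspan deg (fun e => t + 1 ≤ Finsupp.weight deg e), d a = 0 →
      ∃ b ∈ wspan deg (fun e => t ≤ Finsupp.weight deg e), d b = a)
    {D : SuperPoly (edeg deg g) →ₗ[ℚ] SuperPoly (edeg deg g)} (hD : IsDer 1 D)
    (hDD : ∀ x, D (D x) = 0) (hDV : ∀ v, D (X _ (Sum.inl v)) = incl g (d (X deg v)))
    (hDU : ∀ u, D (X _ (Sum.inr u)) ∈ wspan (edeg deg g) fun f =>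
      1 ≤ vlen β U f ∧ ∀ u', f (Sum.inr u') ≠ 0 → g u' < g u)
    (s : Finset U) : (∀ u ∈ s, ∀ u', g u' < g u → u' ∈ s) → ∀ t, n ≤ t →
      ∀ z ∈ wspan (edeg deg g) (fun f => t + 1 ≤ vdeg deg U f ∧ ∀ u, f (Sum.inr u) ≠ 0 → u ∈ s),
      D z = 0 →
      ∃ w ∈ wspan (edeg deg g) (fun f => t ≤ vdeg deg U f ∧ ∀ u, f (Sum.inr u) ≠ 0 → u ∈ s),
        D w = z := by
  classical
  have hDincl : ∀ x, D (incl g x) = incl g (d x) := fun x =>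
    intertwine (incl_sgn g) hd.isDer hD (p := fun _ => True) (fun b _ => by rw [incl_X, hDV])
      (by simp [wspan_true])
  induction s using Finset.induction_on_max_value g with
  | empty =>
    intro _ t ht z hz hDz
    have hz0 : z ∈ wspan (edeg deg g) fun f => ∀ u, f (Sum.inr u) = 0 :=
      wspan_mono (fun f hf u => by simpa using hf.2 u) hz
    have hzr := incl_retr g hz0
    obtain ⟨b, hb, hdb⟩ := hH t ht (retr g z) (retr_mem g (wspan_mono (fun f hf => hf.1) hz)) (by
      rw [← retr_incl g (d (retr g z)), ← hDincl, hzr, hDz, map_zero])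
    refine ⟨incl g b, wspan_mono (fun f hf => ⟨hf.1, fun u hu => absurd (hf.2 u) hu⟩)
      (incl_mem g hb), ?_⟩
    rw [hDincl, hdb, hzr]
  | insert u s hu hmax ih =>
    intro hinit t ht
    have hs : ∀ x ∈ s, ∀ y, g y < g x → y ∈ s := fun x hx y hy => by
      have h1 := hinit x (Finset.mem_insert_of_mem hx) y hy
      rcases Finset.mem_insert.1 h1 with rfl | h1
      · have := hmax x hx; omega
      · exact h1
    have hus : ∀ y, g y < g u → y ∈ s := fun y hy => by
      rcases Finset.mem_insert.1 (hinit u (Finset.mem_insert_self _ _) y hy) with rfl | h1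
      · omega
      · exact h1
    specialize ih hs
    -- the words without `ū` and with bars in `s`
    have hDs : ∀ {t : ℕ}, ∀ x ∈ wspan (edeg deg g)
        (fun f => t ≤ vdeg deg U f ∧ ∀ u, f (Sum.inr u) ≠ 0 → u ∈ s),
        D x ∈ wspan (edeg deg g) fun f => ∀ u, f (Sum.inr u) ≠ 0 → u ∈ s := by
      intro t x hx
      refine hD.mem_wspan (R := fun b f => ∀ u, f (Sum.inr u) ≠ 0 →
        ∃ v, b = Sum.inr v ∧ g u < g v) ?_ ?_ hx
      · rintro (v | v)
        · rw [hDV]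
          have := incl_mem (deg := deg) (t := 0) g (x := d (X deg v))
            (by simp [wspan_true])
          exact wspan_mono (fun f hf u hu => absurd (hf.2 u) hu) this
        · exact wspan_mono (fun f hf u hu => ⟨v, rfl, hf.2 u hu⟩) (hDU v)
      · intro b e f he hf v hv
        by_cases hfv : f (Sum.inr v) = 0
        · refine he.2 v ?_
          rw [Finsupp.add_apply, hfv, add_zero] at hv
          rw [Finsupp.add_apply]; omega
        · obtain ⟨v', rfl, hlt⟩ := hf v hfv
          exact hs v' (he.2 v' (by simp)) v hlt
    have key : ∀ K : ℕ, (Odd (edeg deg g (Sum.inr u)) → K ≤ 1) →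
        ∀ c : ℕ → SuperPoly (edeg deg g), (∀ k, c k ∈ wspan (edeg deg g)
          (fun f => t + 1 ≤ vdeg deg U f ∧ ∀ u, f (Sum.inr u) ≠ 0 → u ∈ s)) →
        D (∑ k ∈ Finset.range (K + 1), c k * X _ (Sum.inr u) ^ k) = 0 →
        ∃ w ∈ wspan (edeg deg g) (fun f => t ≤ vdeg deg U f ∧
          ∀ v, f (Sum.inr v) ≠ 0 → v ∈ insert u s),
          D w = ∑ k ∈ Finset.range (K + 1), c k * X _ (Sum.inr u) ^ k := by
      intro K
      choose m hm hmD using hD.map_pow (Sum.inr u) (hDU u)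
      induction K with
      | zero =>
        intro _ c hc hcD
        rw [zero_add, Finset.sum_range_one, pow_zero, mul_one] at hcD ⊢
        obtain ⟨w, hw, h⟩ := ih t ht (c 0) (hc 0) hcD
        exact ⟨w, wspan_mono (fun f hf => ⟨hf.1, fun v hv =>
          Finset.mem_insert_of_mem (hf.2 v hv)⟩) hw, h⟩
      | succ K ihK =>
        intro hodd c hc hcD
        have hmul : ∀ {t : ℕ} {a : SuperPoly (edeg deg g)} (k : ℕ), a ∈ wspan (edeg deg g)
            (fun f => t ≤ vdeg deg U f ∧ ∀ u, f (Sum.inr u) ≠ 0 → u ∈ s) →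
            sgn a * m k ∈ wspan (edeg deg g)
            (fun f => t + 1 ≤ vdeg deg U f ∧ ∀ u, f (Sum.inr u) ≠ 0 → u ∈ s) := by
          intro t a k ha
          rw [← sgnPow_one]
          refine mul_mem_wspan ?_ (sgnPow_mem 1 ha) (hm k)
          intro e f he hf
          refine ⟨?_, fun v hv => ?_⟩
          · have := two_mul_vlen_le (U := U) hd.two_le f
            rw [map_add]; omega
          · by_cases h : e (Sum.inr v) = 0
            · rw [Finsupp.add_apply, h, zero_add] at hv
              exact hus v (hf.2 v hv)
            · exact he.2 v h
        have h0 : ∀ {t : ℕ} {a : SuperPoly (edeg deg g)}, a ∈ wspan (edeg deg g)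
            (fun f => t ≤ vdeg deg U f ∧ ∀ u, f (Sum.inr u) ≠ 0 → u ∈ s) →
            a ∈ wspan (edeg deg g) fun f => f (Sum.inr u) = 0 := fun ha =>
          wspan_mono (fun f hf => by
            by_contra h; exact hu (hf.2 u h)) ha
        -- `D` never raises the power of `ū`, so the coefficient of `ū^(K+1)` in the differential of
        -- the sum is `D (c (K + 1))` alone; expansions in powers of `ū` are unique.
        have htop : D (c (K + 1)) = 0 := by
          have hsum : D (∑ k ∈ Finset.range (K + 1 + 1), c k * X _ (Sum.inr u) ^ k) =
              ∑ k ∈ Finset.range (K + 1 + 1), (D (c k) + if k = K + 1 then 0 else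
                sgn (c (k + 1)) * m (k + 1)) * X _ (Sum.inr u) ^ k := by
            have e1 : ∑ k ∈ Finset.range (K + 1 + 1), sgn (c k) * D (X _ (Sum.inr u) ^ k) =
                ∑ k ∈ Finset.range (K + 1), sgn (c (k + 1)) * m (k + 1) * X _ (Sum.inr u) ^ k := by
              rw [Finset.sum_range_succ', pow_zero, hD.map_one, mul_zero, add_zero]
              exact Finset.sum_congr rfl fun k _ => by rw [hmD, Nat.add_sub_cancel, mul_assoc]
            have e2 : ∑ k ∈ Finset.range (K + 1 + 1), (if k = K + 1 then 0 else
                sgn (c (k + 1)) * m (k + 1)) * X _ (Sum.inr u) ^ k =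
                ∑ k ∈ Finset.range (K + 1), sgn (c (k + 1)) * m (k + 1) * X _ (Sum.inr u) ^ k := by
              rw [Finset.sum_range_succ, if_pos rfl, zero_mul, add_zero]
              exact Finset.sum_congr rfl fun k hk => by
                rw [if_neg (by have := Finset.mem_range.1 hk; omega)]
            rw [map_sum]
            simp only [hD.leibniz, add_mul, Finset.sum_add_distrib, sgnPow_one]
            rw [e1, e2]
          rw [hsum] at hcD
          have := eq_zero_of_sum_mul_pow (Sum.inr u) (K + 1) hodd _ (fun k => ?_) hcD (K + 1) le_rfl
          · simpa using this
          · refine Submodule.add_mem _ (wspan_mono (fun f hf => ?_) (hDs _ (hc k))) ?_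
            · by_contra h; exact hu (hf u h)
            · split_ifs
              · exact zero_mem _
              · exact h0 (hmul (k + 1) (hc (k + 1)))
        obtain ⟨w, hw, hwD⟩ := ih t ht _ (hc (K + 1)) htop
        have hDw : D (w * X _ (Sum.inr u) ^ (K + 1)) = c (K + 1) * X _ (Sum.inr u) ^ (K + 1) +
            sgn w * m (K + 1) * X _ (Sum.inr u) ^ K := by
          rw [hD.leibniz, hwD, hmD, sgnPow_one, Nat.add_sub_cancel, mul_assoc]
        -- Subtracting `D (w ū^(K+1))` cancels the leading term and alters only the coefficient of
        -- `ū^K`.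
        obtain ⟨c', hc', hsum⟩ : ∃ c' : ℕ → SuperPoly (edeg deg g),
            (∀ k, c' k ∈ wspan (edeg deg g)
              (fun f => t + 1 ≤ vdeg deg U f ∧ ∀ u, f (Sum.inr u) ≠ 0 → u ∈ s)) ∧
            ∑ k ∈ Finset.range (K + 1), c' k * X _ (Sum.inr u) ^ k =
              ∑ k ∈ Finset.range (K + 1 + 1), c k * X _ (Sum.inr u) ^ k -
                D (w * X _ (Sum.inr u) ^ (K + 1)) := by
          refine ⟨fun k => if k = K then c K - sgn w * m (K + 1) else c k, fun k => ?_, ?_⟩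
          · beta_reduce
            split_ifs
            · exact Submodule.sub_mem _ (hc K) (hmul _ hw)
            · exact hc k
          · have e : ∑ k ∈ Finset.range K, (if k = K then c K - sgn w * m (K + 1) else c k) *
                X _ (Sum.inr u) ^ k = ∑ k ∈ Finset.range K, c k * X _ (Sum.inr u) ^ k :=
              Finset.sum_congr rfl fun k hk => by
                rw [if_neg (by have := Finset.mem_range.1 hk; omega)]
            rw [Finset.sum_range_succ, Finset.sum_range_succ, Finset.sum_range_succ, hDw]
            beta_reduce
            rw [e, if_pos rfl, sub_mul]; abel
        obtain ⟨w', hw', hwD'⟩ := ihK (fun h => (Nat.le_succ K).trans (hodd h)) c' hc' (by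
          rw [hsum, map_sub, hDD, hcD, sub_zero])
        refine ⟨w' + w * X _ (Sum.inr u) ^ (K + 1), Submodule.add_mem _ hw' ?_, by
          rw [map_add, hwD', hsum]; abel⟩
        rw [← word_replicate]
        refine mul_mem_wspan (Q := fun f => ∃ k, f = Finsupp.single (Sum.inr u) k) ?_ hw
          (word_mem ⟨K + 1, cnt_replicate _ _⟩)
        rintro e _ he ⟨k, rfl⟩
        refine ⟨by rw [map_add]; exact he.1.trans (Nat.le_add_right _ _), fun v hv => ?_⟩
        by_cases h : e (Sum.inr v) = 0
        · rw [Finsupp.add_apply, h, zero_add] at hv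
          obtain rfl : v = u := by
            by_contra hne
            exact hv (Finsupp.single_eq_of_ne (by simpa using hne))
          exact Finset.mem_insert_self _ _
        · exact Finset.mem_insert_of_mem (he.2 v h)
    intro z hz hDz
    obtain ⟨K, c, hK, hc, rfl⟩ := exists_expansion (Sum.inr u) hz
    refine key K hK c (fun k => wspan_mono (fun f hf => ?_) (hc k)) hDz
    obtain ⟨hf0, hf1, hf2⟩ := hf
    refine ⟨?_, fun v hv => ?_⟩
    · rw [map_add] at hf1
      simpa [vdeg, Finsupp.weight_single] using hf1
    · have hvu : v ≠ u := by rintro rfl; exact hv hf0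
      exact (Finset.mem_insert.1 (hf2 v (by
        rw [Finsupp.add_apply]; omega))).resolve_left hvu

end Extension

end SuperPoly

namespace SuperPoly

/-! ### Nilpotence of the lowest generators not killed by an evaluation. -/

section Nilpotency

variable {β : Type*} {deg : β → ℕ} {d : SuperPoly deg →ₗ[ℚ] SuperPoly deg}

variable (deg) in
/-- The rank of the generators `û`, `ū` is the degree of `u`. -/
def krank (a : ℕ) : {b : β // deg b < a} ⊕ {b : β // deg b < a} → ℕ :=
  Sum.elim (fun u => deg u.1) fun u => deg u.1

/-- The number of letters of the form `û`. -/
noncomputable def hats (U : Type*) : (U ⊕ U →₀ ℕ) →+ ℕ :=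
  Finsupp.weight (Sum.elim (fun _ => (1 : ℕ)) fun _ => 0)

theorem hats_inl {U : Type*} (u : U) : hats U (Finsupp.single (Sum.inl u) 1) = 1 :=
  weight_single_one _ _

theorem hats_inr {U : Type*} (u : U) : hats U (Finsupp.single (Sum.inr u) 1) = 0 :=
  weight_single_one _ _

theorem vlen_inl {U : Type*} (b : β) : vlen β U (Finsupp.single (Sum.inl b) 1) = 1 :=
  weight_single_one _ _

variable [Finite β]

theorem exists_deg_lt : ∃ N, ∀ b : β, deg b < N := by
  obtain ⟨N, hN⟩ := (Set.finite_range deg).bddAbove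
  exact ⟨N + 1, fun b => Nat.lt_succ_of_le (hN ⟨b, rfl⟩)⟩

/-- A map from the part of `ΛV` generated in degrees `< a` to a contractible algebra. -/
theorem exists_to_contractible (hd : IsMinimalDifferential d) (a : ℕ)
    {g : {b : β // deg b < a} → ℕ} (hgdef : g = fun u => deg u.1)
    {δ h : SuperPoly (kdeg g) →ₗ[ℚ] SuperPoly (kdeg g)} (hδ : IsDer 1 δ)
    (hδl : ∀ u, δ (X _ (Sum.inl u)) = 0)
    (hδh : ∀ x, δ (h x) + h (δ x) = x - algebraMap ℚ _ (aug x))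
    (hpar : ∀ a i, HasParity i a → HasParity (i + 1) (h a)) (haug : ∀ x, aug (h x) = 0)
    (hmem : ∀ P Q : (_ →₀ ℕ) → Prop, (∀ u e, P (Finsupp.single (Sum.inl u) 1 + e) →
        Q (Finsupp.single (Sum.inr u) 1 + e)) → ∀ x ∈ wspan (kdeg g) P, h x ∈ wspan (kdeg g) Q) :
    ∃ ψ : SuperPoly deg →ₐ[ℚ] SuperPoly (kdeg g), (∀ x, ψ (sgn x) = sgn (ψ x)) ∧
      (∀ u, ψ (X deg u.1) = X _ (Sum.inl u) + h (ψ (d (X deg u.1)))) ∧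
      (∀ b, h (ψ (d (X deg b))) ∈ wspan (kdeg g) fun f =>
        1 ≤ hats _ f ∧ ∀ c, f c ≠ 0 → krank deg a c < deg b) ∧
      ∀ b, deg b ≤ a → δ (h (ψ (d (X deg b)))) = ψ (d (X deg b)) := by
  classical
  obtain ⟨N, hN⟩ := exists_deg_lt (deg := deg)
  -- For `deg b < a` the value on `b` is the cocycle `b̂` plus `h (ψ (d b))`, a primitive of the
  -- cocycle `ψ (d b)`. The term `b̂` is what makes `ψ` invertible on these generators after
  -- adjoining the bars; the generators of degree at least `a` go to `0`.
  obtain ⟨ψ, hψs, hψ⟩ := exists_rec_hom (deg := deg) (deg' := kdeg g) deg N hN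
    (fun b => if hb : deg b < a then X _ (Sum.inl ⟨b, hb⟩) else 0) (fun b => d (X deg b))
    (fun b => if deg b < a then h else 0)
    (fun b => wspan_mono (fun e he => he.2) (hd.map_X_lt b)) (by
      intro f hf b
      have h1 := hpar _ _ (HasParity.map hf (hd.isDer.parity _ _ (hasParity_X b)))
      split_ifs with hb
      · refine HasParity.add ?_ (h1.congr (by rw [add_assoc, pow_add]; norm_num))
        refine (hasParity_X (deg := kdeg g) (Sum.inl (⟨b, hb⟩ : {b : β // deg b < a}))).congr ?_
        subst hgdef
        rfl
      · rw [LinearMap.zero_apply, add_zero]; exact HasParity.zero)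
  have hψ1 : ∀ u : {b : β // deg b < a},
      ψ (X deg u.1) = X _ (Sum.inl u) + h (ψ (d (X deg u.1))) := fun u => by
    rw [hψ, dif_pos u.2, if_pos u.2]
  have hψ0 : ∀ b, ¬ deg b < a → ψ (X deg b) = 0 := fun b hb => by
    rw [hψ, dif_neg hb, if_neg hb]; simp
  -- membership
  have hmem1 : ∀ b, (∀ c, deg c < deg b → ψ (X deg c) ∈ wspan (kdeg g) fun f =>
      1 ≤ hats _ f ∧ ∀ v, f v ≠ 0 → krank deg a v ≤ deg c) →
      h (ψ (d (X deg b))) ∈ wspan (kdeg g) fun f =>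
        1 ≤ hats _ f ∧ ∀ c, f c ≠ 0 → krank deg a c < deg b := by
    intro b ih
    have h1 : ψ (d (X deg b)) ∈ wspan (kdeg g) fun f =>
        2 ≤ hats _ f ∧ ∀ c, f c ≠ 0 → krank deg a c < deg b := by
      refine algHom_mem_wspan ψ (R := fun c f => deg c < deg b →
        1 ≤ hats _ f ∧ ∀ v, f v ≠ 0 → krank deg a v ≤ deg c) ?_
        (fun e f => (∀ c, e c ≠ 0 → deg c < deg b) →
          len β e ≤ hats _ f ∧ ∀ v, f v ≠ 0 → krank deg a v < deg b) ?_ ?_ ?_ (hd.map_X_lt b)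
      · intro c
        by_cases hc : deg c < deg b
        · exact wspan_mono (fun f hf _ => hf) (ih c hc)
        · rw [show (fun f => deg c < deg b → 1 ≤ hats _ f ∧ ∀ v, f v ≠ 0 → krank deg a v ≤ deg c) =
            fun _ => True from funext fun f => by simp [hc], wspan_true]
          trivial
      · simp
      · intro c e f f' hT hR hlt
        obtain ⟨k1, k2⟩ := hT fun c' hc' => hlt c' (by rw [Finsupp.add_apply]; omega)
        have hcb := hlt c (by simp)
        obtain ⟨k3, k4⟩ := hR hcb
        refine ⟨by rw [map_add, map_add, weight_single_one]; omega, fun v hv => ?_⟩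
        by_cases hfv : f' v = 0
        · exact k2 v (by rw [Finsupp.add_apply] at hv; omega)
        · exact (k4 v hfv).trans_lt hcb
      · intro e f he hT
        obtain ⟨k1, k2⟩ := hT he.2
        exact ⟨he.1.trans k1, k2⟩
    -- A decomposable word maps to terms with at least two hats; `h` replaces one of them by a bar,
    -- so one hat is left.
    refine hmem _ _ (fun u e he => ⟨?_, fun c hc => ?_⟩) _ h1
    · have := he.1
      rw [map_add, hats_inl] at this
      rw [map_add, hats_inr]; omega
    · by_cases hec : e c = 0
      · obtain rfl : c = Sum.inr u := by
          by_contra hne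
          rw [Finsupp.add_apply, hec, Finsupp.single_eq_of_ne hne] at hc
          exact hc rfl
        exact he.2 (Sum.inl u) (by simp)
      · exact he.2 c (by rw [Finsupp.add_apply]; omega)
  have hmem2 : ∀ k b, deg b ≤ k → ψ (X deg b) ∈ wspan (kdeg g) fun f =>
      1 ≤ hats _ f ∧ ∀ v, f v ≠ 0 → krank deg a v ≤ deg b := by
    intro k
    induction k with
    | zero => intro b hb; have := hd.two_le b; omega
    | succ k ih =>
      intro b hb
      by_cases hba : deg b < a
      · rw [hψ1 ⟨b, hba⟩]
        refine Submodule.add_mem _ (X_mem ⟨(hats_inl _).ge, fun v hv => ?_⟩)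
          (wspan_mono (fun f hf => ⟨hf.1, fun v hv => (hf.2 v hv).le⟩)
            (hmem1 b fun c hc => ih c (by omega)))
        obtain rfl : v = Sum.inl ⟨b, hba⟩ := by
          by_contra hne
          exact hv (Finsupp.single_eq_of_ne hne)
        exact le_rfl
      · rw [hψ0 b hba]; exact zero_mem _
  have haugψ : ∀ x, aug (ψ x) = aug x := fun x => by
    have : aug.comp ψ = aug := algHom_ext fun b => by
      by_cases hba : deg b < a
      · rw [AlgHom.comp_apply, hψ1 ⟨b, hba⟩, map_add, haug, aug_X, aug_X, add_zero]
      · rw [AlgHom.comp_apply, hψ0 b hba, map_zero, aug_X]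
    exact DFunLike.congr_fun this x
  have haugd : ∀ b, aug (d (X deg b)) = 0 := fun b => by
    have := eq_of_mem_wspan aug.toLinearMap (0 : SuperPoly deg →ₗ[ℚ] ℚ) (fun l hl => by
      rcases l with _ | ⟨b, l⟩
      · simp at hl
      · simp) (hd.map_X b)
    simpa using this
  -- If `ψ` is a chain map below the degree of `b`, then `ψ (d b)` is a cocycle without constant
  -- term, and the contraction shows that `h` of it is a primitive.
  have hchain : ∀ k ≤ a, ∀ b, deg b < k → δ (ψ (X deg b)) = ψ (d (X deg b)) := by
    intro k
    induction k with
    | zero => intro _ b hb; omega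
    | succ k ih =>
      intro hk b hb
      have h1 : δ (ψ (d (X deg b))) = 0 := by
        rw [intertwine hψs hd.isDer hδ (ih (by omega))
          (wspan_mono (fun e he c hc => by have := he.2 c hc; omega) (hd.map_X_lt b)),
          hd.sq_zero, map_zero]
      have h2 := hδh (ψ (d (X deg b)))
      rw [h1, map_zero, add_zero, haugψ, haugd, map_zero, sub_zero] at h2
      rw [hψ1 ⟨b, by omega⟩, map_add, hδl, h2, zero_add]
  refine ⟨ψ, hψs, hψ1, fun b => hmem1 b fun c _ => hmem2 _ c le_rfl, fun b hb => ?_⟩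
  have h1 : δ (ψ (d (X deg b))) = 0 := by
    rw [intertwine hψs hd.isDer hδ (hchain a le_rfl)
      (wspan_mono (fun e he c hc => by have := he.2 c hc; omega) (hd.map_X_lt b)),
      hd.sq_zero, map_zero]
  have h2 := hδh (ψ (d (X deg b)))
  rwa [h1, map_zero, add_zero, haugψ, haugd, map_zero, sub_zero] at h2

/-- If the cohomology of a minimal algebra `ΛV` vanishes above degree `n`, then a multiplicative
map to an algebra with zero differential that vanishes in degrees `< a` takes nilpotent values on
the generators of degree `a`. -/
theorem pow_eq_zero_of_hom (hd : IsMinimalDifferential d) {n : ℕ}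
    (hH : ∀ t, n ≤ t → ∀ a ∈ wspan deg (fun e => t + 1 ≤ Finsupp.weight deg e), d a = 0 →
      ∃ b ∈ wspan deg (fun e => t ≤ Finsupp.weight deg e), d b = a)
    {R : Type*} [CommRing R] [Algebra ℚ R] (ε : SuperPoly deg →ₐ[ℚ] R) (hε : ∀ x, ε (d x) = 0)
    (hodd : ∀ b, Odd (deg b) → ε (X deg b) = 0) (x : β)
    (hlow : ∀ b, deg b < deg x → ε (X deg b) = 0) : ε (X deg x) ^ (n + 1) = 0 := by
  classical
  have := Fintype.ofFinite {b : β // deg b < deg x}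
  obtain ⟨g, hg⟩ : ∃ g : {b : β // deg b < deg x} → ℕ, g = fun u => deg u.1 := ⟨_, rfl⟩
  have hg2 : ∀ u, g u = deg u.1 := fun u => by rw [hg]
  obtain ⟨δ, h, hδ, hδr, hδl, hδh, hpar, haug, hmem⟩ := exists_contraction g
    fun u => by rw [hg2]; exact le_of_lt (hd.two_le u.1)
  obtain ⟨ψ, hψs, hψ, hψm, hδψ⟩ := exists_to_contractible hd (deg x) hg hδ hδl hδh hpar haug hmem
  obtain ⟨N, hN⟩ := exists_deg_lt (deg := deg)
  -- the comparison map `κ`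
  obtain ⟨κ, hκs, hκ⟩ := exists_rec_hom (deg := kdeg g) (deg' := edeg deg g)
    (krank deg (deg x)) N (by rintro (u | u) <;> exact hN u.1)
    (Sum.elim (fun u => X _ (Sum.inl u.1)) fun u => X _ (Sum.inr u))
    (Sum.elim (fun u => h (ψ (d (X deg u.1)))) fun _ => 0)
    (Sum.elim (fun _ => -LinearMap.id) fun _ => 0)
    (by
      rintro (u | u)
      · exact wspan_mono (fun f hf => hf.2) (hψm u.1)
      · exact zero_mem _)
    (by
      rintro f hf (u | u)
      · simp only [Sum.elim_inl, LinearMap.neg_apply, LinearMap.id_apply]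
        have h1 := hpar _ _ (HasParity.map hψs (hd.isDer.parity _ _ (hasParity_X u.1)))
        have e1 : kdeg g (Sum.inl u) = deg u.1 := hg2 u
        refine HasParity.add ((hasParity_X (deg := edeg deg g) (Sum.inl u.1)).congr ?_)
          ((HasParity.map hf h1).congr ?_).neg
        · rw [e1]; rfl
        · rw [e1, add_assoc, pow_add]; norm_num
      · simp only [Sum.elim_inr, LinearMap.zero_apply, add_zero]
        exact (hasParity_X (deg := edeg deg g) (Sum.inr u)).congr rfl)
  -- The correction makes `κ (ψ u) = u` for all generators of degree below `deg x`. Setting `D ū = κ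
  -- û` then turns `κ` into a chain map.
  have hκl : ∀ u, κ (X _ (Sum.inl u)) = X _ (Sum.inl u.1) - κ (h (ψ (d (X deg u.1)))) := fun u => by
    rw [hκ]; simp [sub_eq_add_neg]
  have hκr : ∀ u, κ (X _ (Sum.inr u)) = X _ (Sum.inr u) := fun u => by rw [hκ]; simp
  -- `κ` sends words with a hat to words with a letter from `V`
  have hκm : ∀ k, ∀ y ∈ wspan (kdeg g) (fun f => 1 ≤ hats _ f ∧
      ∀ c, f c ≠ 0 → krank deg (deg x) c < k), κ y ∈ wspan (edeg deg g) fun f =>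
        1 ≤ vlen β _ f ∧ ∀ u, f (Sum.inr u) ≠ 0 → g u < k := by
    intro k
    induction k with
    | zero =>
      intro y hy
      have : y ∈ wspan (kdeg g) fun _ => False := wspan_mono (fun f hf => by
        by_cases hf0 : f = 0
        · rw [hf0, map_zero] at hf; omega
        · obtain ⟨c, hc⟩ := Finsupp.ne_iff.1 hf0
          have := hf.2 c hc; omega) hy
      rw [wspan_false] at this
      rw [(Submodule.mem_bot ℚ).1 this, map_zero]
      exact zero_mem _
    | succ k ih =>
      intro y hy
      refine algHom_mem_wspan κ (R := fun c f => krank deg (deg x) c < k + 1 →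
        hats _ (Finsupp.single c 1) ≤ vlen β _ f ∧ ∀ u, f (Sum.inr u) ≠ 0 → g u < k + 1) ?_
        (fun e f => (∀ c, e c ≠ 0 → krank deg (deg x) c < k + 1) →
          hats _ e ≤ vlen β _ f ∧ ∀ u, f (Sum.inr u) ≠ 0 → g u < k + 1) ?_ ?_ ?_ hy
      · intro c
        by_cases hc : krank deg (deg x) c < k + 1
        · rcases c with u | u
          · rw [hκl]
            refine Submodule.sub_mem _ (X_mem fun _ => ⟨?_, by simp⟩) ?_
            · rw [hats_inl]; exact (vlen_inl _).ge
            · have := ih (h (ψ (d (X deg u.1)))) (wspan_mono (fun f hf => ⟨hf.1, fun c hc' =>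
                lt_of_lt_of_le (hf.2 c hc') (Nat.lt_succ_iff.1 hc)⟩) (hψm u.1))
              exact wspan_mono (fun f hf _ => ⟨by rw [hats_inl]; exact hf.1, fun v hv =>
                (hf.2 v hv).trans (Nat.lt_succ_self k)⟩) this
          · rw [hκr]
            refine X_mem fun _ => ⟨by rw [hats_inr]; exact Nat.zero_le _, fun v hv => ?_⟩
            obtain rfl : v = u := by
              by_contra hne
              exact hv (Finsupp.single_eq_of_ne (by simpa using hne))
            rw [hg2]; exact hc
        · rw [show (fun f => krank deg (deg x) c < k + 1 → hats _ (Finsupp.single c 1) ≤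
              vlen β _ f ∧ ∀ u, f (Sum.inr u) ≠ 0 → g u < k + 1) =
            fun _ => True from funext fun f => by simp [hc], wspan_true]
          trivial
      · simp
      · intro c e f f' hT hR hlt
        obtain ⟨k1, k2⟩ := hT fun c' hc' => hlt c' (by rw [Finsupp.add_apply]; omega)
        obtain ⟨k3, k4⟩ := hR (hlt c (by simp))
        refine ⟨by rw [map_add, map_add]; omega, fun v hv => ?_⟩
        by_cases hfv : f' (Sum.inr v) = 0
        · exact k2 v (by rw [Finsupp.add_apply] at hv; omega)
        · exact k4 v hfv
      · intro e f he hT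
        obtain ⟨k1, k2⟩ := hT he.2
        exact ⟨he.1.trans k1, k2⟩
  -- the differential on `ΛV ⊗ ΛŪ`
  obtain ⟨D, hD, hDX⟩ := exists_isDer (deg := edeg deg g) 1
    (Sum.elim (fun v => incl g (d (X deg v))) fun u => κ (X _ (Sum.inl u))) (by
      rintro (v | u)
      · exact HasParity.map (incl_sgn g) (hd.isDer.parity _ _ (hasParity_X v))
      · refine (HasParity.map hκs (hasParity_X (deg := kdeg g) (Sum.inl u))).congr ?_
        have e1 : kdeg g (Sum.inl u) = deg u.1 := hg2 u
        have e2 : edeg deg g (Sum.inr u) = deg u.1 - 1 := by rw [← hg2]; rfl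
        have := hd.two_le u.1
        rw [e1, e2, Nat.sub_add_cancel (by omega)])
  have hDV : ∀ v, D (X _ (Sum.inl v)) = incl g (d (X deg v)) := fun v => hDX _
  have hDU : ∀ u, D (X _ (Sum.inr u)) = κ (X _ (Sum.inl u)) := fun u => hDX _
  have hDincl : ∀ y, D (incl g y) = incl g (d y) := fun y =>
    intertwine (incl_sgn g) hd.isDer hD (p := fun _ => True) (fun b _ => by rw [incl_X, hDV])
      (by simp [wspan_true])
  have hκψ : ∀ y ∈ wspan deg (fun e => ∀ b, e b ≠ 0 → deg b < deg x), κ (ψ y) = incl g y :=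
    fun y hy => algHom_eq_of_mem (f := κ.comp ψ) (g := incl g) (fun b hb => by
      rw [AlgHom.comp_apply, hψ ⟨b, hb⟩, map_add, hκl, incl_X, sub_add_cancel]) hy
  have hdlow : ∀ b, deg b ≤ deg x → κ (ψ (d (X deg b))) = incl g (d (X deg b)) := fun b hb =>
    hκψ _ (wspan_mono (fun e he c hc => (he.2 c hc).trans_le hb) (hd.map_X_lt b))
  have hDκ : ∀ k, ∀ y ∈ wspan (kdeg g) (fun f => ∀ c, f c ≠ 0 → krank deg (deg x) c < k),
      D (κ y) = κ (δ y) := by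
    intro k
    induction k with
    | zero =>
      intro y hy
      exact intertwine hκs hδ hD (p := fun c => krank deg (deg x) c < 0) (fun c hc => by omega) hy
    | succ k ih =>
      intro y hy
      refine intertwine hκs hδ hD (p := fun c => krank deg (deg x) c < k + 1) ?_ hy
      rintro (u | u) hu
      · rw [hδl, map_zero, hκl, map_sub, hDV, ih _ (wspan_mono (fun f hf c hc =>
          lt_of_lt_of_le (hf.2 c hc) (Nat.lt_succ_iff.1 hu)) (hψm u.1)), hδψ u.1 u.2.le,
          hdlow u.1 u.2.le, sub_self]
      · rw [hκr, hDU, hδr]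
  have hDκ' : ∀ b, D (κ (h (ψ (d (X deg b))))) = κ (δ (h (ψ (d (X deg b))))) := fun b =>
    hDκ _ _ (wspan_mono (fun f hf => hf.2) (hψm b))
  have hDD : ∀ y, D (D y) = 0 := hD.sq_eq_zero (by
    rintro (v | u)
    · rw [hDV, hDincl, hd.sq_zero, map_zero]
    · rw [hDU, hDκ (deg u.1 + 1) _ (X_mem fun c hc => ?_), hδl, map_zero]
      obtain rfl : c = Sum.inl u := by
        by_contra hne
        exact hc (Finsupp.single_eq_of_ne hne)
      exact Nat.lt_succ_self _)
  -- the cocycle `z`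
  obtain ⟨z, hz⟩ : ∃ z, z = X (edeg deg g) (Sum.inl x) - κ (h (ψ (d (X deg x)))) := ⟨_, rfl⟩
  have hDz : D z = 0 := by
    rw [hz, map_sub, hDV, hDκ', hδψ x le_rfl, hdlow x le_rfl, sub_self]
  have hzm : z ∈ wspan (edeg deg g) fun f => 1 ≤ vlen β _ f := by
    rw [hz]
    exact Submodule.sub_mem _ (X_mem (vlen_inl _).ge)
      (wspan_mono (fun f hf => hf.1) (hκm _ _ (hψm x)))
  have hzpow : ∀ m, z ^ m ∈ wspan (edeg deg g) (fun f => m ≤ vlen β _ f) ∧ D (z ^ m) = 0 := by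
    intro m
    induction m with
    | zero => exact ⟨by rw [pow_zero]; exact one_mem_wspan (by simp), by rw [pow_zero, hD.map_one]⟩
    | succ m ih =>
      rw [_root_.pow_succ]
      exact ⟨mul_mem_wspan (fun e f he hf => by rw [map_add]; omega) ih.1 hzm, by
        rw [hD.leibniz, ih.2, hDz, zero_mul, mul_zero, add_zero]⟩
  -- Every term of `z ^ (n + 1)` has at least `n + 1` letters from `V`, hence `V`-degree at least `n
  -- + 1`; so it bounds, and `t = n` is enough.
  obtain ⟨w, -, hw⟩ := exists_primitive hd hH hD hDD hDV (fun u => by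
      rw [hDU, hκl]
      refine Submodule.sub_mem _ (X_mem ⟨(vlen_inl _).ge, by simp⟩)
        (wspan_mono (fun f hf => ⟨hf.1, fun v hv => ?_⟩) (hκm _ _ (hψm u.1)))
      rw [hg2 u]; exact hf.2 v hv)
    Finset.univ (fun _ _ _ _ => Finset.mem_univ _) n le_rfl (z ^ (n + 1))
    (wspan_mono (fun f hf => ⟨by
      have := two_mul_vlen_le (U := {b : β // deg b < deg x}) hd.two_le f
      omega, fun _ _ => Finset.mem_univ _⟩) (hzpow (n + 1)).1) (hzpow (n + 1)).2
  -- evaluation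
  let π : SuperPoly (edeg deg g) →ₐ[ℚ] R :=
    lift (Sum.elim (fun v => ε (X deg v)) fun _ => 0) (by
      rintro (v | v) (v' | v')
      · simp only [Sum.elim_inl, edeg]
        by_cases hv : Odd (deg v)
        · simp [hodd v hv]
        · rw [((Nat.not_odd_iff_even.1 hv).mul_right _).neg_one_pow, one_smul, mul_comm]
      all_goals simp)
  have hπl : ∀ v, π (X _ (Sum.inl v)) = ε (X deg v) := fun v => lift_X _ _ _
  have hπr : ∀ v, π (X _ (Sum.inr v)) = 0 := fun v => lift_X _ _ _
  have hπincl : ∀ y, π (incl g y) = ε y := fun y => by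
    have : π.comp (incl g) = ε := algHom_ext fun b => by rw [AlgHom.comp_apply, incl_X, hπl]
    exact DFunLike.congr_fun this y
  -- The generators below `deg x` and all bars evaluate to zero, so `π ∘ κ` is the augmentation. As
  -- `aug ∘ h = 0`, the correction terms in `z` disappear and `π z = ε x`.
  have hπκ : ∀ k, ∀ y ∈ wspan (kdeg g) (fun f => ∀ c, f c ≠ 0 → krank deg (deg x) c < k),
      π (κ y) = algebraMap ℚ R (aug y) := by
    intro k
    induction k with
    | zero =>
      intro y hy
      exact algHom_eq_of_mem (f := π.comp κ) (g := (Algebra.ofId ℚ R).comp aug)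
        (p := fun c => krank deg (deg x) c < 0) (fun c hc => by omega) hy
    | succ k ih =>
      intro y hy
      refine algHom_eq_of_mem (f := π.comp κ) (g := (Algebra.ofId ℚ R).comp aug)
        (p := fun c => krank deg (deg x) c < k + 1) ?_ hy
      rintro (u | u) hu
      · rw [AlgHom.comp_apply, AlgHom.comp_apply, aug_X, map_zero, hκl, map_sub, hπl,
          hlow u.1 u.2, ih _ (wspan_mono (fun f hf c hc =>
          lt_of_lt_of_le (hf.2 c hc) (Nat.lt_succ_iff.1 hu)) (hψm u.1)), haug, map_zero, sub_zero]
      · rw [AlgHom.comp_apply, AlgHom.comp_apply, aug_X, map_zero, hκr, hπr]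
  have hπD : ∀ y, π (D y) = 0 := fun y => by
    induction y using word_induction with
    | hw l =>
      induction l with
      | nil => rw [word_nil, hD.map_one, map_zero]
      | cons b l ih =>
        have hb : π (D (X _ b)) = 0 := by
          rcases b with v | u
          · rw [hDV, hπincl, hε]
          · have e := hπκ (deg u.1 + 1) (X _ (Sum.inl u)) (X_mem fun c hc => by
              obtain rfl : c = Sum.inl u := by
                by_contra hne
                exact hc (Finsupp.single_eq_of_ne hne)
              exact Nat.lt_succ_self _)
            rw [hDU, e, aug_X, map_zero]
        rw [word_cons, hD.leibniz, map_add, map_mul, map_mul, hb, ih, zero_mul, mul_zero, add_zero]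
    | hadd x y hx hy => rw [map_add, map_add, hx, hy, add_zero]
    | hsmul r x hx => rw [map_smul, map_smul, hx, smul_zero]
  have hπz : π z = ε (X deg x) := by
    rw [hz, map_sub, hπl, hπκ _ _ (wspan_mono (fun f hf => hf.2) (hψm x)), haug, map_zero, sub_zero]
  rw [← hπz, ← map_pow, ← hw, hπD]

end Nilpotency

end SuperPoly

/-! ### Ideals of polynomial rings containing powers of the variables -/

namespace MvPolynomial

variable {σ : Type*}

open Classical in
/-- The map that sets the variables in `s` to zero. -/
noncomputable def killVars (s : Finset σ) : MvPolynomial σ ℚ →ₐ[ℚ] MvPolynomial σ ℚ :=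
  aeval fun i => if i ∈ s then 0 else X i

/-- Killing the variables of `s` one after another gives a strictly increasing chain of kernels,
each prime because the target is a domain. -/
theorem card_le_height_ker_killVars (s : Finset σ) :
    (s.card : ℕ∞) ≤ (RingHom.ker (killVars s)).height := by
  classical
  induction s using Finset.induction_on with
  | empty => simp
  | insert a s ha ih =>
    rw [Finset.card_insert_of_notMem ha, Nat.cast_succ]
    refine (add_le_add_left ih 1).trans ?_
    have hp : ∀ t : Finset σ, (RingHom.ker (killVars t)).IsPrime := fun t => RingHom.ker_isPrime _
    have := hp s
    have := hp (insert a s)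
    refine Ideal.height_add_one_le_of_lt_of_isPrime ?_
    refine lt_of_le_not_ge (fun p hp => ?_) fun hle => ?_
    · have e : killVars (insert a s) = (killVars (insert a s)).comp (killVars s) := by
        ext i : 1
        by_cases hi : i ∈ s <;> simp [killVars, hi]
      rw [RingHom.mem_ker] at hp ⊢
      rw [e, AlgHom.comp_apply, hp, map_zero]
    · have h1 : X a ∈ RingHom.ker (killVars (insert a s)) := by
        rw [RingHom.mem_ker]; simp [killVars]
      have h2 := hle h1
      rw [RingHom.mem_ker] at h2
      simp [killVars, ha] at h2

/-- An ideal generated by `r` polynomials without constant term, whose radical contains all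
variables, needs at least as many generators as there are variables. -/
theorem card_le_of_X_mem_radical [Fintype σ] (G : Finset (MvPolynomial σ ℚ))
    (h0 : ∀ f ∈ G, constantCoeff f = 0) (hX : ∀ i : σ, (X i : MvPolynomial σ ℚ) ∈
      (Ideal.span (G : Set (MvPolynomial σ ℚ))).radical) :
    Fintype.card σ ≤ G.card := by
  classical
  have haev : ∀ f : MvPolynomial σ ℚ, killVars Finset.univ f = C (constantCoeff f) := fun f => by
    have : killVars (Finset.univ : Finset σ) = aeval (fun _ => (0 : MvPolynomial σ ℚ)) := by
      simp [killVars]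
    rw [this]
    exact aeval_zero' f
  have hprime : (RingHom.ker (killVars (Finset.univ : Finset σ))).IsPrime := RingHom.ker_isPrime _
  -- The ideal of the origin contains `G`, whose elements have no constant term, and a prime
  -- containing `G` contains all variables. So it is a minimal prime over `G`, and Krull's height
  -- theorem bounds its height by the number of generators.
  have hmin : RingHom.ker (killVars (Finset.univ : Finset σ)) ∈
      (Ideal.span (G : Set (MvPolynomial σ ℚ))).minimalPrimes := by
    refine ⟨⟨hprime, Ideal.span_le.2 fun f hf => ?_⟩, fun q hq _ f hf => ?_⟩
    · rw [SetLike.mem_coe, RingHom.mem_ker, haev, h0 f hf, C_0]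
    · have hXq : ∀ i, X i ∈ q := fun i => (hq.1.radical_le_iff.2 hq.2) (hX i)
      have hf' : f ∈ Ideal.span (X '' (Set.univ : Set σ) : Set (MvPolynomial σ ℚ)) := by
        rw [mem_ideal_span_X_image]
        intro m hm
        by_contra hcon
        push Not at hcon
        obtain rfl : m = 0 := Finsupp.ext fun i => hcon i trivial
        rw [RingHom.mem_ker, haev, ← C_0, (C_injective σ ℚ).eq_iff] at hf
        exact mem_support_iff.1 hm hf
      refine (Ideal.span_le.2 ?_ : _ ≤ q) hf'
      rintro _ ⟨i, -, rfl⟩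
      exact hXq i
  have h1 := card_le_height_ker_killVars (Finset.univ : Finset σ)
  have h2 := Ideal.height_le_card_of_mem_minimalPrimes_span_finset hmin
  rw [Finset.card_univ] at h1
  exact_mod_cast h1.trans h2

end MvPolynomial

namespace SuperPoly

/-! ### The associated pure algebra and the matching of even with odd generators. -/

section Pure

variable {β : Type*} {deg : β → ℕ} {d : SuperPoly deg →ₗ[ℚ] SuperPoly deg}

variable (deg) in
open Classical in
/-- The projection of `ΛV` to the polynomial algebra on the even generators. -/
noncomputable def evenPart : SuperPoly deg →ₐ[ℚ] MvPolynomial {b // Even (deg b)} ℚ :=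
  lift (fun b => if h : Even (deg b) then MvPolynomial.X ⟨b, h⟩ else 0) fun b c => by
    by_cases hb : Even (deg b)
    · rw [(hb.mul_right _).neg_one_pow, one_smul, mul_comm]
    · simp [hb]

theorem evenPart_X_even (i : {b // Even (deg b)}) :
    evenPart deg (X deg i.1) = MvPolynomial.X i := by
  classical
  rw [evenPart, lift_X, dif_pos i.2]

theorem evenPart_X_odd {b : β} (hb : Odd (deg b)) : evenPart deg (X deg b) = 0 := by
  classical
  rw [evenPart, lift_X, dif_neg (Nat.not_even_iff_odd.2 hb)]

theorem evenPart_sgn (x : SuperPoly deg) : evenPart deg (sgn x) = evenPart deg x := by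
  have : (evenPart deg).comp sgn = evenPart deg := algHom_ext fun b => by
    rw [AlgHom.comp_apply, sgn_X, map_smul]
    rcases Nat.even_or_odd (deg b) with h | h
    · rw [h.neg_one_pow, one_smul]
    · rw [evenPart_X_odd h, smul_zero]
  exact DFunLike.congr_fun this x

theorem evenPart_eq_zero_of_odd {i : ℕ} (hi : Odd i) {x : SuperPoly deg} (hx : HasParity i x) :
    evenPart deg x = 0 := by
  have h := evenPart_sgn x
  rw [hx, hi.neg_one_pow, neg_one_smul, map_neg, neg_eq_iff_add_eq_zero, ← two_smul ℚ] at h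
  exact (smul_eq_zero.1 h).resolve_left two_ne_zero

/-- The ideal generated by the pure parts of the differentials of the odd generators. -/
noncomputable def pureIdeal (d : SuperPoly deg →ₗ[ℚ] SuperPoly deg) :
    Ideal (MvPolynomial {b // Even (deg b)} ℚ) :=
  Ideal.span (Set.range fun j : {b // Odd (deg b)} => evenPart deg (d (X deg j.1)))

/-- `evenPart` kills everything of odd parity, so only differentials of odd generators contribute to
the Leibniz expansion. Thus `evenPart` modulo this ideal kills boundaries, as `pow_eq_zero_of_hom`
demands. -/
theorem evenPart_d_mem (hd : IsMinimalDifferential d) (x : SuperPoly deg) :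
    evenPart deg (d x) ∈ pureIdeal d := by
  induction x using word_induction with
  | hw l =>
    induction l with
    | nil => rw [word_nil, hd.isDer.map_one, map_zero]; exact zero_mem _
    | cons b l ih =>
      rw [word_cons, hd.isDer.leibniz, map_add, map_mul, map_mul]
      refine Ideal.add_mem _ (Ideal.mul_mem_right _ _ ?_) (Ideal.mul_mem_left _ _ ih)
      rcases Nat.even_or_odd (deg b) with h | h
      · rw [evenPart_eq_zero_of_odd (h.add_one) (hd.isDer.parity _ _ (hasParity_X b))]
        exact zero_mem _
      · exact Ideal.subset_span ⟨⟨b, h⟩, rfl⟩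
  | hadd x y hx hy => rw [map_add, map_add]; exact Ideal.add_mem _ hx hy
  | hsmul r x hx => rw [map_smul, map_smul]; exact Submodule.smul_of_tower_mem _ r hx

/-- For a minimal algebra with bounded cohomology the associated pure algebra is
finite dimensional. -/
theorem X_mem_radical_pureIdeal [Finite β] (hd : IsMinimalDifferential d) {n : ℕ}
    (hH : ∀ t, n ≤ t → ∀ a ∈ wspan deg (fun e => t + 1 ≤ Finsupp.weight deg e), d a = 0 →
      ∃ b ∈ wspan deg (fun e => t ≤ Finsupp.weight deg e), d b = a)
    (i : {b // Even (deg b)}) : MvPolynomial.X i ∈ (pureIdeal d).radical := by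
  obtain ⟨k, hk⟩ : ∃ k, k = deg i.1 := ⟨_, rfl⟩
  induction k using Nat.strong_induction_on generalizing i with
  | _ k ih =>
    -- Modulo `J` all even generators of smaller degree vanish, so `pow_eq_zero_of_hom` puts a power
    -- of `X i` in `J`. By induction `J` lies in the radical of the pure ideal.
    obtain ⟨J, hJ⟩ : ∃ J, J = pureIdeal d ⊔
      Ideal.span (MvPolynomial.X '' {i' : {b // Even (deg b)} | deg i'.1 < deg i.1}) := ⟨_, rfl⟩
    have hJ1 : pureIdeal d ≤ J := hJ ▸ le_sup_left
    have h := pow_eq_zero_of_hom hd hH ((Ideal.Quotient.mkₐ ℚ J).comp (evenPart deg))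
      (fun x => Ideal.Quotient.eq_zero_iff_mem.2 (hJ1 (evenPart_d_mem hd x)))
      (fun b hb => by rw [AlgHom.comp_apply, evenPart_X_odd hb, map_zero]) i.1
      (fun b hb => by
        rcases Nat.even_or_odd (deg b) with h | h
        · rw [AlgHom.comp_apply, evenPart_X_even ⟨b, h⟩]
          refine Ideal.Quotient.eq_zero_iff_mem.2 ?_
          rw [hJ]
          exact Ideal.mem_sup_right (Ideal.subset_span ⟨⟨b, h⟩, hb, rfl⟩)
        · rw [AlgHom.comp_apply, evenPart_X_odd h, map_zero])
    rw [AlgHom.comp_apply, evenPart_X_even, ← map_pow] at h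
    have h1 : MvPolynomial.X i ^ (n + 1) ∈ J := Ideal.Quotient.eq_zero_iff_mem.1 h
    have h2 : J ≤ (pureIdeal d).radical := by
      rw [hJ]
      refine sup_le Ideal.le_radical (Ideal.span_le.2 ?_)
      rintro _ ⟨i', hi', rfl⟩
      exact ih (deg i'.1) (hk ▸ hi') i' rfl
    rw [← Ideal.radical_idem]
    exact ⟨n + 1, h2 h1⟩

/-- The pure part of a sum of words of length at least two and weight `k` lies in the ideal of the
variables of degree at most `k / 2`. -/
theorem evenPart_mem_span {k : ℕ} (S : Set {b // Even (deg b)})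
    (hS : ∀ i ∈ S, k < 2 * deg i.1) {x : SuperPoly deg}
    (hx : x ∈ wspan deg fun e => 2 ≤ len β e ∧ Finsupp.weight deg e = k) :
    evenPart deg x ∈ Ideal.span (MvPolynomial.X '' Sᶜ) := by
  refine map_mem_of_mem_wspan (N := (Ideal.span (MvPolynomial.X '' Sᶜ)).restrictScalars ℚ)
    (evenPart deg).toLinearMap (fun l hl => ?_) hx
  rw [Submodule.restrictScalars_mem, AlgHom.toLinearMap_apply]
  -- If all letters were even and in `S`, two of them would already have total degree greater than
  -- `k`.
  have key : ∃ b ∈ l, ∀ h : Even (deg b), (⟨b, h⟩ : {b // Even (deg b)}) ∉ S := by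
    by_contra hcon
    push Not at hcon
    rw [weight_cnt, weight_cnt] at hl
    rcases l with _ | ⟨b, _ | ⟨c, l⟩⟩
    · simp at hl
    · simp at hl
    · obtain ⟨h1, h1'⟩ := hcon b (by simp)
      obtain ⟨h2, h2'⟩ := hcon c (by simp)
      have h3 : k < 2 * deg b := hS _ h1'
      have h4 : k < 2 * deg c := hS _ h2'
      simp only [List.map_cons, List.sum_cons] at hl
      omega
  obtain ⟨b, hb, hbS⟩ := key
  have hb' : evenPart deg (X deg b) ∈ Ideal.span (MvPolynomial.X '' Sᶜ) := by
    rcases Nat.even_or_odd (deg b) with h | h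
    · rw [evenPart_X_even ⟨b, h⟩]
      exact Ideal.subset_span ⟨_, hbS h, rfl⟩
    · rw [evenPart_X_odd h]; exact zero_mem _
  clear hl
  induction l with
  | nil => simp at hb
  | cons c l ih =>
    rw [word_cons, map_mul]
    rcases List.mem_cons.1 hb with rfl | hb
    · exact Ideal.mul_mem_right _ _ hb'
    · exact Ideal.mul_mem_left _ _ (ih hb)

/-- The even generators can be matched injectively to odd generators of at least twice the degree
minus one. -/
theorem exists_matching [Finite β] (hd : IsMinimalDifferential d)
    (hX : ∀ i, MvPolynomial.X i ∈ (pureIdeal d).radical) :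
    ∃ m : {b // Even (deg b)} → {b // Odd (deg b)}, Function.Injective m ∧
      ∀ i, 2 * deg i.1 ≤ deg (m i).1 + 1 := by
  classical
  have := Fintype.ofFinite β
  obtain ⟨m, hm, h⟩ := (Finset.all_card_le_biUnion_card_iff_exists_injective
    fun i : {b // Even (deg b)} => Finset.univ.filter fun j : {b // Odd (deg b)} =>
      2 * deg i.1 ≤ deg j.1 + 1).1 fun S => by
    obtain ⟨T, hT⟩ : ∃ T, T = S.biUnion fun i : {b // Even (deg b)} =>
      Finset.univ.filter fun j : {b // Odd (deg b)} => 2 * deg i.1 ≤ deg j.1 + 1 := ⟨_, rfl⟩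
    rw [← hT]
    -- Hall's condition for `S`, whose set of candidates is `T`. For `j ∉ T` the pure part of `d
    -- y_j` lies in the ideal of the variables outside `S`, for reasons of degree. So the pure parts
    -- with `j ∈ T` and these variables generate an ideal containing the pure ideal, and Krull's
    -- theorem bounds the number of even generators by `T.card + Sᶜ.card`.
    let G : Finset (MvPolynomial {b // Even (deg b)} ℚ) :=
      T.image (fun j => evenPart deg (d (X deg j.1))) ∪ Sᶜ.image MvPolynomial.X
    have hsub : Ideal.span (MvPolynomial.X '' (S : Set {b // Even (deg b)})ᶜ) ≤
        Ideal.span (G : Set (MvPolynomial {b // Even (deg b)} ℚ)) := by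
      refine Ideal.span_mono ?_
      rintro _ ⟨i, hi, rfl⟩
      exact Finset.mem_coe.2 (Finset.mem_union_right _ (Finset.mem_image_of_mem _ (by simpa using hi)))
    have hle : pureIdeal d ≤ Ideal.span (G : Set (MvPolynomial {b // Even (deg b)} ℚ)) := by
      refine Ideal.span_le.2 ?_
      rintro _ ⟨j, rfl⟩
      by_cases hj : j ∈ T
      · exact Ideal.subset_span (Finset.mem_coe.2 (Finset.mem_union_left _
          (Finset.mem_image_of_mem (fun j : {b // Odd (deg b)} => evenPart deg (d (X deg j.1))) hj)))
      · refine hsub (evenPart_mem_span (S : Set {b // Even (deg b)}) (fun i hi => ?_)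
          (hd.map_X j.1))
        by_contra hcon
        refine hj ?_
        rw [hT]
        exact Finset.mem_biUnion.2 ⟨i, hi, Finset.mem_filter.2 ⟨Finset.mem_univ _, by omega⟩⟩
    have h0 : ∀ f ∈ G, MvPolynomial.constantCoeff f = 0 := by
      intro f hf
      rcases Finset.mem_union.1 hf with hf | hf
      · obtain ⟨j, -, rfl⟩ := Finset.mem_image.1 hf
        have := evenPart_mem_span (deg := deg) (k := deg j.1 + 1) ∅ (by simp) (hd.map_X j.1)
        have hle : Ideal.span (MvPolynomial.X '' (∅ : Set {b // Even (deg b)})ᶜ) ≤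
            RingHom.ker (MvPolynomial.constantCoeff (R := ℚ) (σ := {b // Even (deg b)})) := by
          refine Ideal.span_le.2 ?_
          rintro _ ⟨i, -, rfl⟩
          simp [RingHom.mem_ker]
        exact hle this
      · obtain ⟨i, -, rfl⟩ := Finset.mem_image.1 hf
        simp
    have hcard := MvPolynomial.card_le_of_X_mem_radical G h0 fun i =>
      Ideal.radical_mono hle (hX i)
    have h1 : G.card ≤ T.card + Sᶜ.card := (Finset.card_union_le _ _).trans
      (add_le_add Finset.card_image_le Finset.card_image_le)
    have h2 := Finset.card_add_card_compl S
    omega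
  exact ⟨m, hm, fun i => (Finset.mem_filter.1 (h i)).2⟩

end Pure

end SuperPoly

namespace SuperPoly

/-! ### Homogeneous components -/

section Components

variable {γ : Type*} {deg : γ → ℕ}

open Classical in
variable (deg) in
/-- The component of degree `k`. -/
noncomputable def comp (k : ℕ) : SuperPoly deg →ₗ[ℚ] SuperPoly deg :=
  diag deg fun e => if Finsupp.weight deg e = k then 1 else 0

theorem comp_of_mem {k : ℕ} {x : SuperPoly deg}
    (hx : x ∈ wspan deg fun e => Finsupp.weight deg e = k) : comp deg k x = x :=
  eq_of_mem_wspan (comp deg k) LinearMap.id (fun l hl => by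
    rw [comp, diag_word, if_pos hl, one_smul, LinearMap.id_apply]) hx

theorem comp_of_mem_ne {j k : ℕ} (hjk : j ≠ k) {x : SuperPoly deg}
    (hx : x ∈ wspan deg fun e => Finsupp.weight deg e = j) : comp deg k x = 0 :=
  eq_of_mem_wspan (comp deg k) 0 (fun l hl => by
    rw [comp, diag_word, if_neg (by omega), zero_smul, LinearMap.zero_apply]) hx

theorem comp_mem {k : ℕ} {P : (γ →₀ ℕ) → Prop} {x : SuperPoly deg} (hx : x ∈ wspan deg P) :
    comp deg k x ∈ wspan deg fun e => P e ∧ Finsupp.weight deg e = k :=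
  map_mem_of_mem_wspan _ (fun l hl => by
    rw [comp, diag_word]
    split_ifs with h
    · rw [one_smul]; exact word_mem ⟨hl, h⟩
    · rw [zero_smul]; exact zero_mem _) hx

theorem comp_mem' (k : ℕ) (x : SuperPoly deg) :
    comp deg k x ∈ wspan deg fun e => Finsupp.weight deg e = k :=
  wspan_mono (fun _ h => h.2) (comp_mem (P := fun _ => True) (by rw [wspan_true]; trivial))

theorem exists_sum_comp (x : SuperPoly deg) :
    ∃ M, ∀ M', M ≤ M' → ∑ k ∈ Finset.range M', comp deg k x = x := by
  induction x using word_induction with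
  | hw l =>
    refine ⟨Finsupp.weight deg (cnt l) + 1, fun M' hM => ?_⟩
    have hl : word deg l ∈ wspan deg fun e => Finsupp.weight deg e = Finsupp.weight deg (cnt l) :=
      word_mem rfl
    rw [Finset.sum_eq_single (Finsupp.weight deg (cnt l)), comp_of_mem hl]
    · exact fun j _ hj => comp_of_mem_ne hj.symm hl
    · intro h; rw [Finset.mem_range] at h; omega
  | hadd x y hx hy =>
    obtain ⟨M, hM⟩ := hx
    obtain ⟨M', hM'⟩ := hy
    refine ⟨max M M', fun K hK => ?_⟩
    simp only [map_add, Finset.sum_add_distrib]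
    rw [hM K (by omega), hM' K (by omega)]
  | hsmul r x hx =>
    obtain ⟨M, hM⟩ := hx
    refine ⟨M, fun K hK => ?_⟩
    simp only [map_smul, ← Finset.smul_sum]
    rw [hM K hK]

variable {d : SuperPoly deg →ₗ[ℚ] SuperPoly deg}

theorem IsMinimalDifferential.map_mem (hd : IsMinimalDifferential d) {k : ℕ} {x : SuperPoly deg}
    (hx : x ∈ wspan deg fun e => Finsupp.weight deg e = k) :
    d x ∈ wspan deg fun e => Finsupp.weight deg e = k + 1 :=
  hd.isDer.mem_wspan hd.map_X (fun b e f h1 h2 => by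
    rw [map_add, weight_single_one] at h1
    rw [map_add, h2.2]; omega) hx

theorem IsMinimalDifferential.comp_map (hd : IsMinimalDifferential d) (k : ℕ) (x : SuperPoly deg) :
    comp deg (k + 1) (d x) = d (comp deg k x) := by
  induction x using word_induction with
  | hw l =>
    have hl : word deg l ∈ wspan deg fun e => Finsupp.weight deg e = Finsupp.weight deg (cnt l) :=
      word_mem rfl
    by_cases h : Finsupp.weight deg (cnt l) = k
    · subst h
      rw [comp_of_mem hl, comp_of_mem (hd.map_mem hl)]
    · rw [comp_of_mem_ne h hl, comp_of_mem_ne (by omega) (hd.map_mem hl), map_zero]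
  | hadd x y hx hy => simp only [map_add, hx, hy]
  | hsmul r x hx => simp only [map_smul, hx]

/-- If the cohomology vanishes in all degrees above `n`, then inhomogeneous cocycles of
sufficiently high degree are coboundaries of elements of high degree. -/
theorem IsMinimalDifferential.exists_primitive_of_le (hd : IsMinimalDifferential d) {n : ℕ}
    (hH : ∀ k, n ≤ k → ∀ a ∈ wspan deg (fun e => Finsupp.weight deg e = k + 1), d a = 0 →
      ∃ b ∈ wspan deg (fun e => Finsupp.weight deg e = k), d b = a)
    (t : ℕ) (ht : n ≤ t) (a : SuperPoly deg)
    (ha : a ∈ wspan deg fun e => t + 1 ≤ Finsupp.weight deg e) (hda : d a = 0) :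
    ∃ b ∈ wspan deg (fun e => t ≤ Finsupp.weight deg e), d b = a := by
  obtain ⟨M, hM⟩ := exists_sum_comp a
  have h : ∀ k, ∃ b ∈ wspan deg (fun e => t ≤ Finsupp.weight deg e), d b = comp deg k a := by
    intro k
    by_cases hk : t + 1 ≤ k
    · obtain ⟨k, rfl⟩ : ∃ k', k = k' + 1 := ⟨k - 1, by omega⟩
      obtain ⟨b, hb, hdb⟩ := hH k (by omega) _ (comp_mem' (k + 1) a) (by
        rw [← hd.comp_map, hda, map_zero])
      exact ⟨b, wspan_mono (fun e he => by omega) hb, hdb⟩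
    · refine ⟨0, zero_mem _, ?_⟩
      have := wspan_mono (Q := fun _ => False) (fun e he => by omega) (comp_mem (k := k) ha)
      rw [wspan_false, Submodule.mem_bot] at this
      rw [map_zero, this]
  choose b hb hdb using h
  refine ⟨∑ k ∈ Finset.range M, b k, Submodule.sum_mem _ fun k _ => hb k, ?_⟩
  rw [map_sum]
  simp only [hdb]
  rw [hM M le_rfl]

end Components

/-! ### Bases adapted to deformations of powers of the even generators -/

section Adapted

variable {β : Type*} {deg : β → ℕ}

variable (deg) in
/-- The central subalgebra. -/
noncomputable abbrev Center : Subalgebra ℚ (SuperPoly deg) := Subalgebra.center ℚ (SuperPoly deg)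

theorem HasParity.mem_center {x : SuperPoly deg} (hx : HasParity 0 x) : x ∈ Center deg :=
  Subalgebra.mem_center_iff.2 fun y => (hx.commute y).symm

theorem hasParity_X_even (i : {b // Even (deg b)}) : HasParity 0 (X deg i.1) :=
  (hasParity_X i.1).congr (by rw [i.2.neg_one_pow, pow_zero])

variable (deg) in
/-- The even generators as central elements. -/
noncomputable def evenX (i : {b // Even (deg b)}) : Center deg :=
  ⟨X deg i.1, (hasParity_X_even i).mem_center⟩

variable (deg) in
/-- The inclusion of the polynomial algebra on the even generators. -/
noncomputable def ofEven : MvPolynomial {b // Even (deg b)} ℚ →ₐ[ℚ] SuperPoly deg :=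
  (Center deg).val.comp (MvPolynomial.aeval (evenX deg))

theorem ofEven_X (i : {b // Even (deg b)}) : ofEven deg (MvPolynomial.X i) = X deg i.1 := by
  simp [ofEven, evenX]

theorem evenPart_ofEven (p : MvPolynomial {b // Even (deg b)} ℚ) :
    evenPart deg (ofEven deg p) = p := by
  have : (evenPart deg).comp (ofEven deg) = AlgHom.id ℚ _ := by
    ext i : 1
    rw [AlgHom.comp_apply, ofEven_X, evenPart_X_even, AlgHom.id_apply]
  exact DFunLike.congr_fun this p

variable (deg) in
/-- The number of odd letters. -/
noncomputable abbrev oddLen : (β →₀ ℕ) →+ ℕ := Finsupp.weight fun b => deg b % 2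

theorem sub_ofEven_evenPart_mem (x : SuperPoly deg) :
    x - ofEven deg (evenPart deg x) ∈ wspan deg fun e => 1 ≤ oddLen deg e := by
  induction x using word_induction with
  | hw l =>
    induction l with
    | nil => simp
    | cons b l ih =>
      rw [word_cons, map_mul, map_mul]
      rcases Nat.even_or_odd (deg b) with h | h
      · rw [evenPart_X_even ⟨b, h⟩, ofEven_X, ← mul_sub]
        exact mul_mem_wspan (P := fun _ => True) (fun e f _ hf => by rw [map_add]; omega)
          (X_mem trivial) ih
      · rw [evenPart_X_odd h, map_zero, zero_mul, sub_zero]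
        exact mul_mem_wspan (Q := fun _ => True) (fun e f he _ => by rw [map_add]; omega)
          (X_mem (P := fun e => 1 ≤ oddLen deg e) (by
            rw [weight_single_one, Nat.odd_iff.1 h])) (word_mem trivial)
  | hadd x y hx hy => rw [map_add, map_add, add_sub_add_comm]; exact add_mem hx hy
  | hsmul r x hx => rw [map_smul, map_smul, ← smul_sub]; exact Submodule.smul_mem _ r hx

theorem evenPart_eq_zero_of_mem {x : SuperPoly deg}
    (hx : x ∈ wspan deg fun e => 1 ≤ oddLen deg e) : evenPart deg x = 0 :=
  eq_of_mem_wspan (evenPart deg).toLinearMap 0 (fun l hl => by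
    rw [AlgHom.toLinearMap_apply, LinearMap.zero_apply]
    induction l with
    | nil => simp at hl
    | cons b l ih =>
      rw [word_cons, map_mul]
      rcases Nat.even_or_odd (deg b) with h | h
      · rw [ih, mul_zero]
        rw [cnt_cons, map_add, weight_single_one, Nat.even_iff.1 h] at hl
        omega
      · rw [evenPart_X_odd h, zero_mul]) hx

theorem mem_oddLen_iff {x : SuperPoly deg} :
    (x ∈ wspan deg fun e => 1 ≤ oddLen deg e) ↔ evenPart deg x = 0 := by
  refine ⟨evenPart_eq_zero_of_mem, fun h => ?_⟩
  have := sub_ofEven_evenPart_mem x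
  rwa [h, map_zero, sub_zero] at this

/-- Each odd generator occurs at most once in an admissible monomial, so the filtration by the
number of odd letters is finite. This is what makes triangular changes of basis invertible. -/
theorem eq_zero_of_oddLen [Fintype β] {x : SuperPoly deg}
    (hx : x ∈ wspan deg fun e => Fintype.card β + 1 ≤ oddLen deg e) : x = 0 := by
  rw [mem_wspan_iff] at hx
  rw [← (monoBasis deg).repr.map_eq_zero_iff]
  ext e
  rw [Finsupp.zero_apply]
  by_contra h
  have h1 := hx e h
  have h2 : oddLen deg e.1 ≤ ∑ _b : β, 1 := by
    rw [oddLen, Finsupp.weight_apply, Finsupp.sum_fintype _ _ (by simp)]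
    refine Finset.sum_le_sum fun b _ => ?_
    rcases Nat.even_or_odd (deg b) with hb | hb
    · simp [Nat.even_iff.1 hb]
    · simpa [Nat.odd_iff.1 hb] using e.2 b hb
  simp at h2
  omega

variable [Fintype {b // Even (deg b)}]

/-- The monomial with exponents `e`, where the `N`-th power of the even generator `i` is replaced
by `z i`. -/
noncomputable def adapted (N : ℕ) (z : {b // Even (deg b)} → Center deg) (e : β →₀ ℕ) :
    SuperPoly deg :=
  ((∏ i, z i ^ (e i.1 / N) : Center deg) : SuperPoly deg) *
    mono deg (e.mapRange (· % N) (Nat.zero_mod N))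

theorem mul_adapted {N : ℕ} (hN : 0 < N) (z : {b // Even (deg b)} → Center deg)
    (i : {b // Even (deg b)}) (e : β →₀ ℕ) :
    (z i : SuperPoly deg) * adapted N z e = adapted N z (e + Finsupp.single i.1 N) := by
  classical
  have h1 : (e + Finsupp.single i.1 N).mapRange (· % N) (Nat.zero_mod N) =
      e.mapRange (· % N) (Nat.zero_mod N) := by
    ext b
    by_cases hb : i.1 = b
    · subst hb; simp
    · simp [hb]
  have h2 : (∏ k, z k ^ ((e + Finsupp.single i.1 N) k.1 / N) : Center deg) =
      z i * ∏ k, z k ^ (e k.1 / N) := by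
    have : ∀ k : {b // Even (deg b)}, z k ^ ((e + Finsupp.single i.1 N) k.1 / N) =
        (if k = i then z k else 1) * z k ^ (e k.1 / N) := fun k => by
      by_cases hk : k = i
      · subst hk
        rw [if_pos rfl, Finsupp.add_apply, Finsupp.single_eq_same, Nat.add_div_right _ hN,
          pow_succ']
      · have : i.1 ≠ k.1 := fun h => hk (Subtype.ext h.symm)
        simp [hk, this]
    simp only [this, Finset.prod_mul_distrib, Finset.prod_ite_eq', Finset.mem_univ, if_true]
  rw [adapted, adapted, h1, h2, MulMemClass.coe_mul, mul_assoc]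

/-- Division with remainder of the even exponents; the odd ones are at most `1` and unaffected by `%
N` precisely because `N ≥ 2`. -/
theorem sum_single_add_mapRange {N : ℕ} (hN : 2 ≤ N) {e : β →₀ ℕ} (he : Adm deg e) :
    ∑ i : {b // Even (deg b)}, Finsupp.single i.1 (N * (e i.1 / N)) +
      e.mapRange (· % N) (Nat.zero_mod N) = e := by
  classical
  ext b
  rw [Finsupp.add_apply, Finsupp.finsetSum_apply, Finsupp.mapRange_apply]
  rcases Nat.even_or_odd (deg b) with hb | hb
  · rw [Finset.sum_eq_single ⟨b, hb⟩, Finsupp.single_eq_same, Nat.div_add_mod]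
    · intro i _ hi
      exact Finsupp.single_eq_of_ne fun h => hi (Subtype.ext h.symm)
    · intro h; exact absurd (Finset.mem_univ _) h
  · rw [Finset.sum_eq_zero, zero_add, Nat.mod_eq_of_lt]
    · have := he b hb; omega
    · intro i _
      exact Finsupp.single_eq_of_ne fun h => (Nat.not_even_iff_odd.2 hb) (h ▸ i.2)

theorem exists_adapted_eq_smul {N : ℕ} (hN : 2 ≤ N) {e : β →₀ ℕ} (he : Adm deg e) :
    ∃ s : ℚ, s ≠ 0 ∧ adapted N (fun i => evenX deg i ^ N) e = s • mono deg e := by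
  classical
  have key : ∀ S : Finset {b // Even (deg b)}, ∃ l : List β,
      ((∏ i ∈ S, (evenX deg i ^ N) ^ (e i.1 / N) : Center deg) : SuperPoly deg) = word deg l ∧
      cnt l = ∑ i ∈ S, Finsupp.single i.1 (N * (e i.1 / N)) := by
    intro S
    induction S using Finset.induction_on with
    | empty => exact ⟨[], by simp⟩
    | insert i S hi ih =>
      obtain ⟨l, h1, h2⟩ := ih
      refine ⟨List.replicate (N * (e i.1 / N)) i.1 ++ l, ?_, ?_⟩
      · rw [Finset.prod_insert hi, MulMemClass.coe_mul, h1, word_append, word_replicate, ← pow_mul]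
        rfl
      · rw [Finset.sum_insert hi, cnt_append, cnt_replicate, h2]
  obtain ⟨l, h1, h2⟩ := key Finset.univ
  have h3 : cnt (l ++ listOf (e.mapRange (· % N) (Nat.zero_mod N))) = cnt (listOf e) := by
    rw [cnt_append, h2, cnt_listOf, cnt_listOf, sum_single_add_mapRange hN he]
  obtain ⟨s, hs, h⟩ := exists_word_of_cnt (deg := deg) h3
  refine ⟨s, hs, ?_⟩
  rw [adapted, h1, mono, ← word_append, h, mono]

theorem adapted_sub_mem {N : ℕ} (hN : 2 ≤ N) {z : {b // Even (deg b)} → Center deg}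
    (hz : ∀ i, evenPart deg (z i) = MvPolynomial.X i ^ N) {e : β →₀ ℕ} (he : Adm deg e) :
    adapted N z e - adapted N (fun i => evenX deg i ^ N) e ∈
      wspan deg fun f => oddLen deg e + 1 ≤ oddLen deg f := by
  rw [adapted, adapted, ← sub_mul]
  refine mul_mem_wspan (P := fun f => 1 ≤ oddLen deg f) (Q := fun f => oddLen deg e = oddLen deg f)
    (fun f g hf hg => by rw [map_add]; omega) ?_ ?_
  · rw [mem_oddLen_iff, map_sub, sub_eq_zero]
    have : ∀ z : {b // Even (deg b)} → Center deg,
        (∀ i, evenPart deg (z i) = MvPolynomial.X i ^ N) →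
        evenPart deg ((∏ i, z i ^ (e i.1 / N) : Center deg) : SuperPoly deg) =
          ∏ i, (MvPolynomial.X i ^ N) ^ (e i.1 / N) := fun z hz => by
      have := map_prod ((evenPart deg).comp (Center deg).val) (fun i => z i ^ (e i.1 / N))
        Finset.univ
      simp only [AlgHom.comp_apply, Subalgebra.coe_val, map_pow, hz] at this
      exact this
    rw [this z hz, this _ fun i => by
      rw [SubmonoidClass.coe_pow, map_pow]
      exact congrArg (· ^ N) (evenPart_X_even i)]
  · refine word_mem ?_
    rw [cnt_listOf, oddLen, Finsupp.weight_apply, Finsupp.weight_apply, Finsupp.sum_mapRange_index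
      (by simp)]
    refine Finsupp.sum_congr fun b _ => ?_
    rcases Nat.even_or_odd (deg b) with hb | hb
    · simp [Nat.even_iff.1 hb]
    · have := he b hb
      rw [Nat.mod_eq_of_lt (a := e b) (by omega)]

/-- Since `z i` and the `N`-th power of the generator have the same pure part, replacing one by the
other changes a monomial only by terms with more odd letters. After rescaling, the change of basis
`Θ` is therefore unipotent. -/
theorem exists_adapted_basis [Finite β] {N : ℕ} (hN : 2 ≤ N)
    {z : {b // Even (deg b)} → Center deg}
    (hz : ∀ i, evenPart deg (z i) = MvPolynomial.X i ^ N) :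
    ∃ B : Module.Basis {e : β →₀ ℕ // Adm deg e} ℚ (SuperPoly deg),
      ∀ e, B e = adapted N z e.1 := by
  have := Fintype.ofFinite β
  choose s hs0 hs using fun e : {e : β →₀ ℕ // Adm deg e} => exists_adapted_eq_smul hN e.2
  let Θ : Module.End ℚ (SuperPoly deg) :=
    (monoBasis deg).constr ℚ fun e => (s e)⁻¹ • adapted N z e.1
  have hΘ : ∀ e, Θ (mono deg e.1) = (s e)⁻¹ • adapted N z e.1 := fun e => by
    rw [← monoBasis_apply]; exact (monoBasis deg).constr_basis ℚ _ e
  have hstep : ∀ k x, (x ∈ wspan deg fun f => k ≤ oddLen deg f) →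
      (Θ - 1) x ∈ wspan deg fun f => k + 1 ≤ oddLen deg f := by
    intro k x hx
    refine map_mem_of_mem_wspan _ (fun l hl => ?_) hx
    by_cases h : Adm deg (cnt l)
    · obtain ⟨t, -, ht⟩ := exists_word_eq_mono (deg := deg) l
      rw [ht, map_smul]
      refine Submodule.smul_mem _ _ ?_
      have h1 : (Θ - 1) (mono deg (cnt l)) = (s ⟨_, h⟩)⁻¹ •
          (adapted N z (cnt l) - adapted N (fun i => evenX deg i ^ N) (cnt l)) := by
        have h2 := hΘ ⟨_, h⟩
        rw [smul_sub, hs ⟨_, h⟩, smul_smul, inv_mul_cancel₀ (hs0 _), one_smul, LinearMap.sub_apply,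
          h2, Module.End.one_apply]
      rw [h1]
      exact Submodule.smul_mem _ _ (wspan_mono (fun f hf => by omega) (adapted_sub_mem hN hz h))
    · rw [word_eq_zero_of_not_adm h, map_zero]; exact zero_mem _
  have hpow : ∀ k x, ((Θ - 1) ^ k) x ∈ wspan deg fun f => k ≤ oddLen deg f := by
    intro k
    induction k with
    | zero => intro x; simp [wspan_true]
    | succ k ih => intro x; rw [pow_succ']; exact hstep k _ (ih x)
  have hnil : IsNilpotent (Θ - 1) :=
    ⟨Fintype.card β + 1, LinearMap.ext fun x => eq_zero_of_oddLen (hpow _ x)⟩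
  have hunit : IsUnit Θ := by
    have := hnil.isUnit_one_add
    rwa [add_sub_cancel] at this
  refine ⟨((monoBasis deg).map (LinearEquiv.ofBijective Θ
    ((Module.End.isUnit_iff Θ).1 hunit))).isUnitSMul (w := s) fun e => (hs0 e).isUnit, fun e => ?_⟩
  rw [Module.Basis.isUnitSMul_apply, Module.Basis.map_apply, LinearEquiv.ofBijective_apply,
    monoBasis_apply, hΘ, smul_smul, mul_inv_cancel₀ (hs0 e), one_smul]

end Adapted

end SuperPoly

namespace SuperPoly

/-! ### A regular sequence of cocycles and the formal dimension inequality. -/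

section TopDegree

variable {β : Type*} {deg : β → ℕ} {d : SuperPoly deg →ₗ[ℚ] SuperPoly deg}

theorem pow_mem_wspan {k : ℕ} {x : SuperPoly deg}
    (hx : x ∈ wspan deg fun e => Finsupp.weight deg e = k) (q : ℕ) :
    x ^ q ∈ wspan deg fun e => Finsupp.weight deg e = q * k := by
  induction q with
  | zero => simpa using one_mem_wspan (deg := deg) (P := fun e => Finsupp.weight deg e = 0) (by simp)
  | succ q ih =>
    rw [pow_succ]
    exact mul_mem_wspan (fun e f he hf => by rw [map_add, he, hf]; ring) ih hx

theorem adapted_mem [Fintype {b // Even (deg b)}] {N : ℕ} (hN : 2 ≤ N)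
    {z : {b // Even (deg b)} → Center deg}
    (hz : ∀ i, (z i : SuperPoly deg) ∈ wspan deg fun e => Finsupp.weight deg e = N * deg i.1)
    {e : β →₀ ℕ} (he : Adm deg e) :
    adapted N z e ∈ wspan deg fun f => Finsupp.weight deg f = Finsupp.weight deg e := by
  classical
  have key : ∀ S : Finset {b // Even (deg b)},
      ((∏ i ∈ S, z i ^ (e i.1 / N) : Center deg) : SuperPoly deg) ∈
        wspan deg fun f => Finsupp.weight deg f =
          Finsupp.weight deg (∑ i ∈ S, Finsupp.single i.1 (N * (e i.1 / N))) := by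
    intro S
    induction S using Finset.induction_on with
    | empty => simpa using one_mem_wspan (deg := deg) (P := fun e => Finsupp.weight deg e = 0) (by simp)
    | insert i S hi ih =>
      rw [Finset.prod_insert hi, MulMemClass.coe_mul, SubmonoidClass.coe_pow]
      refine mul_mem_wspan (fun f g hf hg => ?_) (pow_mem_wspan (hz i) (e i.1 / N)) ih
      rw [Finset.sum_insert hi, map_add, map_add, hf, hg, Finsupp.weight_single, smul_eq_mul]
      ring
  refine mul_mem_wspan (fun f g hf hg => ?_) (key Finset.univ)
    (word_mem (P := fun g => g = e.mapRange (· % N) (Nat.zero_mod N)) (cnt_listOf _))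
  rw [map_add, hf, hg, ← map_add, sum_single_add_mapRange hN he]

/-- For an even polynomial `r`, the element `d r` is odd and has no pure part, so `d (r Φ)` has pure
part `r` times that of `d Φ`. Hence the pure parts of boundaries form an ideal. -/
theorem exists_evenPart_map_eq (hd : IsMinimalDifferential d)
    {p : MvPolynomial {b // Even (deg b)} ℚ} (hp : p ∈ pureIdeal d) :
    ∃ Φ, evenPart deg (d Φ) = p := by
  induction hp using Submodule.span_induction with
  | mem p hp => obtain ⟨j, rfl⟩ := hp; exact ⟨_, rfl⟩
  | zero => exact ⟨0, by simp⟩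
  | add p q _ _ hp hq =>
    obtain ⟨Φ, rfl⟩ := hp
    obtain ⟨Ψ, rfl⟩ := hq
    exact ⟨Φ + Ψ, by simp⟩
  | smul r p _ hp =>
    obtain ⟨Φ, rfl⟩ := hp
    refine ⟨ofEven deg r * Φ, ?_⟩
    have h1 : sgnPow 1 (ofEven deg r) = ofEven deg r := by
      have : (sgnPow 1).comp (ofEven deg) = ofEven deg := by
        ext i : 1
        rw [AlgHom.comp_apply, ofEven_X, sgnPow_X, one_mul, i.2.neg_one_pow, one_smul]
      exact DFunLike.congr_fun this r
    have h2 : HasParity 0 (ofEven deg r) := by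
      rw [sgnPow_one] at h1
      rw [HasParity, h1, pow_zero, one_smul]
    rw [hd.isDer.leibniz, h1, map_add, map_mul, map_mul, evenPart_ofEven,
      evenPart_eq_zero_of_odd (by decide) (hd.isDer.parity _ _ h2), zero_mul, zero_add, smul_eq_mul]

/-- The element `d Φ` with the prescribed pure part may be inhomogeneous; its component of degree `N
* deg i` has the same pure part and is still a cocycle. -/
theorem exists_cocycle (hd : IsMinimalDifferential d) {N : ℕ} {i : {b // Even (deg b)}}
    (h : MvPolynomial.X i ^ N ∈ pureIdeal d) :
    ∃ c ∈ wspan deg fun e => Finsupp.weight deg e = N * deg i.1,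
      evenPart deg c = MvPolynomial.X i ^ N ∧ d c = 0 := by
  obtain ⟨Φ, hΦ⟩ := exists_evenPart_map_eq hd h
  refine ⟨comp deg (N * deg i.1) (d Φ), comp_mem' _ _, ?_, ?_⟩
  · have h1 := sub_ofEven_evenPart_mem (d Φ)
    rw [hΦ, map_pow, ofEven_X] at h1
    have h2 := evenPart_eq_zero_of_mem (wspan_mono (fun _ h => h.1)
      (comp_mem (k := N * deg i.1) h1))
    rw [map_sub, comp_of_mem (x := X deg i.1 ^ N) (pow_mem_wspan (X_mem (weight_single_one _ _)) N),
      map_sub, map_pow, evenPart_X_even, sub_eq_zero] at h2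
    exact h2
  · have h1 := hd.comp_map (N * deg i.1) (d Φ)
    rw [hd.sq_zero, map_zero] at h1
    exact h1.symm

/-- Increase the exponent of an even generator. -/
noncomputable def shift (N : ℕ) (i : {b // Even (deg b)}) (e : {e : β →₀ ℕ // Adm deg e}) :
    {e : β →₀ ℕ // Adm deg e} :=
  ⟨e.1 + Finsupp.single i.1 N, fun b hb => by
    have : i.1 ≠ b := fun h => Nat.not_even_iff_odd.2 hb (h ▸ i.2)
    rw [Finsupp.add_apply, Finsupp.single_eq_of_ne this.symm, add_zero]
    exact e.2 b hb⟩

theorem shift_injective (N : ℕ) (i : {b // Even (deg b)}) : Function.Injective (shift N i) :=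
  fun _ _ h => Subtype.ext (add_right_cancel (Subtype.ext_iff.1 h))

theorem exists_shift {N : ℕ} {i : {b // Even (deg b)}} {e : {e : β →₀ ℕ // Adm deg e}}
    (h : N ≤ e.1 i.1) : ∃ f, e = shift N i f := by
  have h1 : e.1 - Finsupp.single i.1 N + Finsupp.single i.1 N = e.1 :=
    tsub_add_cancel_of_le (Finsupp.single_le_iff.2 h)
  refine ⟨⟨e.1 - Finsupp.single i.1 N, fun b hb => ?_⟩, Subtype.ext h1.symm⟩
  rw [Finsupp.tsub_apply]
  exact (Nat.sub_le _ _).trans (e.2 b hb)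

/-- A homogeneous basis on which central cocycles `z i` act by shifting exponents. -/
structure IsAdaptedBasis (d : SuperPoly deg →ₗ[ℚ] SuperPoly deg) (N : ℕ)
    (z : {b // Even (deg b)} → Center deg)
    (B : Module.Basis {e : β →₀ ℕ // Adm deg e} ℚ (SuperPoly deg)) : Prop where
  map_mul : ∀ i x, d ((z i : SuperPoly deg) * x) = z i * d x
  mul_basis : ∀ i e, (z i : SuperPoly deg) * B e = B (shift N i e)
  z_mem : ∀ i, (z i : SuperPoly deg) ∈ wspan deg fun e => Finsupp.weight deg e = N * deg i.1
  mem : ∀ e, B e ∈ wspan deg fun f => Finsupp.weight deg f = Finsupp.weight deg e.1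

theorem exists_isAdaptedBasis [Finite β] (hd : IsMinimalDifferential d) {N : ℕ} (hN : 2 ≤ N)
    (h : ∀ i, MvPolynomial.X i ^ N ∈ pureIdeal d) : ∃ z B, IsAdaptedBasis d N z B := by
  have := Fintype.ofFinite β
  classical
  choose c hc1 hc2 hc3 using fun i => exists_cocycle hd (h i)
  have hpar : ∀ i, HasParity 0 (c i) := fun i =>
    hasParity_of_mem (fun e he => by rw [he, (i.2.mul_left _).neg_one_pow, pow_zero]) (hc1 i)
  let z : {b // Even (deg b)} → Center deg := fun i => ⟨c i, (hpar i).mem_center⟩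
  obtain ⟨B, hB⟩ := exists_adapted_basis hN (z := z) hc2
  refine ⟨z, B, fun i x => ?_, fun i e => ?_, hc1, fun e => ?_⟩
  · rw [hd.isDer.leibniz, hc3, zero_mul, zero_add, (hpar i).sgnPow]
    simp [z]
  · rw [hB, hB, mul_adapted (by omega)]
    rfl
  · rw [hB]; exact adapted_mem hN hc1 e.2

namespace IsAdaptedBasis

variable {N : ℕ} {z : {b // Even (deg b)} → Center deg}
    {B : Module.Basis {e : β →₀ ℕ // Adm deg e} ℚ (SuperPoly deg)}

/-- The span of the basis elements in which some exponent from `T` is at least `N`; this is the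
ideal generated by the `z i` with `i ∈ T`. -/
noncomputable def ideal (B : Module.Basis {e : β →₀ ℕ // Adm deg e} ℚ (SuperPoly deg)) (N : ℕ)
    (T : Finset {b // Even (deg b)}) : Submodule ℚ (SuperPoly deg) :=
  Submodule.span ℚ (B '' {e | ∃ i ∈ T, N ≤ e.1 i.1})

theorem ideal_empty : ideal B N ∅ = ⊥ := by
  simp [ideal]

theorem ideal_mono {S T : Finset {b // Even (deg b)}} (h : S ⊆ T) : ideal B N S ≤ ideal B N T :=
  Submodule.span_mono (Set.image_mono fun _ ⟨i, hi, h'⟩ => ⟨i, h hi, h'⟩)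

theorem z_mul_mem_ideal (hB : IsAdaptedBasis d N z B) {T : Finset {b // Even (deg b)}}
    {i : {b // Even (deg b)}} (hi : i ∈ T) (x : SuperPoly deg) :
    (z i : SuperPoly deg) * x ∈ ideal B N T := by
  have hx := B.mem_span x
  induction hx using Submodule.span_induction with
  | mem x hx =>
    obtain ⟨e, rfl⟩ := hx
    rw [hB.mul_basis]
    exact Submodule.subset_span ⟨_, ⟨i, hi, by simp [shift]⟩, rfl⟩
  | zero => simp
  | add x y _ _ hx hy => rw [mul_add]; exact add_mem hx hy
  | smul r x _ hx => rw [mul_smul_comm]; exact Submodule.smul_mem _ r hx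

theorem mul_mem_ideal (hB : IsAdaptedBasis d N z B) {T : Finset {b // Even (deg b)}}
    (i : {b // Even (deg b)}) {x : SuperPoly deg} (hx : x ∈ ideal B N T) :
    (z i : SuperPoly deg) * x ∈ ideal B N T := by
  induction hx using Submodule.span_induction with
  | mem x hx =>
    obtain ⟨e, ⟨j, hj, h⟩, rfl⟩ := hx
    rw [hB.mul_basis]
    exact Submodule.subset_span ⟨_, ⟨j, hj, h.trans (by simp [shift])⟩, rfl⟩
  | zero => simp
  | add x y _ _ hx hy => rw [mul_add]; exact add_mem hx hy
  | smul r x _ hx => rw [mul_smul_comm]; exact Submodule.smul_mem _ r hx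

theorem map_mem_ideal (hB : IsAdaptedBasis d N z B) {T : Finset {b // Even (deg b)}}
    {x : SuperPoly deg} (hx : x ∈ ideal B N T) : d x ∈ ideal B N T := by
  induction hx using Submodule.span_induction with
  | mem x hx =>
    obtain ⟨e, ⟨j, hj, h⟩, rfl⟩ := hx
    obtain ⟨f, rfl⟩ := exists_shift h
    rw [← hB.mul_basis, hB.map_mul]
    exact hB.z_mul_mem_ideal hj _
  | zero => simp
  | add x y _ _ hx hy => rw [map_add]; exact add_mem hx hy
  | smul r x _ hx => rw [map_smul]; exact Submodule.smul_mem _ r hx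

/-- Multiplication by `z i` shifts the exponent of `i` injectively and leaves those indexed by `T`
alone: the `z i` form a regular sequence. -/
theorem mem_ideal_of_mul_mem (hB : IsAdaptedBasis d N z B) {T : Finset {b // Even (deg b)}}
    {i : {b // Even (deg b)}} (hi : i ∉ T) {x : SuperPoly deg}
    (hx : (z i : SuperPoly deg) * x ∈ ideal B N T) : x ∈ ideal B N T := by
  have h1 : B.repr ((z i : SuperPoly deg) * x) = (B.repr x).mapDomain (shift N i) := by
    have : B.repr.toLinearMap ∘ₗ LinearMap.mulLeft ℚ (z i : SuperPoly deg) =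
        Finsupp.lmapDomain ℚ ℚ (shift N i) ∘ₗ B.repr.toLinearMap := B.ext fun e => by
      simp [hB.mul_basis]
    exact LinearMap.congr_fun this x
  rw [ideal, Module.Basis.mem_span_image] at hx ⊢
  intro e he
  have h2 : shift N i e ∈ (B.repr ((z i : SuperPoly deg) * x)).support := by
    rw [h1, Finsupp.mem_support_iff, Finsupp.mapDomain_apply (shift_injective N i)]
    exact Finsupp.mem_support_iff.1 he
  obtain ⟨j, hj, h3⟩ := hx h2
  have hij : i.1 ≠ j.1 := fun h => hi (Subtype.ext h ▸ hj)
  refine ⟨j, hj, ?_⟩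
  simpa [shift, hij] using h3

theorem mem_span_of_mem (hB : IsAdaptedBasis d N z B) {S : Set {e : β →₀ ℕ // Adm deg e}} {k : ℕ}
    {x : SuperPoly deg} (hx : x ∈ Submodule.span ℚ (B '' S))
    (hk : x ∈ wspan deg fun e => Finsupp.weight deg e = k) :
    x ∈ Submodule.span ℚ (B '' {e | e ∈ S ∧ Finsupp.weight deg e.1 = k}) := by
  have : Submodule.span ℚ (B '' S) ≤
      (Submodule.span ℚ (B '' {e | e ∈ S ∧ Finsupp.weight deg e.1 = k})).comap (comp deg k) := by
    refine Submodule.span_le.2 ?_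
    rintro _ ⟨e, he, rfl⟩
    rw [SetLike.mem_coe, Submodule.mem_comap]
    by_cases h : Finsupp.weight deg e.1 = k
    · rw [comp_of_mem (h ▸ hB.mem e)]
      exact Submodule.subset_span ⟨e, ⟨he, h⟩, rfl⟩
    · rw [comp_of_mem_ne h (hB.mem e)]; exact zero_mem _
  have h := this hx
  rwa [Submodule.mem_comap, comp_of_mem hk] at h

theorem exists_eq_add_mul (hB : IsAdaptedBasis d N z B) [DecidableEq {b // Even (deg b)}]
    {T : Finset {b // Even (deg b)}} {i : {b // Even (deg b)}} {k : ℕ} {x : SuperPoly deg}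
    (hx : x ∈ ideal B N (insert i T))
    (hk : x ∈ wspan deg fun e => Finsupp.weight deg e = k + N * deg i.1) :
    ∃ y ∈ ideal B N T, ∃ b ∈ wspan deg fun e => Finsupp.weight deg e = k, x = y + z i * b := by
  have h := hB.mem_span_of_mem hx hk
  clear hx hk
  induction h using Submodule.span_induction with
  | mem x hx =>
    obtain ⟨e, ⟨⟨j, hj, h⟩, hw⟩, rfl⟩ := hx
    rcases Finset.mem_insert.1 hj with rfl | hj
    · obtain ⟨f, rfl⟩ := exists_shift h
      refine ⟨0, zero_mem _, B f, ?_, by rw [zero_add, hB.mul_basis]⟩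
      have hf := hB.mem f
      rw [shift, map_add, Finsupp.weight_single, smul_eq_mul, add_left_inj] at hw
      rwa [hw] at hf
    · exact ⟨B e, Submodule.subset_span ⟨e, ⟨j, hj, h⟩, rfl⟩, 0, zero_mem _, by simp⟩
  | zero => exact ⟨0, zero_mem _, 0, zero_mem _, by simp⟩
  | add x x' _ _ hx hx' =>
    obtain ⟨y, hy, b, hb, rfl⟩ := hx
    obtain ⟨y', hy', b', hb', rfl⟩ := hx'
    exact ⟨y + y', add_mem hy hy', b + b', add_mem hb hb', by rw [mul_add]; abel⟩
  | smul r x _ hx =>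
    obtain ⟨y, hy, b, hb, rfl⟩ := hx
    exact ⟨r • y, Submodule.smul_mem _ r hy, r • b, Submodule.smul_mem _ r hb, by
      rw [mul_smul_comm, smul_add]⟩

/-- Vanishing of the cohomology of the quotient by a regular sequence in high degrees. -/
theorem exists_sub_mem (hB : IsAdaptedBasis d N z B) (hd : IsMinimalDifferential d)
    (hN : 1 ≤ N) {n : ℕ}
    (hH : ∀ k, n ≤ k → ∀ a ∈ wspan deg (fun e => Finsupp.weight deg e = k + 1), d a = 0 →
      ∃ b ∈ wspan deg (fun e => Finsupp.weight deg e = k), d b = a)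
    (T : Finset {b // Even (deg b)}) :
    ∀ k, n + ∑ i ∈ T, (N * deg i.1 - 1) ≤ k →
      ∀ a ∈ wspan deg (fun e => Finsupp.weight deg e = k + 1), d a ∈ ideal B N T →
      ∃ b ∈ wspan deg (fun e => Finsupp.weight deg e = k), a - d b ∈ ideal B N T := by
  classical
  induction T using Finset.induction_on with
  | empty =>
    intro k hk a ha hda
    rw [ideal_empty, Submodule.mem_bot] at hda
    obtain ⟨b, hb, rfl⟩ := hH k (by simpa using hk) a ha hda
    exact ⟨b, hb, by simp⟩
  | insert i T hi ih =>
    intro k hk a ha hda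
    rw [Finset.sum_insert hi] at hk
    have h2 := hd.two_le i.1
    have h3 : 1 * 2 ≤ N * deg i.1 := Nat.mul_le_mul hN h2
    -- This is the connecting map of `0 → A/T → A/T → A/(T, z i) → 0`, where the first map is
    -- multiplication by `z i`. Writing `d a = y + z i * b` gives a cocycle `b` modulo `T` of degree
    -- `k + 2 - N * deg i`; the shift accounts for the summand `N * deg i - 1` of the bound.
    obtain ⟨k', hk'⟩ : ∃ k', k' + 1 + N * deg i.1 = k + 1 + 1 := ⟨k + 1 - N * deg i.1, by omega⟩
    obtain ⟨y, hy, b, hb, hyb⟩ := hB.exists_eq_add_mul (k := k' + 1) hda (by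
      rw [hk']; exact hd.map_mem ha)
    have hdb : d b ∈ ideal B N T := by
      refine hB.mem_ideal_of_mul_mem hi ?_
      have h4 := congrArg d hyb
      rw [hd.sq_zero, map_add, hB.map_mul] at h4
      rw [← neg_eq_of_add_eq_zero_right h4.symm]
      exact neg_mem (hB.map_mem_ideal hy)
    -- As `b` is the boundary of `g` modulo `T`, the element `a - z i * g` is a cocycle modulo `T`,
    -- to which the induction hypothesis applies again.
    obtain ⟨g, hg, hbg⟩ := ih k' (by omega) b hb hdb
    have hzg : (z i : SuperPoly deg) * g ∈ wspan deg fun e => Finsupp.weight deg e = k + 1 :=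
      mul_mem_wspan (fun e f he hf => by rw [map_add, he, hf]; omega) (hB.z_mem i) hg
    obtain ⟨f, hf, haf⟩ := ih k (by omega) (a - z i * g) (sub_mem ha hzg) (by
      rw [map_sub, hyb, hB.map_mul, add_sub_assoc, ← mul_sub]
      exact add_mem hy (hB.mul_mem_ideal i hbg))
    refine ⟨f, hf, ?_⟩
    have h5 : a - d f = (a - z i * g - d f) + z i * g := by abel
    rw [h5]
    exact add_mem (ideal_mono (Finset.subset_insert i T) haf)
      (hB.z_mul_mem_ideal (Finset.mem_insert_self i T) g)

end IsAdaptedBasis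

/-- In the quotient by all `z i` the monomial `ω`, with exponents `N - 1` on even and `1` on odd
generators, is the top class and represents nonzero cohomology. By `exists_sub_mem` its degree is at
most `n + ∑ (N * deg i - 1)`, and the terms containing `N` cancel. -/
theorem sum_odd_deg_le [Fintype β] [Fintype {b // Even (deg b)}] [Fintype {b // Odd (deg b)}]
    (hd : IsMinimalDifferential d) {n : ℕ}
    (hH : ∀ k, n ≤ k → ∀ a ∈ wspan deg (fun e => Finsupp.weight deg e = k + 1), d a = 0 →
      ∃ b ∈ wspan deg (fun e => Finsupp.weight deg e = k), d b = a)
    (hX : ∀ i, MvPolynomial.X i ∈ (pureIdeal d).radical) :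
    ∑ j : {b // Odd (deg b)}, deg j.1 + Fintype.card {b // Even (deg b)} ≤
      n + ∑ i : {b // Even (deg b)}, deg i.1 := by
  classical
  choose M hM using hX
  obtain ⟨N, hN2, hN⟩ : ∃ N, 2 ≤ N ∧ ∀ i, MvPolynomial.X i ^ N ∈ pureIdeal d :=
    ⟨2 + ∑ i, M i, by omega, fun i => by
      have h1 : M i ≤ ∑ i, M i :=
        Finset.single_le_sum (fun _ _ => Nat.zero_le _) (Finset.mem_univ i)
      exact Ideal.pow_mem_of_pow_mem _ (hM i) (h1.trans (Nat.le_add_left _ _))⟩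
  obtain ⟨z, B, hB⟩ := exists_isAdaptedBasis hd hN2 hN
  have hwt : ∀ e : β →₀ ℕ, Finsupp.weight deg e = ∑ b, e b * deg b := fun e => by
    rw [Finsupp.weight_apply, Finsupp.sum_fintype _ _ (by simp)]; rfl
  obtain ⟨ω, hω⟩ : ∃ ω : β →₀ ℕ, ∀ b, ω b = if Even (deg b) then N - 1 else 1 :=
    ⟨Finsupp.equivFunOnFinite.symm fun b => if Even (deg b) then N - 1 else 1, fun b => rfl⟩
  have hωA : Adm deg ω := fun b hb => by rw [hω, if_neg (Nat.not_even_iff_odd.2 hb)]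
  have hωw : Finsupp.weight deg ω =
      ∑ i : {b // Even (deg b)}, (N - 1) * deg i.1 + ∑ j : {b // Odd (deg b)}, deg j.1 := by
    rw [hwt, ← Finset.sum_filter_add_sum_filter_not Finset.univ fun b => Even (deg b)]
    congr 1
    · rw [Finset.sum_subtype (p := fun b => Even (deg b)) _ (by simp)]
      exact Finset.sum_congr rfl fun i _ => by rw [hω, if_pos i.2]
    · rw [Finset.sum_subtype (p := fun b => Odd (deg b)) _ (by simp)]
      exact Finset.sum_congr rfl fun i _ => by
        rw [hω, if_neg (Nat.not_even_iff_odd.2 i.2), one_mul]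
  have hle : ∀ e : β →₀ ℕ, Adm deg e → (¬ ∃ i ∈ (Finset.univ : Finset {b // Even (deg b)}),
      N ≤ e i.1) → e ≤ ω := by
    intro e he h b
    push Not at h
    rw [hω]
    split_ifs with hb
    · have h1 : e b < N := h ⟨b, hb⟩ (Finset.mem_univ _)
      omega
    · exact he b (Nat.not_even_iff_odd.1 hb)
  -- Exponent vectors outside the ideal lie below `ω`, and a strictly smaller one has degree at most
  -- `|ω| - 2`, as generators have degree at least two. So the quotient is zero in degree `|ω| - 1`
  -- and above `|ω|`.
  have htop : ∀ k, k ≠ Finsupp.weight deg ω → k + 1 ≥ Finsupp.weight deg ω → ∀ x ∈ wspan deg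
      (fun e => Finsupp.weight deg e = k), x ∈ IsAdaptedBasis.ideal B N Finset.univ := by
    intro k hk1 hk2 x hx
    have h1 : x ∈ Submodule.span ℚ (B '' Set.univ) := by
      rw [Set.image_univ]; exact B.mem_span x
    refine Submodule.span_mono (Set.image_mono ?_) (hB.mem_span_of_mem h1 hx)
    rintro e ⟨-, hek⟩
    by_contra hcon
    obtain ⟨f, hf⟩ := exists_add_of_le (hle e.1 e.2 hcon)
    have h2 := congrArg (Finsupp.weight deg) hf
    rw [map_add] at h2
    have h3 : ¬ ∃ b, f b ≠ 0 := by
      rintro ⟨b, hb⟩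
      obtain ⟨f', rfl⟩ := exists_single_add hb
      rw [map_add, weight_single_one] at h2
      have := hd.two_le b
      omega
    push Not at h3
    obtain rfl : f = 0 := Finsupp.ext h3
    rw [map_zero] at h2
    omega
  by_contra hcon
  have hsum : ∑ i : {b // Even (deg b)}, (N * deg i.1 - 1) + Fintype.card {b // Even (deg b)} =
      ∑ i : {b // Even (deg b)}, (N - 1) * deg i.1 + ∑ i : {b // Even (deg b)}, deg i.1 := by
    rw [Fintype.card, Finset.card_eq_sum_ones, ← Finset.sum_add_distrib, ← Finset.sum_add_distrib]
    refine Finset.sum_congr rfl fun i _ => ?_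
    have h2 := hd.two_le i.1
    have h3 : 1 * 2 ≤ N * deg i.1 := Nat.mul_le_mul (by omega) h2
    obtain ⟨N', rfl⟩ : ∃ N', N = N' + 1 := ⟨N - 1, by omega⟩
    rw [Nat.sub_add_cancel (by omega), Nat.add_sub_cancel]
    ring
  obtain ⟨k, hk⟩ : ∃ k, Finsupp.weight deg ω = k + 1 :=
    ⟨Finsupp.weight deg ω - 1, by omega⟩
  have hBω := hB.mem ⟨ω, hωA⟩
  -- `B ω` is a cocycle modulo the ideal. Were it a boundary there, its primitive, of degree `|ω| -
  -- 1`, would lie in the ideal, and so would `B ω`.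
  obtain ⟨f, hf, h⟩ := hB.exists_sub_mem hd (by omega) hH Finset.univ k (by omega) (B ⟨ω, hωA⟩)
    (by rw [← hk]; exact hBω) (htop (k + 2) (by omega) (by omega) _ (by
      have := hd.map_mem hBω; rwa [hk] at this))
  have h1 : B ⟨ω, hωA⟩ ∈ IsAdaptedBasis.ideal B N Finset.univ := by
    have := add_mem h (hB.map_mem_ideal (htop k (by omega) (by omega) f hf))
    rwa [sub_add_cancel] at this
  rw [IsAdaptedBasis.ideal, Module.Basis.mem_span_image, B.repr_self] at h1
  obtain ⟨i, -, hi⟩ := h1 (show (⟨ω, hωA⟩ : {e // Adm deg e}) ∈ _ by simp)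
  rw [hω, if_pos i.2] at hi
  omega

/-- A minimal algebra whose cohomology vanishes above degree `n` has no even generator of degree
greater than `n`, and at most one odd one. -/
theorem generators_of_large_degree [Finite β] (hd : IsMinimalDifferential d) {n : ℕ}
    (hH : ∀ k, n ≤ k → ∀ a ∈ wspan deg (fun e => Finsupp.weight deg e = k + 1), d a = 0 →
      ∃ b ∈ wspan deg (fun e => Finsupp.weight deg e = k), d b = a) :
    (∀ b, Even (deg b) → deg b ≤ n) ∧
      ∀ b c, Odd (deg b) → Odd (deg c) → n < deg b → n < deg c → b = c := by
  classical
  have := Fintype.ofFinite β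
  have hX := X_mem_radical_pureIdeal hd (hd.exists_primitive_of_le hH)
  obtain ⟨m, hm, hmd⟩ := exists_matching hd hX
  have hle := sum_odd_deg_le hd hH hX
  -- The share of an odd generator is `deg i - 1` if it is matched to `i`, and `0` if it is
  -- unmatched. Removing all shares from the odd degrees turns `sum_odd_deg_le` into `∑ u ≤ n`.
  let v : {b // Odd (deg b)} → ℕ := fun j =>
    ∑ i : {b // Even (deg b)}, if m i = j then deg i.1 - 1 else 0
  have hv : ∀ i, v (m i) = deg i.1 - 1 := fun i => by
    simp only [v, hm.eq_iff, Finset.sum_ite_eq', Finset.mem_univ, if_true]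
  have hv' : ∀ j, 2 * v j + 1 ≤ deg j.1 := fun j => by
    by_cases h : ∃ i, m i = j
    · obtain ⟨i, rfl⟩ := h
      have h1 := hmd i
      have h2 := hd.two_le i.1
      rw [hv]; omega
    · push Not at h
      have h1 := hd.two_le j.1
      have h2 : v j = 0 := Finset.sum_eq_zero fun i _ => if_neg (h i)
      omega
  obtain ⟨u, hu⟩ : ∃ u : {b // Odd (deg b)} → ℕ, ∀ j, deg j.1 = u j + v j :=
    ⟨fun j => deg j.1 - v j, fun j => by have := hv' j; exact (Nat.sub_add_cancel (by omega)).symm⟩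
  have hsum : ∑ j, v j + Fintype.card {b // Even (deg b)} = ∑ i : {b // Even (deg b)}, deg i.1 := by
    rw [Finset.sum_comm]
    simp only [Finset.sum_ite_eq, Finset.mem_univ, if_true]
    rw [Fintype.card, Finset.card_eq_sum_ones, ← Finset.sum_add_distrib]
    exact Finset.sum_congr rfl fun i _ => by have := hd.two_le i.1; omega
  have hun : ∑ j, u j ≤ n := by
    simp only [hu, Finset.sum_add_distrib] at hle
    omega
  refine ⟨fun b hb => ?_, fun b c hb hc hnb hnc => ?_⟩
  -- The partner has degree at least `2 deg b - 1` and share `deg b - 1`, so its remainder `u` is at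
  -- least `deg b`.
  · have h1 := hmd ⟨b, hb⟩
    have h2 := hu (m ⟨b, hb⟩)
    have h3 := hv ⟨b, hb⟩
    have h4 := hd.two_le b
    have h5 : u (m ⟨b, hb⟩) ≤ ∑ j, u j :=
      Finset.single_le_sum (fun _ _ => Nat.zero_le _) (Finset.mem_univ _)
    simp only at h1 h3
    omega
  · by_contra hne
    -- Each remainder satisfies `2 u ≥ deg + 1 ≥ n + 2`, so the two together exceed `n`.
    have h1 : u ⟨b, hb⟩ + u ⟨c, hc⟩ ≤ ∑ j, u j := by
      rw [← Finset.sum_pair (f := u) (by simpa using hne)]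
      exact Finset.sum_le_sum_of_subset (Finset.subset_univ _)
    have h2 := hu ⟨b, hb⟩
    have h3 := hu ⟨c, hc⟩
    have h4 := hv' ⟨b, hb⟩
    have h5 := hv' ⟨c, hc⟩
    simp only at h2 h3 h4 h5
    omega

end TopDegree

end SuperPoly

/-! ### The universal property of `ΛV`. -/

namespace FreeCGA

variable {V : ℕ → Type u} [∀ i, AddCommGroup (V i)] [∀ i, Module ℚ (V i)]

theorem gen_mul_gen (i j : ℕ) (x : V i) (y : V j) :
    gen V i x * gen V j y = (-1 : ℚ) ^ (i * j) • (gen V j y * gen V i x) := by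
  have := RingQuot.mkAlgHom_rel ℚ (Rel.comm (V := V) i j x y)
  rw [map_mul, map_smul, map_mul] at this
  exact this

theorem algHom_ext {C : Type*} [Semiring C] [Algebra ℚ C] {f g : FreeCGA V →ₐ[ℚ] C}
    (h : ∀ i x, f (gen V i x) = g (gen V i x)) : f = g := by
  refine RingQuot.ringQuot_ext' _ _ _ (TensorAlgebra.hom_ext (DirectSum.linearMap_ext ℚ fun i => ?_))
  ext x
  exact h i x

/-- Algebra maps out of `ΛV`. -/
noncomputable def lift {C : Type*} [Semiring C] [Algebra ℚ C] (f : ∀ i, V i →ₗ[ℚ] C)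
    (hf : ∀ i j x y, f i x * f j y = (-1 : ℚ) ^ (i * j) • (f j y * f i x)) :
    FreeCGA V →ₐ[ℚ] C :=
  RingQuot.liftAlgHom ℚ ⟨TensorAlgebra.lift ℚ (DirectSum.toModule ℚ ℕ C f), by
    rintro _ _ ⟨i, j, x, y⟩
    simp [hf i j x y]⟩

theorem lift_gen {C : Type*} [Semiring C] [Algebra ℚ C] (f : ∀ i, V i →ₗ[ℚ] C)
    (hf : ∀ i j x y, f i x * f j y = (-1 : ℚ) ^ (i * j) • (f j y * f i x)) (i : ℕ) (x : V i) :
    lift f hf (gen V i x) = f i x := by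
  have : lift f hf (gen V i x) = TensorAlgebra.lift ℚ (DirectSum.toModule ℚ ℕ C f)
      (TensorAlgebra.ι ℚ (DirectSum.lof ℚ ℕ V i x)) :=
    RingQuot.liftAlgHom_mkAlgHom_apply _ _ _ _
  rw [this]
  simp

end FreeCGA

namespace SuperPoly

open FreeCGA

/-! ### Passage from `ΛV` to coordinates. -/

section Transfer

variable (V : ℕ → Type u) [∀ i, AddCommGroup (V i)] [∀ i, Module ℚ (V i)]

/-- The index type of a homogeneous basis of `V`. -/
abbrev Index : Type := Σ i, Fin (Module.finrank ℚ (V i))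

/-- The degrees of the elements of a homogeneous basis of `V`. -/
abbrev degree : Index V → ℕ := Sigma.fst

variable [∀ i, Module.Finite ℚ (V i)]

/-- The inclusion of `V` in terms of a basis. -/
noncomputable def genMap (i : ℕ) : V i →ₗ[ℚ] SuperPoly (degree V) :=
  (Module.finBasis ℚ (V i)).constr ℚ fun k => X (degree V) ⟨i, k⟩

theorem genMap_basis (b : Index V) :
    genMap V b.1 (Module.finBasis ℚ (V b.1) b.2) = X (degree V) b :=
  (Module.finBasis ℚ (V b.1)).constr_basis ℚ _ b.2

theorem genMap_mem (i : ℕ) (x : V i) :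
    genMap V i x ∈ wspan (degree V) fun e => ∃ b, degree V b = i ∧ e = Finsupp.single b 1 := by
  rw [genMap, Module.Basis.constr_apply_fintype]
  exact Submodule.sum_mem _ fun k _ => Submodule.smul_mem _ _ (X_mem ⟨⟨i, k⟩, rfl, rfl⟩)

theorem hasParity_genMap (i : ℕ) (x : V i) : HasParity i (genMap V i x) :=
  hasParity_of_mem (by rintro _ ⟨b, hb, rfl⟩; rw [weight_single_one, hb]) (genMap_mem V i x)

/-- A free commutative graded algebra in terms of a basis. -/
noncomputable def equiv : FreeCGA V ≃ₐ[ℚ] SuperPoly (degree V) :=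
  AlgEquiv.ofAlgHom
    (FreeCGA.lift (genMap V) fun i j x y => (hasParity_genMap V i x).mul_comm (hasParity_genMap V j y))
    (SuperPoly.lift (fun b => gen V b.1 (Module.finBasis ℚ (V b.1) b.2)) fun b c =>
      gen_mul_gen _ _ _ _)
    (SuperPoly.algHom_ext fun b => by
      rw [AlgHom.comp_apply, lift_X, lift_gen, genMap_basis, AlgHom.id_apply])
    (FreeCGA.algHom_ext fun i x => by
      rw [AlgHom.comp_apply, lift_gen, AlgHom.id_apply]
      have : (SuperPoly.lift (fun b : Index V => gen V b.1 (Module.finBasis ℚ (V b.1) b.2))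
          fun b c => gen_mul_gen _ _ _ _).toLinearMap ∘ₗ genMap V i = gen V i :=
        (Module.finBasis ℚ (V i)).ext fun k => by
          rw [LinearMap.comp_apply, genMap_basis V ⟨i, k⟩, AlgHom.toLinearMap_apply, lift_X]
      exact LinearMap.congr_fun this x)

theorem equiv_gen (i : ℕ) (x : V i) : equiv V (gen V i x) = genMap V i x :=
  lift_gen _ _ i x

theorem equiv_symm_X (b : Index V) :
    (equiv V).symm (X (degree V) b) = gen V b.1 (Module.finBasis ℚ (V b.1) b.2) :=
  lift_X _ _ b

theorem isMonomial_symm_word (l : List (Index V)) :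
    IsMonomial V (Finsupp.weight (degree V) (cnt l)) ((equiv V).symm (word (degree V) l)) := by
  induction l with
  | nil => rw [cnt_nil, map_zero, word_nil, map_one]; exact .one
  | cons b l ih =>
    rw [cnt_cons, map_add, weight_single_one, word_cons, map_mul, equiv_symm_X]
    exact .mul _ _ _ _ ih

theorem mem_degreePart_iff (k : ℕ) (a : FreeCGA V) : a ∈ degreePart V k ↔
    equiv V a ∈ wspan (degree V) fun e => Finsupp.weight (degree V) e = k := by
  constructor
  · intro ha
    refine (Submodule.span_le (p := (wspan (degree V) fun e => Finsupp.weight (degree V) e = k).comap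
      (equiv V).toLinearMap)).2 ?_ ha
    clear ha
    intro m hm
    simp only [Submodule.comap_coe, Set.mem_preimage, SetLike.mem_coe, AlgEquiv.toLinearMap_apply]
    induction hm with
    | one => rw [map_one]; exact one_mem_wspan (map_zero _)
    | mul i j x m _ ih =>
      rw [map_mul, equiv_gen]
      refine mul_mem_wspan ?_ (genMap_mem V i x) ih
      rintro _ f ⟨b, hb, rfl⟩ hf
      rw [map_add, weight_single_one, hb, hf]
  · intro ha
    rw [← (equiv V).symm_apply_apply a]
    refine map_mem_of_mem_wspan (N := degreePart V k) (equiv V).symm.toLinearMap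
      (fun l hl => ?_) ha
    exact Submodule.subset_span (hl ▸ isMonomial_symm_word V l)

theorem equiv_mem_of_mem_decomposables {a : FreeCGA V} (ha : a ∈ decomposables V) :
    equiv V a ∈ wspan (degree V) fun e => 2 ≤ len _ e := by
  have hgen : ∀ a ∈ generators V, equiv V a ∈ wspan (degree V) fun e => 1 ≤ len _ e := by
    intro a ha
    refine (iSup_le fun i => ?_ : generators V ≤ (wspan (degree V) fun e => 1 ≤ len _ e).comap
      (equiv V).toLinearMap) ha
    rintro _ ⟨x, rfl⟩
    rw [Submodule.mem_comap, AlgEquiv.toLinearMap_apply, equiv_gen]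
    refine wspan_mono ?_ (genMap_mem V i x)
    rintro _ ⟨b, -, rfl⟩
    rw [weight_single_one]
  have h2 : ∀ a ∈ generators V * generators V,
      equiv V a ∈ wspan (degree V) fun e => 2 ≤ len _ e := by
    intro a ha
    induction ha using Submodule.mul_induction_on' with
    | mem_mul_mem x hx y hy =>
      rw [map_mul]
      exact mul_mem_wspan (fun e f he hf => by rw [map_add]; omega) (hgen x hx) (hgen y hy)
    | add x _ y _ hx hy => rw [map_add]; exact add_mem hx hy
  induction ha using Submodule.mul_induction_on' with
  | mem_mul_mem x hx y hy =>
    rw [map_mul]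
    exact mul_mem_wspan (Q := fun _ => True) (fun e f he hf => by rw [map_add]; omega) (h2 x hx)
      (by rw [wspan_true]; trivial)
  | add x _ y _ hx hy => rw [map_add]; exact add_mem hx hy

theorem mem_subLE_iff (k : ℕ) (a : FreeCGA V) : a ∈ subLE V k ↔
    equiv V a ∈ wspan (degree V) fun e => ∀ c, e c ≠ 0 → degree V c ≤ k := by
  constructor
  · intro ha
    induction ha using Algebra.adjoin_induction with
    | mem x hx =>
      obtain ⟨i, x, hx, rfl⟩ := hx
      rw [equiv_gen]
      by_cases hi : i ≤ k
      · refine wspan_mono ?_ (genMap_mem V i x)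
        rintro _ ⟨b, rfl, rfl⟩ c hc
        rw [Finsupp.single_apply_ne_zero] at hc
        rw [hc.1]; exact hi
      · beta_reduce at hx
        rw [if_neg hi, Submodule.mem_bot] at hx
        rw [hx, map_zero]; exact zero_mem _
    | algebraMap r =>
      rw [AlgEquiv.commutes, Algebra.algebraMap_eq_smul_one]
      exact Submodule.smul_mem _ _ (one_mem_wspan (by simp))
    | add x y _ _ hx hy => rw [map_add]; exact add_mem hx hy
    | mul x y _ _ hx hy =>
      rw [map_mul]
      refine mul_mem_wspan (fun e f he hf c hc => ?_) hx hy
      rw [Finsupp.add_apply] at hc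
      by_cases h : e c = 0
      · exact hf c (by omega)
      · exact he c h
  · intro ha
    rw [← (equiv V).symm_apply_apply a]
    refine map_mem_of_mem_wspan (N := Subalgebra.toSubmodule (subLE V k))
      (equiv V).symm.toLinearMap (fun l hl => ?_) ha
    rw [Subalgebra.mem_toSubmodule, AlgEquiv.toLinearMap_apply]
    induction l with
    | nil => rw [word_nil, map_one]; exact one_mem _
    | cons b l ih =>
      rw [word_cons, map_mul, equiv_symm_X]
      refine mul_mem (Algebra.subset_adjoin ⟨b.1, _, ?_, rfl⟩) (ih fun c hc => hl c ?_)
      · beta_reduce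
        rw [if_pos (hl b (by simp))]; trivial
      · rw [cnt_cons, Finsupp.add_apply]; omega

variable {V}

/-- The differential of a Sullivan algebra in terms of a basis. -/
noncomputable def diff (A : SullivanAlgebra V) :
    SuperPoly (degree V) →ₗ[ℚ] SuperPoly (degree V) :=
  (equiv V).toLinearMap ∘ₗ A.d ∘ₗ (equiv V).symm.toLinearMap

theorem diff_apply (A : SullivanAlgebra V) (x : SuperPoly (degree V)) :
    diff A x = equiv V (A.d ((equiv V).symm x)) := rfl

theorem diff_equiv (A : SullivanAlgebra V) (a : FreeCGA V) :
    diff A (equiv V a) = equiv V (A.d a) := by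
  rw [diff_apply, AlgEquiv.symm_apply_apply]

/-- The axioms on `A.d` concern homogeneous elements; words are homogeneous and span, so the Leibniz
rule extends with `sgn` in place of the sign of the degree. Generators have degree at least two
because `V^0` and `V^1` vanish. -/
theorem isMinimalDifferential_diff (A : SullivanAlgebra V) (hsc : A.IsSimplyConnected)
    (hmin : A.IsMinimal) : IsMinimalDifferential (diff A) := by
  have hword : ∀ l, (equiv V).symm (word (degree V) l) ∈
      degreePart V (Finsupp.weight (degree V) (cnt l)) := fun l =>
    Submodule.subset_span (isMonomial_symm_word V l)
  have hdeg : ∀ l, diff A (word (degree V) l) ∈ wspan (degree V) fun e =>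
      Finsupp.weight (degree V) e = Finsupp.weight (degree V) (cnt l) + 1 := fun l => by
    rw [diff_apply, ← mem_degreePart_iff]
    exact A.d_mem _ _ (hword l)
  have hsgn : ∀ a, sgn (diff A a) = - diff A (sgn a) := by
    intro a
    induction a using word_induction with
    | hw l =>
      have h1 := hasParity_of_mem (i := Finsupp.weight (degree V) (cnt l) + 1)
        (fun e he => by rw [he]) (hdeg l)
      have h2 := hasParity_word (deg := degree V) l
      rw [← weight_cnt] at h2
      rw [h1, h2, map_smul, pow_succ, mul_neg_one, neg_smul]
    | hadd x y hx hy => rw [map_add, map_add, map_add, map_add, hx, hy, neg_add]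
    | hsmul r x hx => rw [map_smul, map_smul, map_smul, map_smul, hx, smul_neg]
  refine ⟨⟨fun a b => ?_, fun a i ha => ?_⟩, fun x => ?_, fun b => ?_, fun b => ?_⟩
  · induction a using word_induction with
    | hw l =>
      rw [diff_apply, map_mul, A.leibniz _ _ _ (hword l), map_add, map_smul, map_mul, map_mul,
        AlgEquiv.apply_symm_apply, AlgEquiv.apply_symm_apply, sgnPow_word, one_mul, weight_cnt,
        smul_mul_assoc]
      rfl
    | hadd x y hx hy => rw [add_mul, map_add, hx, hy, map_add, map_add, add_mul, add_mul]; abel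
    | hsmul r x hx =>
      rw [smul_mul_assoc, map_smul, hx, map_smul, map_smul, smul_mul_assoc, smul_mul_assoc, smul_add]
  · rw [HasParity, hsgn, ha, map_smul, pow_succ, mul_neg_one, neg_smul]
  · rw [diff_apply, diff_apply, AlgEquiv.symm_apply_apply, A.d_d, map_zero]
  · obtain ⟨i, k⟩ := b
    by_contra hcon
    have hsub : Subsingleton (V i) := by
      have hi : i = 0 ∨ i = 1 := by simp only [degree] at hcon; omega
      rcases hi with rfl | rfl
      · exact A.positive
      · exact hsc
    exact Fin.elim0 (Fin.cast (Module.finrank_zero_of_subsingleton) k)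
  · refine mem_wspan_and ?_ ?_
    · rw [diff_apply, equiv_symm_X]
      exact equiv_mem_of_mem_decomposables V (hmin _ _)
    · have h := hdeg [b]
      rwa [word_cons, word_nil, mul_one, cnt_cons, cnt_nil, add_zero, weight_single_one] at h

theorem exists_diff_eq (A : SullivanAlgebra V) {n : ℕ} (hn : A.IsFormalDimension n) (k : ℕ)
    (hk : n ≤ k) (a : SuperPoly (degree V))
    (ha : a ∈ wspan (degree V) fun e => Finsupp.weight (degree V) e = k + 1) (hda : diff A a = 0) :
    ∃ b ∈ wspan (degree V) fun e => Finsupp.weight (degree V) e = k, diff A b = a := by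
  have h1 : Subsingleton (A.H (k + 1)) := by
    rw [← not_nontrivial_iff_subsingleton]
    intro h
    have := hn.2 h
    omega
  obtain ⟨a, rfl⟩ := (equiv V).surjective a
  rw [diff_equiv, map_eq_zero_iff _ (equiv V).injective] at hda
  have hc : a ∈ A.cocycles ⊤ (k + 1) :=
    ⟨⟨trivial, (mem_degreePart_iff V _ a).2 ha⟩, LinearMap.mem_ker.2 hda⟩
  have h2 : (⟨a, hc⟩ : A.cocycles ⊤ (k + 1)) ∈
      (A.coboundaries ⊤ (k + 1)).submoduleOf (A.cocycles ⊤ (k + 1)) :=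
    (Submodule.Quotient.mk_eq_zero _).1 (Subsingleton.elim _ _)
  obtain ⟨b, ⟨-, hb⟩, hba⟩ := h2
  refine ⟨equiv V b, (mem_degreePart_iff V _ b).1 hb, ?_⟩
  rw [diff_equiv]
  exact congrArg _ hba

end Transfer

end SuperPoly

namespace SuperPoly

open FreeCGA

/-! ### Indecomposables and the groups `L^i` above the formal dimension. -/

section Generators

variable {γ : Type*} {deg : γ → ℕ}

theorem IsMinimalDifferential.map_mem_len {d : SuperPoly deg →ₗ[ℚ] SuperPoly deg}
    (hd : IsMinimalDifferential d) (x : SuperPoly deg) : d x ∈ wspan deg fun e => 2 ≤ len γ e :=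
  hd.isDer.mem_wspan hd.map_X (P := fun _ => True)
    (fun _ e f _ hf => by rw [map_add]; omega) (by rw [wspan_true]; trivial)

theorem exists_ne_zero_of_weight_ne_zero {w : γ → ℕ} {e : γ →₀ ℕ} (h : Finsupp.weight w e ≠ 0) :
    ∃ c, e c ≠ 0 := by
  by_contra hcon
  push Not at hcon
  exact h (by rw [Finsupp.ext (g := 0) hcon, map_zero])

/-- A single letter of degree at most `m` cannot account for degree `m + 1`: elements of `Λ(V^{≤
m})` of this degree are decomposable. -/
theorem two_le_len {m : ℕ} {e : γ →₀ ℕ} (hw : Finsupp.weight deg e = m + 1)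
    (he : ∀ c, e c ≠ 0 → deg c ≤ m) : 2 ≤ len γ e := by
  obtain ⟨c, hc⟩ := exists_ne_zero_of_weight_ne_zero (w := deg) (e := e) (by omega)
  have h1 := he c hc
  obtain ⟨e', rfl⟩ := exists_single_add hc
  rw [map_add, weight_single_one] at hw
  obtain ⟨c', hc'⟩ := exists_ne_zero_of_weight_ne_zero (w := deg) (e := e') (by omega)
  obtain ⟨e'', rfl⟩ := exists_single_add hc'
  rw [map_add, map_add, weight_single_one, weight_single_one]
  omega

theorem eq_single_of_weight (h2 : ∀ b, 2 ≤ deg b) {e : γ →₀ ℕ} {c : γ} (hc : e c ≠ 0)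
    (hw : Finsupp.weight deg e ≤ deg c) :
    e = Finsupp.single c 1 ∧ Finsupp.weight deg e = deg c := by
  obtain ⟨e', rfl⟩ := exists_single_add hc
  rw [map_add, weight_single_one] at hw ⊢
  have : e' = 0 := by
    by_contra hne
    obtain ⟨c', hc'⟩ : ∃ c', e' c' ≠ 0 := by
      by_contra hcon
      push Not at hcon
      exact hne (Finsupp.ext hcon)
    obtain ⟨e'', rfl⟩ := exists_single_add hc'
    rw [map_add, weight_single_one] at hw
    have := h2 c'
    omega
  simp [this]

theorem finite_wspan_weight [Finite γ] (h2 : ∀ b, 2 ≤ deg b) (k : ℕ) :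
    Module.Finite ℚ (wspan deg fun e => Finsupp.weight deg e = k) := by
  have hfin := Finsupp.finite_of_nat_weight_eq deg (fun b => by have := h2 b; omega) k
  rw [wspan_eq_span_image]
  exact Module.Finite.span_of_finite ℚ
    (Set.Finite.image _ (hfin.preimage Subtype.val_injective.injOn))

end Generators

section Transfer

variable {V : ℕ → Type u} [∀ i, AddCommGroup (V i)] [∀ i, Module ℚ (V i)]
  [∀ i, Module.Finite ℚ (V i)]

theorem pd_genMap (b : Index V) (x : V b.1) :
    pd (degree V) b (genMap V b.1 x) =
      algebraMap ℚ _ ((Module.finBasis ℚ (V b.1)).repr x b.2) := by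
  obtain ⟨i, k⟩ := b
  have : pd (degree V) ⟨i, k⟩ ∘ₗ genMap V i =
      Algebra.linearMap ℚ (SuperPoly (degree V)) ∘ₗ (Module.finBasis ℚ (V i)).coord k :=
    (Module.finBasis ℚ (V i)).ext fun j => by
      rw [LinearMap.comp_apply, genMap_basis V ⟨i, j⟩, LinearMap.comp_apply,
        Module.Basis.coord_apply, Module.Basis.repr_self, Algebra.linearMap_apply]
      by_cases h : j = k
      · subst h; simp
      · rw [pd_of_ne (by simpa using h), Finsupp.single_eq_of_ne (Ne.symm h), map_zero]
  exact LinearMap.congr_fun this x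

/-- A combination of one-letter monomials supported on longer words is zero, and the partial
derivatives read off the coordinates of `x`. -/
theorem eq_zero_of_genMap_mem {i : ℕ} {x : V i}
    (hx : genMap V i x ∈ wspan (degree V) fun e => 2 ≤ len _ e) : x = 0 := by
  have h0 : genMap V i x = 0 := by
    have h := wspan_mono (Q := fun _ => False) (by
      rintro _ ⟨h1, b, -, rfl⟩
      rw [weight_single_one] at h1
      omega) (mem_wspan_and hx (genMap_mem V i x))
    rwa [wspan_false] at h
  refine (Module.finBasis ℚ (V i)).repr.map_eq_zero_iff.1 (Finsupp.ext fun k => ?_)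
  have h := pd_genMap ⟨i, k⟩ x
  rw [h0, map_zero] at h
  have h1 := congrArg aug h
  rw [map_zero, AlgHom.commutes] at h1
  exact h1.symm

/-- All generators have positive degree, so a word of degree `m + 1` with a letter of degree above
`m` consists of that letter alone. -/
theorem exists_eq_gen_add (h2 : ∀ b : Index V, 2 ≤ degree V b) {m : ℕ} {a : FreeCGA V}
    (ha : a ∈ degreePart V (m + 1)) :
    ∃ v : V (m + 1), ∃ s ∈ degreePart V (m + 1), s ∈ subLE V m ∧ a = gen V (m + 1) v + s := by
  have key : equiv V a ∈ LinearMap.range (genMap V (m + 1)) ⊔ wspan (degree V) fun e =>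
      Finsupp.weight (degree V) e = m + 1 ∧ ∀ c, e c ≠ 0 → degree V c ≤ m := by
    refine map_mem_of_mem_wspan LinearMap.id (fun l hl => ?_) ((mem_degreePart_iff V _ a).1 ha)
    rw [LinearMap.id_apply]
    by_cases h : ∀ c, cnt l c ≠ 0 → degree V c ≤ m
    · exact Submodule.mem_sup_right (word_mem ⟨hl, h⟩)
    · push Not at h
      obtain ⟨c, hc, hcm⟩ := h
      obtain ⟨h3, h4⟩ := eq_single_of_weight h2 hc (by omega)
      obtain ⟨r, -, hr⟩ := exists_word_of_cnt (deg := degree V) (l := l) (l' := [c])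
        (by rw [h3]; simp)
      obtain ⟨i, k⟩ := c
      obtain rfl : i = m + 1 := h4.symm.trans hl
      refine Submodule.mem_sup_left ⟨r • Module.finBasis ℚ (V (m + 1)) k, ?_⟩
      rw [map_smul, genMap_basis V ⟨m + 1, k⟩, hr, word_cons, word_nil, mul_one]
  obtain ⟨_, ⟨v, rfl⟩, s, hs, h⟩ := Submodule.mem_sup.1 key
  refine ⟨v, (equiv V).symm s, ?_, ?_, (equiv V).injective ?_⟩
  · rw [mem_degreePart_iff, AlgEquiv.apply_symm_apply]
    exact wspan_mono (fun _ h => h.1) hs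
  · rw [mem_subLE_iff, AlgEquiv.apply_symm_apply]
    exact wspan_mono (fun _ h => h.2) hs
  · rw [map_add, equiv_gen, AlgEquiv.apply_symm_apply, h]

theorem map_gen_mem_cocycles (A : SullivanAlgebra V) (hsc : A.IsSimplyConnected)
    (hmin : A.IsMinimal) (m : ℕ) (v : V (m + 1)) :
    A.d (gen V (m + 1) v) ∈ A.cocycles (subLE V m) (m + 2) := by
  have hd := isMinimalDifferential_diff A hsc hmin
  have h1 : gen V (m + 1) v ∈ degreePart V (m + 1) := by
    rw [mem_degreePart_iff, equiv_gen]
    refine wspan_mono ?_ (genMap_mem V _ v)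
    rintro _ ⟨b, hb, rfl⟩
    rw [weight_single_one, hb]
  have h2 := A.d_mem _ _ h1
  refine ⟨⟨?_, h2⟩, LinearMap.mem_ker.2 (A.d_d _)⟩
  rw [SetLike.mem_coe, Subalgebra.mem_toSubmodule, mem_subLE_iff]
  have h3 := hd.map_mem_len (equiv V (gen V (m + 1) v))
  rw [diff_equiv] at h3
  refine wspan_mono ?_ (mem_wspan_and h3 ((mem_degreePart_iff V _ _).1 h2))
  rintro e ⟨h4, h5⟩ c hc
  have := deg_add_two_le hd.two_le h4 hc
  omega

/-- The map is `v ↦ [∂v]`. If `∂v = ∂a` with `a ∈ Λ(V^{≤ m})`, then `v - a` is a cocycle of degree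
`m + 1 > n`, hence a boundary and decomposable; so is `a`, hence `v = 0`. Conversely, a cocycle of
degree `m + 2` is `∂(v + s)` with `v ∈ V^{m+1}` and `s ∈ Λ(V^{≤ m})`, so its class is that of `∂v`.
-/
theorem nonempty_equiv_L (A : SullivanAlgebra V) (hsc : A.IsSimplyConnected)
    (hmin : A.IsMinimal) {n : ℕ} (hn : A.IsFormalDimension n) {m : ℕ} (hm : n ≤ m) :
    Nonempty (V (m + 1) ≃ₗ[ℚ] A.L (m + 2)) := by
  have hd := isMinimalDifferential_diff A hsc hmin
  let f : V (m + 1) →ₗ[ℚ] A.cocycles (subLE V m) (m + 2) :=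
    (A.d ∘ₗ gen V (m + 1)).codRestrict _ (map_gen_mem_cocycles A hsc hmin m)
  let g : V (m + 1) →ₗ[ℚ] A.L (m + 2) := (Submodule.mkQ _) ∘ₗ f
  refine ⟨LinearEquiv.ofBijective g ⟨?_, ?_⟩⟩
  · rw [← LinearMap.ker_eq_bot, LinearMap.ker_eq_bot']
    intro v hv
    have h1 : f v ∈ (A.coboundaries (subLE V m) (m + 2)).submoduleOf
        (A.cocycles (subLE V m) (m + 2)) := (Submodule.Quotient.mk_eq_zero _).1 hv
    obtain ⟨a, ⟨ha1, ha2⟩, ha3⟩ := h1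
    have ha4 : A.d a = A.d (gen V (m + 1) v) := ha3
    rw [SetLike.mem_coe, Subalgebra.mem_toSubmodule, mem_subLE_iff] at ha1
    rw [SetLike.mem_coe, mem_degreePart_iff] at ha2
    obtain ⟨c, -, hc⟩ := exists_diff_eq A hn m hm (equiv V (gen V (m + 1) v) - equiv V a)
      (sub_mem (by
        rw [equiv_gen]
        refine wspan_mono ?_ (genMap_mem V _ v)
        rintro _ ⟨b, hb, rfl⟩
        rw [weight_single_one, hb]) ha2)
      (by rw [map_sub, diff_equiv, diff_equiv, ha4, sub_self])
    refine eq_zero_of_genMap_mem ?_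
    rw [← equiv_gen, ← sub_add_cancel (equiv V (gen V (m + 1) v)) (equiv V a), ← hc]
    exact add_mem (hd.map_mem_len c)
      (wspan_mono (fun e he => two_le_len he.1 he.2) (mem_wspan_and ha2 ha1))
  · intro q
    obtain ⟨z, rfl⟩ := Submodule.mkQ_surjective _ q
    obtain ⟨⟨hz1, hz2⟩, hz3⟩ := z.2
    obtain ⟨a, ha, haz⟩ := exists_diff_eq A hn (m + 1) (by omega) (equiv V z.1)
      ((mem_degreePart_iff V _ _).1 hz2) (by rw [diff_equiv, LinearMap.mem_ker.1 hz3, map_zero])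
    obtain ⟨a, rfl⟩ := (equiv V).surjective a
    rw [diff_equiv, (equiv V).injective.eq_iff] at haz
    obtain ⟨v, s, hs1, hs2, rfl⟩ := exists_eq_gen_add hd.two_le ((mem_degreePart_iff V _ _).2 ha)
    refine ⟨v, (Submodule.Quotient.eq _).2 ⟨-s, ⟨neg_mem hs2, neg_mem hs1⟩, ?_⟩⟩
    have : A.d (gen V (m + 1) v) - z.1 = A.d (-s) := by
      rw [← haz, map_add, map_neg]; abel
    exact this.symm

theorem finite_L [Finite (Index V)] (A : SullivanAlgebra V) (hsc : A.IsSimplyConnected)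
    (hmin : A.IsMinimal) (i : ℕ) : Module.Finite ℚ (A.L i) := by
  have hd := isMinimalDifferential_diff A hsc hmin
  have := finite_wspan_weight hd.two_le i
  let f : A.cocycles (subLE V (i - 2)) i →ₗ[ℚ]
      wspan (degree V) fun e => Finsupp.weight (degree V) e = i :=
    ((equiv V).toLinearMap ∘ₗ Submodule.subtype _).codRestrict _ fun a =>
      (mem_degreePart_iff V _ _).1 a.2.1.2
  have : Module.Finite ℚ (A.cocycles (subLE V (i - 2)) i) :=
    Module.Finite.of_injective f fun a b h =>
      Subtype.ext ((equiv V).injective (congrArg Subtype.val h))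
  infer_instance

end Transfer

end SuperPoly

/-! ### The alternating sum and the conclusion. -/

namespace SuperPoly

theorem moduleFinite_of_directSum (V : ℕ → Type u) [∀ i, AddCommGroup (V i)] [∀ i, Module ℚ (V i)]
    [Module.Finite ℚ (⨁ i, V i)] (i : ℕ) : Module.Finite ℚ (V i) :=
  Module.Finite.of_injective (DirectSum.lof ℚ ℕ V i) (DirectSum.of_injective i)

theorem finite_index (V : ℕ → Type u) [∀ i, AddCommGroup (V i)] [∀ i, Module ℚ (V i)]
    [h : Module.Finite ℚ (⨁ i, V i)] [∀ i, Module.Finite ℚ (V i)] : Finite (Index V) := by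
  have : Module.Finite ℚ (Π₀ i, V i) := h
  exact Module.Finite.finite_basis (DFinsupp.basis fun i => Module.finBasis ℚ (V i))

/-- Comparison of an alternating series with a truncation whose remaining terms are nonnegative. -/
theorem rho_sub_bounds {ℓ v : ℕ → ℕ} {n M : ℕ} (hℓ : ∀ m, n ≤ m → ℓ (m + 2) = v (m + 1))
    (hM : ∀ k, M ≤ k → v k = 0) (heven : ∀ k, Even k → n < k → v k = 0)
    (hodd : ∀ K : ℕ, ∑ k ∈ (Finset.range K).filter (fun k => Odd k ∧ n < k), v k ≤ 1) :
    0 ≤ (1 + ((∑ᶠ j : ℕ, ℓ (2 * j + 4) : ℕ) : ℤ) - ((∑ᶠ j : ℕ, ℓ (2 * j + 5) : ℕ) : ℤ)) -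
      ∑ i ∈ Finset.Icc 4 (n + 1), (-1 : ℤ) ^ i * (ℓ i : ℤ) ∧
    (1 + ((∑ᶠ j : ℕ, ℓ (2 * j + 4) : ℕ) : ℤ) - ((∑ᶠ j : ℕ, ℓ (2 * j + 5) : ℕ) : ℤ)) -
      ∑ i ∈ Finset.Icc 4 (n + 1), (-1 : ℤ) ^ i * (ℓ i : ℤ) ≤ 2 := by
  obtain ⟨K, hK⟩ : ∃ K, K = n + M := ⟨_, rfl⟩
  have hz : ∀ i, 2 * K + 4 ≤ i → ℓ i = 0 := fun i hi => by
    obtain ⟨m, rfl⟩ : ∃ m, i = m + 2 := ⟨i - 2, by omega⟩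
    rw [hℓ m (by omega), hM _ (by omega)]
  have h1 : ∀ c, 4 ≤ c → ∑ᶠ j : ℕ, ℓ (2 * j + c) = ∑ j ∈ Finset.range K, ℓ (2 * j + c) :=
    fun c hc => finsum_eq_sum_of_support_subset _ fun j hj => by
      rw [Finset.coe_range, Set.mem_Iio]
      by_contra hcon
      exact hj (hz _ (by omega))
  have h2 : ∀ K, (((∑ j ∈ Finset.range K, ℓ (2 * j + 4) : ℕ) : ℤ) -
      ((∑ j ∈ Finset.range K, ℓ (2 * j + 5) : ℕ) : ℤ)) =
      ∑ i ∈ Finset.Ico 4 (2 * K + 4), (-1 : ℤ) ^ i * (ℓ i : ℤ) := by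
    intro K
    induction K with
    | zero => simp
    | succ K ih =>
      rw [show 2 * (K + 1) + 4 = 2 * K + 4 + 1 + 1 by ring,
        Finset.sum_Ico_succ_top (by omega), Finset.sum_Ico_succ_top (by omega), ← ih,
        Finset.sum_range_succ, Finset.sum_range_succ,
        (show Even (2 * K + 4) from ⟨K + 2, by ring⟩).neg_one_pow,
        (show Odd (2 * K + 4 + 1) from ⟨K + 2, by ring⟩).neg_one_pow]
      push_cast
      ring
  have h3 : Finset.Icc 4 (n + 1) = (Finset.Ico 4 (2 * K + 4)).filter (fun i => i < n + 2) := by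
    ext i
    simp only [Finset.mem_Icc, Finset.mem_filter, Finset.mem_Ico]
    omega
  -- In the tail `i ≥ n + 2` the term is `(-1)^i v (i - 1)`; only odd `i - 1` contribute, with a
  -- positive sign, so the tail lies in `[0, 1]`. Together with the `1` in `ρ` this gives the
  -- bounds.
  have h4 : ∑ i ∈ (Finset.Ico 4 (2 * K + 4)).filter (fun i => ¬ i < n + 2),
      (-1 : ℤ) ^ i * (ℓ i : ℤ) ≤ 1 ∧ 0 ≤ ∑ i ∈ (Finset.Ico 4 (2 * K + 4)).filter
        (fun i => ¬ i < n + 2), (-1 : ℤ) ^ i * (ℓ i : ℤ) := by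
    have h5 : ∀ i ∈ (Finset.Ico 4 (2 * K + 4)).filter (fun i => ¬ i < n + 2),
        (-1 : ℤ) ^ i * (ℓ i : ℤ) = if Odd (i - 1) then (v (i - 1) : ℤ) else 0 := by
      intro i hi
      rw [Finset.mem_filter, Finset.mem_Ico] at hi
      obtain ⟨m, rfl⟩ : ∃ m, i = m + 2 := ⟨i - 2, by omega⟩
      rw [hℓ m (by omega), show m + 2 - 1 = m + 1 by omega]
      split_ifs with h
      · rw [show (m + 2) = (m + 1) + 1 by ring, h.add_one.neg_one_pow, one_mul]
      · rw [heven _ (Nat.not_odd_iff_even.1 h) (by omega)]; simp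
    rw [Finset.sum_congr rfl h5]
    refine ⟨?_, Finset.sum_nonneg fun i _ => by split_ifs <;> simp⟩
    rw [← Finset.sum_filter]
    have h6 : ∑ i ∈ ((Finset.Ico 4 (2 * K + 4)).filter (fun i => ¬ i < n + 2)).filter
        (fun i => Odd (i - 1)), v (i - 1) ≤ 1 := by
      refine le_trans ?_ (hodd (2 * K + 4))
      rw [← Finset.sum_image (f := v) (g := fun i => i - 1)]
      · refine Finset.sum_le_sum_of_subset fun k hk => ?_
        simp only [Finset.mem_image, Finset.mem_filter, Finset.mem_Ico, Finset.mem_range] at hk ⊢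
        obtain ⟨i, ⟨hi, ho⟩, rfl⟩ := hk
        exact ⟨by omega, ho, by omega⟩
      · intro i hi j hj h
        simp only [Finset.coe_filter, Set.mem_ofPred_eq, Finset.mem_filter, Finset.mem_Ico] at hi hj
        simp only at h
        omega
    exact_mod_cast h6
  have h7 := Finset.sum_filter_add_sum_filter_not (Finset.Ico 4 (2 * K + 4))
    (fun i => i < n + 2) (fun i => (-1 : ℤ) ^ i * (ℓ i : ℤ))
  rw [← h2 K] at h7
  rw [h1 4 le_rfl, h1 5 (by omega), h3]
  omega

end SuperPoly

theorem proposition2p3 (V : ℕ → Type u) [∀ i, AddCommGroup (V i)] [∀ i, Module ℚ (V i)]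
    (A : SullivanAlgebra V) (hsc : A.IsSimplyConnected) (hmin : A.IsMinimal)
    (hell : A.IsElliptic) (n : ℕ) (hn : A.IsFormalDimension n) :
    (∀ i, 2 ≤ i → Module.Finite ℚ (A.L i)) ∧
    {i : ℕ | 2 ≤ i ∧ Nontrivial (A.L i)}.Finite ∧
    0 ≤ A.rho - ∑ i ∈ Finset.Icc 4 (n + 1), (-1 : ℤ) ^ i * (Module.finrank ℚ (A.L i) : ℤ) ∧
    A.rho - ∑ i ∈ Finset.Icc 4 (n + 1), (-1 : ℤ) ^ i * (Module.finrank ℚ (A.L i) : ℤ) ≤ 2 := by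
  have := hell.2
  have hfin := SuperPoly.moduleFinite_of_directSum V
  have hidx := SuperPoly.finite_index V
  have hL := SuperPoly.finite_L A hsc hmin
  have hd := SuperPoly.isMinimalDifferential_diff A hsc hmin
  obtain ⟨heven, hodd⟩ := SuperPoly.generators_of_large_degree hd (SuperPoly.exists_diff_eq A hn)
  have hrank : ∀ m, n ≤ m →
      Module.finrank ℚ (A.L (m + 2)) = Module.finrank ℚ (V (m + 1)) := fun m hm =>
    ((SuperPoly.nonempty_equiv_L A hsc hmin hn hm).some.finrank_eq).symm
  obtain ⟨M, hM⟩ := (Set.finite_range (SuperPoly.degree V)).bddAbove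
  have hzero : ∀ k, (¬ ∃ b : SuperPoly.Index V, SuperPoly.degree V b = k) →
      Module.finrank ℚ (V k) = 0 := by
    intro k hk
    by_contra h
    exact hk ⟨⟨k, ⟨0, Nat.pos_of_ne_zero h⟩⟩, rfl⟩
  have hvM : ∀ k, M + 1 ≤ k → Module.finrank ℚ (V k) = 0 := fun k hk => hzero k <| by
    rintro ⟨b, hb⟩
    have := hM ⟨b, rfl⟩
    omega
  have hbounds := SuperPoly.rho_sub_bounds (ℓ := fun i => Module.finrank ℚ (A.L i))
    (v := fun k => Module.finrank ℚ (V k)) hrank hvM ?_ ?_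
  · refine ⟨fun i _ => hL i, ?_, hbounds⟩
    refine (Set.finite_Iic (n + M + 4)).subset fun i hi => ?_
    by_contra hcon
    rw [Set.mem_Iic] at hcon
    obtain ⟨m, rfl⟩ : ∃ m, i = m + 2 := ⟨i - 2, by omega⟩
    have h1 := hrank m (by omega)
    have := hL (m + 2)
    rw [hvM _ (by omega), Module.finrank_zero_iff] at h1
    exact not_nontrivial_iff_subsingleton.2 h1 hi.2
  · refine fun k hk hnk => hzero k ?_
    rintro ⟨b, rfl⟩
    have := heven b hk
    omega
  · intro K
    -- The sum of dimensions counts the basis elements of odd degree above `n`, of which `hodd`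
    -- allows at most one.
    have h1 := Finset.card_sigma ((Finset.range K).filter fun k => Odd k ∧ n < k)
      fun k => (Finset.univ : Finset (Fin (Module.finrank ℚ (V k))))
    simp only [Finset.card_univ, Fintype.card_fin] at h1
    rw [← h1, Finset.card_le_one]
    intro b hb c hc
    simp only [Finset.mem_sigma, Finset.mem_filter] at hb hc
    exact hodd b c hb.1.2.1 hc.1.2.1 hb.1.2.2 hc.1.2.2
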